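/- **Setting.** Let $f\in C^1[0,1]$ with $f(0)=f(1)=0$, $f\ge 0$ on $(0,1)$, $f\not\equiv 0$, and let $H,\kappa,v_0>0$, $l=\kappa/v_0$, $\Omega=\mathbb R_x\times[0,H]_y$. Let $u=(u_1,u_2)(x,y)$ be a time-independent $C^1$ velocity on $\Omega$ that is periodic in $x$, incompressible ($\nabla\cdot u=0$) and has mean zero, $\int_0^H u_1(x,y)\,dy=0$ for all $x$; consider either Neumann conditions at $y=0,H$, with $u_2=0$ there, or periodic conditions, with $u$ being $H$-periodic in $y$ (so that $\Omega$ becomes a cylinder). Let $T(x,y,t)\in[0,1]$ be a classical solution of $$T_t+u\cdot\nabla T=\kappa\Delta T+\frac{v_0^2}{\kappa}f(T),\quad t>0,\qquad T(x,y,0)=T_0(x,y),$$ with $T\to1$ as $x\to-\infty$, $T\to0$ as $x\to+\infty$, and with the Neumann condition $T_y=0$ at $y=0,H$, respectively $T(x,y+H,t)=T(x,y,t)$. Let the initial data satisfy, for some $\lambda>0$, $T_0=1-O(e^{\lambda x})$ for $x<0$, $T_0=O(e^{-\lambda x})$ for $x>0$, $|\nabla T_0|=O(e^{-\lambda|x|})$,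 and $$\kappa\Delta T_0+\frac{v_0^2}{\kappa}f(T_0)-u\cdot\nabla T_0\ge0$$ (the condition on the initial data under which $T_t\ge0$). **Percolating flow.** Let $D_1,\dots,D_N$ be finitely many pairwise non-overlapping tubes of streamlines of $u$ (the tubes $D_j^+$ and $D_j^-$ together), such that on each $D_j$ there is a one-to-one $C^2$ change of coordinates $(x,y)\mapsto(\rho,\xi)$, $\rho\in(c_j-h_j,c_j+h_j)$, $h_j>0$, $\xi\in(-\infty,\infty)$, which is orthogonal, $dx^2+dy^2=E_1^2\,d\rho^2+E_2^2\,d\xi^2$, with $\rho$ constant on streamlines, with $x\to\pm\infty$ as $\xi\to\pm\infty$ along each streamline of $D_j$, and with $u\cdot\nabla\xi>0$ throughout $D_j$ (tubes $D^+$) or $u\cdot\nabla\xi<0$ throughout $D_j$ (tubes $D^-$). Assume that for a constant $K>0$ and $\omega=E_2/E_1$ $$K^{-1}\le E_1,E_2,\qquad K^{-1}\le\omega\le K,\qquad \Big|\frac{\partial\omega}{\partial\xi}\Big|,\ \Big|\frac{\partial\omega}{\partial\rho}\Big|\le\frac{K}{h_j}\quad\text{on each }D_j,$$ and that the flux density does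 not oscillate too much: $\tfrac12\sup_{D_j}E_1|u|\le E_1|u|\le\sup_{D_j}E_1|u|<\infty$ on each $D_j$. **Theorem.** There is a constant $C>0$ that depends only on $f$ and $K$ such that in this situation, for every $t>0$, $T_t(\cdot,\cdot,t)$ is integrable on $\Omega$ and the bulk burning rate $V(t)=\int_\Omega T_t\,\frac{dx\,dy}{H}$ satisfies $$V(t)\ge C\Big(v_0+\sum_{j=1}^N\Big(1+\frac{l}{h_j}\Big)^{-1}\int_{c_j-h_j}^{c_j+h_j}|u(\rho,\xi)|\,E_1(\rho,\xi)\,\frac{d\rho}{H}\Big)$$ for any choice of $\xi=\xi_j\in\mathbb R$ in each integral, which is the flux of $u$ through the tube $D_j$. -/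

import Mathlib

open Set Filter Topology MeasureTheory

noncomputable section

namespace PercolatingFlow

/-! Points of the plane are pairs `p = (x, y) : ℝ × ℝ`; the product structure is used only as a
topological vector space, Euclidean lengths are written out. -/

/-- The partial derivative in the first variable. -/
def partialFst (g : ℝ × ℝ → ℝ) (p : ℝ × ℝ) : ℝ :=
  deriv (fun s => g (s, p.2)) p.1

/-- The partial derivative in the second variable, which ranges over `Y`
(one-sided at the end points when `Y` is an interval). -/
def partialSnd (Y : Set ℝ) (g : ℝ × ℝ → ℝ) (p : ℝ × ℝ) : ℝ :=
  derivWithin (fun s => g (p.1, s)) Y p.2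

/-- The Laplacian `g_xx + g_yy`. -/
def laplacian (Y : Set ℝ) (g : ℝ × ℝ → ℝ) (p : ℝ × ℝ) : ℝ :=
  partialFst (partialFst g) p + partialSnd Y (partialSnd Y g) p

/-- The advection term `u · ∇g`. -/
def advection (Y : Set ℝ) (u : ℝ × ℝ → ℝ × ℝ) (g : ℝ × ℝ → ℝ) (p : ℝ × ℝ) : ℝ :=
  (u p).1 * partialFst g p + (u p).2 * partialSnd Y g p

/-- The Euclidean length of a plane vector. -/
def euclLength (v : ℝ × ℝ) : ℝ := √(v.1 ^ 2 + v.2 ^ 2)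

/-- The two kinds of boundary conditions at `y = 0, H`. -/
inductive BoundaryKind
  | neumann
  | periodic

/-- The range of `y`: the interval `[0, H]` for the Neumann problem; for the periodic problem all
functions are `H`-periodic functions on the whole plane. -/
def BoundaryKind.yRange (bc : BoundaryKind) (H : ℝ) : Set ℝ :=
  match bc with
  | .neumann => Icc 0 H
  | .periodic => univ

/-- The domain `ℝ × [0, H]` (Neumann) or the plane covering the cylinder (periodic). -/
def BoundaryKind.domain (bc : BoundaryKind) (H : ℝ) : Set (ℝ × ℝ) :=
  univ ×ˢ bc.yRange H

/-- The boundary condition at `y = 0, H` for the temperature. -/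
def BoundaryKind.TemperatureCondition (bc : BoundaryKind) (H : ℝ) (g : ℝ × ℝ → ℝ) : Prop :=
  match bc with
  | .neumann => ∀ x : ℝ, partialSnd (Icc 0 H) g (x, 0) = 0 ∧ partialSnd (Icc 0 H) g (x, H) = 0
  | .periodic => ∀ x y : ℝ, g (x, y + H) = g (x, y)

/-- The condition at `y = 0, H` for the velocity: no flow through the walls of the strip, or
periodicity. -/
def BoundaryKind.VelocityCondition (bc : BoundaryKind) (H : ℝ) (u : ℝ × ℝ → ℝ × ℝ) : Prop :=
  match bc with
  | .neumann => ∀ x : ℝ, (u (x, 0)).2 = 0 ∧ (u (x, H)).2 = 0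
  | .periodic => ∀ x y : ℝ, u (x, y + H) = u (x, y)

/-- The reaction functions: `f ∈ C¹[0,1]`, `f(0) = f(1) = 0`, `f ≥ 0`, `f` not identically `0`. -/
structure IsReaction (f : ℝ → ℝ) : Prop where
  contDiffOn : ContDiffOn ℝ 1 f (Icc 0 1)
  zero : f 0 = 0
  one : f 1 = 0
  nonneg : ∀ s ∈ Ioo (0 : ℝ) 1, 0 ≤ f s
  nontrivial : ∃ s ∈ Ioo (0 : ℝ) 1, f s ≠ 0

/-- The flows: `C¹`, incompressible, of zero mean in the `x`-direction, periodic in space. -/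
structure IsFlow (bc : BoundaryKind) (H : ℝ) (u : ℝ × ℝ → ℝ × ℝ) : Prop where
  contDiffOn : ContDiffOn ℝ 1 u (bc.domain H)
  incompressible : ∀ p ∈ bc.domain H,
    partialFst (fun q => (u q).1) p + partialSnd (bc.yRange H) (fun q => (u q).2) p = 0
  mean_zero : ∀ x : ℝ, ∫ y in (0 : ℝ)..H, (u (x, y)).1 = 0
  periodic_x : ∃ L : ℝ, 0 < L ∧ ∀ x, ∀ y ∈ bc.yRange H, u (x + L, y) = u (x, y)
  boundary : bc.VelocityCondition H u

/-- A classical solution `T t (x, y)`, `t ≥ 0`, of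
`T_t + u · ∇T = κ ΔT + (v₀² / κ) f(T)` with values in `[0, 1]`, with the given boundary condition
at `y = 0, H`, and with limits `1` and `0` as `x → -∞` and `x → +∞`. -/
structure IsSolution (bc : BoundaryKind) (H κ v₀ : ℝ) (f : ℝ → ℝ) (u : ℝ × ℝ → ℝ × ℝ)
    (T : ℝ → ℝ × ℝ → ℝ) : Prop where
  continuousOn : ContinuousOn (fun q : ℝ × (ℝ × ℝ) => T q.1 q.2) (Ici 0 ×ˢ bc.domain H)
  contDiffOn : ∀ t, 0 ≤ t → ContDiffOn ℝ 2 (T t) (bc.domain H)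
  differentiableAt : ∀ t, 0 < t → ∀ p ∈ bc.domain H, DifferentiableAt ℝ (fun s => T s p) t
  mem_Icc : ∀ t, 0 ≤ t → ∀ p ∈ bc.domain H, T t p ∈ Icc (0 : ℝ) 1
  equation : ∀ t, 0 < t → ∀ p ∈ bc.domain H,
    deriv (fun s => T s p) t + advection (bc.yRange H) u (T t) p
      = κ * laplacian (bc.yRange H) (T t) p + v₀ ^ 2 / κ * f (T t p)
  boundary : ∀ t, 0 ≤ t → bc.TemperatureCondition H (T t)
  left_limit : ∀ t, 0 ≤ t → ∀ y ∈ bc.yRange H, Tendsto (fun x => T t (x, y)) atBot (𝓝 1)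
  right_limit : ∀ t, 0 ≤ t → ∀ y ∈ bc.yRange H, Tendsto (fun x => T t (x, y)) atTop (𝓝 0)

/-- Exponential decay of the initial data: `T₀ = 1 - O(e^{λx})` for `x < 0`, `T₀ = O(e^{-λx})` for
`x > 0`, and `|∇T₀| = O(e^{-λ|x|})`, for some `λ > 0`. -/
def InitialDecay (bc : BoundaryKind) (H : ℝ) (T₀ : ℝ × ℝ → ℝ) : Prop :=
  ∃ lam A : ℝ, 0 < lam ∧ ∀ p ∈ bc.domain H,
    (p.1 < 0 → |1 - T₀ p| ≤ A * Real.exp (lam * p.1)) ∧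
    (0 < p.1 → |T₀ p| ≤ A * Real.exp (-lam * p.1)) ∧
    euclLength (partialFst T₀ p, partialSnd (bc.yRange H) T₀ p) ≤ A * Real.exp (-lam * |p.1|)

/-- The condition `κ ΔT₀ + (v₀² / κ) f(T₀) - u · ∇T₀ ≥ 0` on the initial data. -/
def InitialMonotonicity (bc : BoundaryKind) (H κ v₀ : ℝ) (f : ℝ → ℝ) (u : ℝ × ℝ → ℝ × ℝ)
    (T₀ : ℝ × ℝ → ℝ) : Prop :=
  ∀ p ∈ bc.domain H,
    0 ≤ κ * laplacian (bc.yRange H) T₀ p + v₀ ^ 2 / κ * f (T₀ p)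
      - advection (bc.yRange H) u T₀ p

/-- One period cell `ℝ × [0, H]`. -/
def strip (H : ℝ) : Set (ℝ × ℝ) := univ ×ˢ Icc 0 H

/-- The bulk burning rate `V(t) = ∫_{ℝ × [0, H]} T_t dx dy / H`. -/
def bulkBurningRate (H : ℝ) (T : ℝ → ℝ × ℝ → ℝ) (t : ℝ) : ℝ :=
  (∫ p in strip H, deriv (fun s => T s p) t) / H

/-- Curvilinear coordinates on a tube: `map (ρ, ξ)` is the point of the plane with coordinates
`ρ ∈ (c - h, c + h)` and `ξ ∈ ℝ`; `forward` distinguishes the tubes `D⁺` from the tubes `D⁻`. -/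
structure Tube where
  c : ℝ
  h : ℝ
  forward : Bool
  map : ℝ × ℝ → ℝ × ℝ

namespace Tube

/-- The coordinate domain, without the two bounding streamlines. -/
def coords (D : Tube) : Set (ℝ × ℝ) := Ioo (D.c - D.h) (D.c + D.h) ×ˢ univ

/-- The coordinate vector `∂(x, y)/∂ρ`. -/
def tangentRho (D : Tube) (q : ℝ × ℝ) : ℝ × ℝ :=
  (partialFst (fun r => (D.map r).1) q, partialFst (fun r => (D.map r).2) q)

/-- The coordinate vector `∂(x, y)/∂ξ`. -/
def tangentXi (D : Tube) (q : ℝ × ℝ) : ℝ × ℝ :=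
  (partialSnd univ (fun r => (D.map r).1) q, partialSnd univ (fun r => (D.map r).2) q)

/-- The metric coefficient `E₁` in `dx² + dy² = E₁² dρ² + E₂² dξ²`. -/
def E₁ (D : Tube) (q : ℝ × ℝ) : ℝ := euclLength (D.tangentRho q)

/-- The metric coefficient `E₂` in `dx² + dy² = E₁² dρ² + E₂² dξ²`. -/
def E₂ (D : Tube) (q : ℝ × ℝ) : ℝ := euclLength (D.tangentXi q)

/-- `ω = E₂ / E₁`. -/
def omega (D : Tube) (q : ℝ × ℝ) : ℝ := D.E₂ q / D.E₁ q

/-- The flux `∫ |u| E₁ dρ` through the cross-section of the tube with the given value of `ξ`. -/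
def flux (D : Tube) (u : ℝ × ℝ → ℝ × ℝ) (ξ : ℝ) : ℝ :=
  ∫ ρ in (D.c - D.h)..(D.c + D.h), euclLength (u (D.map (ρ, ξ))) * D.E₁ (ρ, ξ)

/-- `D` is a tube of streamlines of `u` from `x = -∞` to `x = +∞` with regular orthogonal
coordinates, with all metric constants equal to `K`. -/
structure IsPercolating (D : Tube) (bc : BoundaryKind) (H K : ℝ) (u : ℝ × ℝ → ℝ × ℝ) : Prop where
  h_pos : 0 < D.h
  contDiffOn : ContDiffOn ℝ 2 D.map D.coords
  mapsTo : MapsTo D.map D.coords (bc.domain H)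
  /-- The coordinates are orthogonal. -/
  orthogonal : ∀ q ∈ D.coords,
    (D.tangentRho q).1 * (D.tangentXi q).1 + (D.tangentRho q).2 * (D.tangentXi q).2 = 0
  /-- `u` is orthogonal to `∂(x, y)/∂ρ`, that is, `u · ∇ρ = 0`: `ρ` is constant on streamlines. -/
  streamlines : ∀ q ∈ D.coords,
    (u (D.map q)).1 * (D.tangentRho q).1 + (u (D.map q)).2 * (D.tangentRho q).2 = 0
  /-- The sign of `u · ∇ξ`, which is that of `u · ∂(x, y)/∂ξ = E₂² u · ∇ξ`. -/
  direction : ∀ q ∈ D.coords,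
    0 < (if D.forward then (1 : ℝ) else -1) *
      ((u (D.map q)).1 * (D.tangentXi q).1 + (u (D.map q)).2 * (D.tangentXi q).2)
  /-- Every streamline of the tube connects `x = -∞` and `x = +∞`. -/
  left_end : ∀ ρ ∈ Ioo (D.c - D.h) (D.c + D.h), Tendsto (fun ξ => (D.map (ρ, ξ)).1) atBot atBot
  right_end : ∀ ρ ∈ Ioo (D.c - D.h) (D.c + D.h), Tendsto (fun ξ => (D.map (ρ, ξ)).1) atTop atTop
  le_E₁ : ∀ q ∈ D.coords, K⁻¹ ≤ D.E₁ q
  le_E₂ : ∀ q ∈ D.coords, K⁻¹ ≤ D.E₂ q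
  le_omega : ∀ q ∈ D.coords, K⁻¹ ≤ D.omega q
  omega_le : ∀ q ∈ D.coords, D.omega q ≤ K
  omega_xi : ∀ q ∈ D.coords, |partialSnd univ D.omega q| ≤ K / D.h
  omega_rho : ∀ q ∈ D.coords, |partialFst D.omega q| ≤ K / D.h
  /-- The flux density `E₁ |u|` varies at most by the factor `2` on the tube. -/
  oscillation : ∃ M : ℝ, ∀ q ∈ D.coords,
    M / 2 ≤ D.E₁ q * euclLength (u (D.map q)) ∧ D.E₁ q * euclLength (u (D.map q)) ≤ M

end Tube

/-- The coordinates on the tubes are one-to-one and different tubes do not overlap, where in the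
periodic problem points of the plane that differ by a multiple of `(0, H)` are the same point
(for tubes inside the strip `ℝ × [0, H]` only the multiple `n = 0` can occur). -/
def TubesDisjoint {N : ℕ} (H : ℝ) (D : Fin N → Tube) : Prop :=
  ∀ i j : Fin N, ∀ p ∈ (D i).coords, ∀ q ∈ (D j).coords, ∀ n : ℤ,
    (D i).map p = (D j).map q + (0, n * H) → i = j ∧ p = q

end PercolatingFlow

end

open PercolatingFlow

/-! # A lower bound for the bulk burning rate in percolating flows -/

/-! Write r = v₀²/κ and l = κ/v₀. The comparison principle gives T_t ≥ 0: T₀, frozen in time, is a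
subsolution, so T dominates T₀, hence its time translates dominate T. Exponential barriers show that
T and 1 - T keep decaying exponentially at the two ends. From then on time is fixed: only the slice
θ = T(t) and the function τ = T_t ≥ 0 matter.

For functions g and G with G' = g, incompressibility turns the equation multiplied by g(θ) into
div(κ g(θ)∇θ - u G(θ)) = κ g'(θ)|∇θ|² + g(θ)(τ - r f(θ)). Over the whole strip the boundary terms
vanish, the convective ones because u₁ has mean zero. Taking g = 1 gives ∫τ = r∫f(θ), which is H
times the burning rate; taking g(s) = s gives κ∫|∇θ|² ≤ r∫f(θ). So burning, dissipation and
reaction, the three parts of `energyDensity`, have total mass at most 3H times the burning rate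
(`integral_time_deriv`, `integral_gradSq_le`).

Now let 0 ≤ g ≤ 1 be a bump with g ≤ B f. Young's inequality and κr = v₀² bound v₀|∇G(θ)| by B times
the energy density. As G(θ) falls from G(1) to G(0) along the strip, this yields the term v₀ of the
theorem (`speed_le`).

For the flux terms the same divergence identity is used inside a tube, with a cutoff in ρ that
vanishes at c ± h/2. Since u is tangent to the streamlines, nothing is convected through the sides,
and far cross-sections contribute G(1) - G(0) times the cut-off flux of u. The interior is paid for
by the energy of the tube: the divergence costs a constant, the derivative of the cutoff costs (κ/h)
g|∇θ|, that is l/h times the energy density (`abs_divergence_bump_le`, `flux_le`). The tubes do not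
overlap, so their energies add up to at most the energy of one period cell
(`sum_integral_tubes_le`). -/

namespace PercolatingFlow

/-! ### Calculus of the partial derivatives -/

section Calculus

variable {X Y : Set ℝ} {g g₁ g₂ : ℝ × ℝ → ℝ} {p : ℝ × ℝ}

/-- `partialFst` is a two-sided derivative, hence the open `X`, while `Y` may be a closed interval.
Phrasing both partial derivatives through `fderivWithin` carries smoothness up to the walls and
serves the strip, the plane and the tube coordinates alike. -/
theorem partialFst_eq_fderivWithin (hX : IsOpen X) (hg : DifferentiableWithinAt ℝ g (X ×ˢ Y) p)
    (hp : p ∈ X ×ˢ Y) :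
    HasDerivAt (fun s => g (s, p.2)) (partialFst g p) p.1 ∧
      partialFst g p = fderivWithin ℝ g (X ×ˢ Y) p (1, 0) := by
  have h1 : HasFDerivWithinAt g (fderivWithin ℝ g (X ×ˢ Y) p) (X ×ˢ Y) (p.1, p.2) :=
    hg.hasFDerivWithinAt
  have h2 : HasDerivWithinAt (fun s : ℝ => (s, p.2)) ((1 : ℝ), (0 : ℝ)) X p.1 :=
    (hasDerivWithinAt_id p.1 X).prodMk (hasDerivWithinAt_const p.1 X p.2)
  have h3 : HasDerivWithinAt (fun s => g (s, p.2)) (fderivWithin ℝ g (X ×ˢ Y) p (1, 0)) X p.1 :=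
    h1.comp_hasDerivWithinAt p.1 h2 (fun s hs => mk_mem_prod hs hp.2)
  have h4 : HasDerivAt (fun s => g (s, p.2)) (fderivWithin ℝ g (X ×ˢ Y) p (1, 0)) p.1 :=
    h3.hasDerivAt (hX.mem_nhds hp.1)
  have h5 : partialFst g p = fderivWithin ℝ g (X ×ˢ Y) p (1, 0) := h4.deriv
  exact ⟨h5 ▸ h4, h5⟩

theorem partialSnd_eq_fderivWithin (hY : UniqueDiffOn ℝ Y)
    (hg : DifferentiableWithinAt ℝ g (X ×ˢ Y) p) (hp : p ∈ X ×ˢ Y) :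
    HasDerivWithinAt (fun s => g (p.1, s)) (partialSnd Y g p) Y p.2 ∧
      partialSnd Y g p = fderivWithin ℝ g (X ×ˢ Y) p (0, 1) := by
  have h1 : HasFDerivWithinAt g (fderivWithin ℝ g (X ×ˢ Y) p) (X ×ˢ Y) (p.1, p.2) :=
    hg.hasFDerivWithinAt
  have h2 : HasDerivWithinAt (fun s : ℝ => (p.1, s)) ((0 : ℝ), (1 : ℝ)) Y p.2 :=
    (hasDerivWithinAt_const p.2 Y p.1).prodMk (hasDerivWithinAt_id p.2 Y)
  have h4 : HasDerivWithinAt (fun s => g (p.1, s)) (fderivWithin ℝ g (X ×ˢ Y) p (0, 1)) Y p.2 :=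
    h1.comp_hasDerivWithinAt p.2 h2 (fun s hs => ⟨hp.1, hs⟩)
  have h5 : partialSnd Y g p = fderivWithin ℝ g (X ×ˢ Y) p (0, 1) := h4.derivWithin (hY p.2 hp.2)
  exact ⟨h5 ▸ h4, h5⟩

theorem hasDerivAt_partialFst (hX : IsOpen X) (hg : ContDiffOn ℝ 1 g (X ×ˢ Y))
    (hp : p ∈ X ×ˢ Y) : HasDerivAt (fun s => g (s, p.2)) (partialFst g p) p.1 :=
  (partialFst_eq_fderivWithin hX (hg.differentiableOn one_ne_zero p hp) hp).1

theorem hasDerivWithinAt_partialSnd (hY : UniqueDiffOn ℝ Y) (hg : ContDiffOn ℝ 1 g (X ×ˢ Y))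
    (hp : p ∈ X ×ˢ Y) : HasDerivWithinAt (fun s => g (p.1, s)) (partialSnd Y g p) Y p.2 :=
  (partialSnd_eq_fderivWithin hY (hg.differentiableOn one_ne_zero p hp) hp).1

theorem contDiffOn_partialFst {m n : WithTop ℕ∞} (hX : IsOpen X) (hY : UniqueDiffOn ℝ Y)
    (hg : ContDiffOn ℝ n g (X ×ˢ Y)) (hmn : m + 1 ≤ n) :
    ContDiffOn ℝ m (partialFst g) (X ×ˢ Y) := by
  have hn : n ≠ 0 := fun h => by simp [h] at hmn
  refine ((hg.fderivWithin (hX.uniqueDiffOn.prod hY) hmn).clm_apply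
    (contDiffOn_const (c := ((1 : ℝ), (0 : ℝ))))).congr fun p hp => ?_
  exact (partialFst_eq_fderivWithin hX (hg.differentiableOn hn p hp) hp).2

theorem contDiffOn_partialSnd {m n : WithTop ℕ∞} (hX : IsOpen X) (hY : UniqueDiffOn ℝ Y)
    (hg : ContDiffOn ℝ n g (X ×ˢ Y)) (hmn : m + 1 ≤ n) :
    ContDiffOn ℝ m (partialSnd Y g) (X ×ˢ Y) := by
  have hn : n ≠ 0 := fun h => by simp [h] at hmn
  refine ((hg.fderivWithin (hX.uniqueDiffOn.prod hY) hmn).clm_apply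
    (contDiffOn_const (c := ((0 : ℝ), (1 : ℝ))))).congr fun p hp => ?_
  exact (partialSnd_eq_fderivWithin hY (hg.differentiableOn hn p hp) hp).2

/-- Mixed partial derivatives commute. -/
theorem partialSnd_partialFst_comm (hX : IsOpen X) (hg : ContDiffOn ℝ 2 g (X ×ˢ univ))
    (hp : p ∈ X ×ˢ (univ : Set ℝ)) :
    partialSnd univ (partialFst g) p = partialFst (partialSnd univ g) p := by
  have ho : IsOpen (X ×ˢ (univ : Set ℝ)) := hX.prod isOpen_univ
  have h1 : ContDiffAt ℝ 2 g p := hg.contDiffAt (ho.mem_nhds hp)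
  have hsymm : IsSymmSndFDerivAt ℝ g p := h1.isSymmSndFDerivAt (by simp)
  have hd : DifferentiableAt ℝ (fderiv ℝ g) p :=
    (h1.fderiv_right (m := 1) (by norm_num)).differentiableAt one_ne_zero
  have e1 : ∀ q ∈ X ×ˢ (univ : Set ℝ), partialFst g q = fderiv ℝ g q (1, 0) := fun q hq => by
    rw [(partialFst_eq_fderivWithin hX (hg.differentiableOn two_ne_zero q hq) hq).2,
      fderivWithin_of_isOpen ho hq]
  have e2 : ∀ q ∈ X ×ˢ (univ : Set ℝ), partialSnd univ g q = fderiv ℝ g q (0, 1) := fun q hq => by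
    rw [(partialSnd_eq_fderivWithin uniqueDiffOn_univ
      (hg.differentiableOn two_ne_zero q hq) hq).2, fderivWithin_of_isOpen ho hq]
  have k1 : HasFDerivAt (partialFst g) ((fderiv ℝ (fderiv ℝ g) p).flip (1, 0)) p :=
    ((hd.hasFDerivAt.clm_apply (hasFDerivAt_const ((1 : ℝ), (0 : ℝ)) p)).congr_of_eventuallyEq
      (Filter.eventuallyEq_of_mem (ho.mem_nhds hp) e1)).congr_fderiv (by ext <;> simp)
  have k2 : HasFDerivAt (partialSnd univ g) ((fderiv ℝ (fderiv ℝ g) p).flip (0, 1)) p :=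
    ((hd.hasFDerivAt.clm_apply (hasFDerivAt_const ((0 : ℝ), (1 : ℝ)) p)).congr_of_eventuallyEq
      (Filter.eventuallyEq_of_mem (ho.mem_nhds hp) e2)).congr_fderiv (by ext <;> simp)
  rw [(partialSnd_eq_fderivWithin uniqueDiffOn_univ
      k1.differentiableAt.differentiableWithinAt hp).2,
    (partialFst_eq_fderivWithin hX k2.differentiableAt.differentiableWithinAt hp).2,
    fderivWithin_of_isOpen ho hp, fderivWithin_of_isOpen ho hp, k1.fderiv, k2.fderiv]
  exact hsymm (0, 1) (1, 0)

/-- The chain rule for a map of the plane with values where `g` is differentiable. -/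
theorem hasDerivWithinAt_comp_plane {γ : ℝ → ℝ × ℝ} {S : Set ℝ} {s a b : ℝ} (hX : IsOpen X)
    (hY : UniqueDiffOn ℝ Y) (hg : ContDiffOn ℝ 1 g (X ×ˢ Y))
    (h₁ : HasDerivWithinAt (fun r => (γ r).1) a S s)
    (h₂ : HasDerivWithinAt (fun r => (γ r).2) b S s)
    (hm : MapsTo γ S (X ×ˢ Y)) (hs : s ∈ S) :
    HasDerivWithinAt (fun r => g (γ r))
      (partialFst g (γ s) * a + partialSnd Y g (γ s) * b) S s := by
  have hd := hg.differentiableOn one_ne_zero (γ s) (hm hs)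
  have hγ : HasDerivWithinAt γ (a, b) S s := h₁.prodMk h₂
  have h3 := hd.hasFDerivWithinAt.comp_hasDerivWithinAt s hγ hm
  refine h3.congr_deriv ?_
  rw [(partialFst_eq_fderivWithin hX hd (hm hs)).2, (partialSnd_eq_fderivWithin hY hd (hm hs)).2]
  have : ((a, b) : ℝ × ℝ) = a • ((1 : ℝ), (0 : ℝ)) + b • ((0 : ℝ), (1 : ℝ)) := by simp
  rw [this, map_add, map_smul, map_smul]
  simp [mul_comm]

/-- The divergence theorem on a rectangle, for fields that are `C¹` up to the boundary. -/
theorem integral_divergence_rectangle (hX : IsOpen X) (hY : UniqueDiffOn ℝ Y)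
    (h₁ : ContDiffOn ℝ 1 g₁ (X ×ˢ Y)) (h₂ : ContDiffOn ℝ 1 g₂ (X ×ˢ Y))
    {a b c d : ℝ} (hab : a ≤ b) (hcd : c ≤ d) (hsub : Icc a b ×ˢ Icc c d ⊆ X ×ˢ Y) :
    ∫ p in Icc a b ×ˢ Icc c d, (partialFst g₁ p + partialSnd Y g₂ p) =
      (∫ x in a..b, g₂ (x, d)) - (∫ x in a..b, g₂ (x, c)) + (∫ y in c..d, g₁ (b, y))
        - ∫ y in c..d, g₁ (a, y) := by
  have hbox : Icc a b ×ˢ Icc c d = Icc (a, c) (b, d) := (Icc_prod_eq (a, c) (b, d)).symm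
  have hsub' : Icc (a, c) (b, d) ⊆ X ×ˢ Y := hbox ▸ hsub
  have e1 : ∀ p ∈ X ×ˢ Y, partialFst g₁ p = fderivWithin ℝ g₁ (X ×ˢ Y) p (1, 0) := fun p hp =>
    (partialFst_eq_fderivWithin hX (h₁.differentiableOn one_ne_zero p hp) hp).2
  have e2 : ∀ p ∈ X ×ˢ Y, partialSnd Y g₂ p = fderivWithin ℝ g₂ (X ×ˢ Y) p (0, 1) := fun p hp =>
    (partialSnd_eq_fderivWithin hY (h₂.differentiableOn one_ne_zero p hp) hp).2
  -- The rectangle may touch the walls, but its interior consists of interior points of `X ×ˢ Y`,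
  -- where `fderivWithin` is a full derivative; the divergence theorem asks for differentiability
  -- only there.
  have hint : ∀ p ∈ Ioo a b ×ˢ Ioo c d, X ×ˢ Y ∈ 𝓝 p := fun p hp =>
    mem_of_superset ((isOpen_Ioo.prod isOpen_Ioo).mem_nhds hp)
      ((Set.prod_mono Ioo_subset_Icc_self Ioo_subset_Icc_self).trans hsub)
  have hcont : ContinuousOn (fun p => partialFst g₁ p + partialSnd Y g₂ p) (X ×ˢ Y) :=
    (contDiffOn_partialFst (m := 0) hX hY h₁ (by simp)).continuousOn.add
      (contDiffOn_partialSnd (m := 0) hX hY h₂ (by simp)).continuousOn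
  have hE : EqOn (fun p => partialFst g₁ p + partialSnd Y g₂ p)
      (fun p => fderivWithin ℝ g₁ (X ×ˢ Y) p (1, 0) + fderivWithin ℝ g₂ (X ×ˢ Y) p (0, 1))
      (Icc (a, c) (b, d)) := fun p hp => by
    simp only [e1 p (hsub' hp), e2 p (hsub' hp)]
  rw [hbox, setIntegral_congr_fun measurableSet_Icc hE]
  refine integral_divergence_prod_Icc_of_hasFDerivAt_of_le g₁ g₂ _ _ (a, c) (b, d)
    ⟨hab, hcd⟩ (h₁.continuousOn.mono hsub') (h₂.continuousOn.mono hsub') ?_ ?_ ?_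
  · intro p hp
    exact (h₁.differentiableOn one_ne_zero p (mem_of_mem_nhds (hint p hp))).hasFDerivWithinAt.hasFDerivAt (hint p hp)
  · intro p hp
    exact (h₂.differentiableOn one_ne_zero p (mem_of_mem_nhds (hint p hp))).hasFDerivWithinAt.hasFDerivAt (hint p hp)
  · exact (((hcont.mono hsub').integrableOn_compact isCompact_Icc).congr_fun hE measurableSet_Icc)

end Calculus

/-! ### The field `κ g(θ) ∇θ - u G(θ)` -/

section FluxField

/-- The first component of `κ g(θ) ∇θ - u G(θ)`. -/
noncomputable def fluxFst (κ : ℝ) (u : ℝ × ℝ → ℝ × ℝ) (g G : ℝ → ℝ) (θ : ℝ × ℝ → ℝ) (p : ℝ × ℝ) : ℝ :=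
  κ * (g (θ p) * partialFst θ p) - (u p).1 * G (θ p)

/-- The second component of `κ g(θ) ∇θ - u G(θ)`. -/
noncomputable def fluxSnd (Y : Set ℝ) (κ : ℝ) (u : ℝ × ℝ → ℝ × ℝ) (g G : ℝ → ℝ) (θ : ℝ × ℝ → ℝ)
    (p : ℝ × ℝ) : ℝ :=
  κ * (g (θ p) * partialSnd Y θ p) - (u p).2 * G (θ p)

variable {Y : Set ℝ} {κ : ℝ} {u : ℝ × ℝ → ℝ × ℝ} {g G : ℝ → ℝ} {θ : ℝ × ℝ → ℝ} {p : ℝ × ℝ}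

theorem contDiffOn_fluxFst (hY : UniqueDiffOn ℝ Y) (hu : ContDiffOn ℝ 1 u (univ ×ˢ Y))
    (hg : ContDiff ℝ 1 g) (hG : ContDiff ℝ 1 G) (hθ : ContDiffOn ℝ 2 θ (univ ×ˢ Y)) :
    ContDiffOn ℝ 1 (fluxFst κ u g G θ) (univ ×ˢ Y) := by
  have h1 : ContDiffOn ℝ 1 θ (univ ×ˢ Y) := hθ.of_le one_le_two
  exact (contDiffOn_const.mul ((hg.comp_contDiffOn h1).mul
    (contDiffOn_partialFst isOpen_univ hY hθ (by norm_num)))).sub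
    (hu.fst.mul (hG.comp_contDiffOn h1))

theorem contDiffOn_fluxSnd (hY : UniqueDiffOn ℝ Y) (hu : ContDiffOn ℝ 1 u (univ ×ˢ Y))
    (hg : ContDiff ℝ 1 g) (hG : ContDiff ℝ 1 G) (hθ : ContDiffOn ℝ 2 θ (univ ×ˢ Y)) :
    ContDiffOn ℝ 1 (fluxSnd Y κ u g G θ) (univ ×ˢ Y) := by
  have h1 : ContDiffOn ℝ 1 θ (univ ×ˢ Y) := hθ.of_le one_le_two
  exact (contDiffOn_const.mul ((hg.comp_contDiffOn h1).mul
    (contDiffOn_partialSnd isOpen_univ hY hθ (by norm_num)))).sub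
    (hu.snd.mul (hG.comp_contDiffOn h1))

/-- The term G(θ) div u drops out, and u · ∇G(θ) = g(θ) u · ∇θ. For a solution the last factor is τ
- r f(θ), so the flow disappears from the divergence. -/
theorem divergence_flux (hY : UniqueDiffOn ℝ Y) (hu : ContDiffOn ℝ 1 u (univ ×ˢ Y))
    (hdiv : ∀ p ∈ (univ : Set ℝ) ×ˢ Y,
      partialFst (fun q => (u q).1) p + partialSnd Y (fun q => (u q).2) p = 0)
    (hg : ContDiff ℝ 1 g) (hG : ContDiff ℝ 1 G) (hGg : ∀ s, deriv G s = g s)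
    (hθ : ContDiffOn ℝ 2 θ (univ ×ˢ Y)) (hp : p ∈ (univ : Set ℝ) ×ˢ Y) :
    partialFst (fluxFst κ u g G θ) p + partialSnd Y (fluxSnd Y κ u g G θ) p =
      κ * (deriv g (θ p) * (partialFst θ p ^ 2 + partialSnd Y θ p ^ 2))
        + g (θ p) * (κ * laplacian Y θ p - advection Y u θ p) := by
  have h1 : ContDiffOn ℝ 1 θ (univ ×ˢ Y) := hθ.of_le one_le_two
  have hgd : HasDerivAt g (deriv g (θ p)) (θ p) := (hg.differentiable one_ne_zero _).hasDerivAt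
  have hGd : HasDerivAt G (g (θ p)) (θ p) := hGg (θ p) ▸ (hG.differentiable one_ne_zero _).hasDerivAt
  have a1 := hasDerivAt_partialFst isOpen_univ h1 hp
  have a2 := hasDerivAt_partialFst isOpen_univ
    (contDiffOn_partialFst (m := 1) isOpen_univ hY hθ (by norm_num)) hp
  have a3 := hasDerivAt_partialFst isOpen_univ hu.fst hp
  have b1 := hasDerivWithinAt_partialSnd hY h1 hp
  have b2 := hasDerivWithinAt_partialSnd hY
    (contDiffOn_partialSnd (m := 1) isOpen_univ hY hθ (by norm_num)) hp
  have b3 := hasDerivWithinAt_partialSnd hY hu.snd hp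
  have e1 : partialFst (fluxFst κ u g G θ) p = _ :=
    ((((hgd.comp p.1 a1).mul a2).const_mul κ).sub (a3.mul (hGd.comp p.1 a1))).deriv
  have e2 : partialSnd Y (fluxSnd Y κ u g G θ) p = _ :=
    ((((hgd.comp_hasDerivWithinAt p.2 b1).mul b2).const_mul κ).sub
      (b3.mul (hGd.comp_hasDerivWithinAt p.2 b1))).derivWithin (hY p.2 hp.2)
  rw [e1, e2]
  simp only [Function.comp_apply, Prod.mk.eta, laplacian, advection]
  linear_combination (-G (θ p)) * hdiv p hp

end FluxField

/-! ### The comparison principle -/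

section Comparison

/-- The second derivative test at a critical minimum point, possibly an end point. -/
theorem second_deriv_nonneg_of_min {Y : Set ℝ} {φ φ' : ℝ → ℝ} {φ'' y : ℝ} (hY : Y.OrdConnected)
    (hnt : Y.Nontrivial) (hy : y ∈ Y)
    (h1 : ∀ s ∈ Y, HasDerivWithinAt φ (φ' s) Y s) (h2 : HasDerivWithinAt φ' φ'' Y y)
    (h0 : φ' y = 0) (hmin : ∀ s ∈ Y, φ y ≤ φ s) : 0 ≤ φ'' := by
  by_contra! hneg
  have hslope := (hasDerivWithinAt_iff_tendsto_slope.1 h2).eventually (gt_mem_nhds hneg)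
  obtain ⟨z, hz, hzy⟩ := hnt.exists_ne y
  rw [eventually_nhdsWithin_iff, Metric.eventually_nhds_iff] at hslope
  obtain ⟨δ, hδ, hball⟩ := hslope
  -- As φ' vanishes at y, a negative φ'' makes φ strictly decrease away from y. It suffices to see
  -- this on the side of y on which z lies, so end points are covered; the mean value theorem then
  -- contradicts minimality.
  have key : ∀ s ∈ Y, s ≠ y → |s - y| < δ → (φ' s) / (s - y) < 0 := fun s hs hne hd => by
    have := hball (y := s) (by rwa [Real.dist_eq]) ⟨hs, hne⟩
    rwa [slope_def_field, h0, sub_zero] at this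
  rcases lt_or_gt_of_ne hzy with hlt | hlt
  · obtain ⟨s, hs1, hs2⟩ : ∃ s, max z (y - δ) < s ∧ s < y := exists_between (max_lt hlt (by linarith))
    have hsub : Icc s y ⊆ Y := fun r hr => hY.out hz hy ⟨((le_max_left _ _).trans hs1.le).trans hr.1, hr.2⟩
    obtain ⟨c, hc, hc'⟩ := exists_hasDerivAt_eq_slope φ φ' hs2
      (fun r hr => ((h1 r (hsub hr)).mono hsub).continuousWithinAt)
      (fun r hr => (h1 r (hsub (Ioo_subset_Icc_self hr))).hasDerivAt
        (mem_of_superset (Icc_mem_nhds hr.1 hr.2) hsub))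
    have h3 := key c (hsub (Ioo_subset_Icc_self hc)) hc.2.ne
      (by rw [abs_sub_comm, abs_of_pos (by linarith [hc.2])]
          linarith [hc.1, (le_max_right z (y - δ)).trans_lt hs1])
    have h4 : 0 < φ' c := by
      by_contra! h
      exact absurd h3 (not_lt.2 (div_nonneg_of_nonpos h (by linarith [hc.2])))
    have h5 := hmin s (hsub ⟨le_rfl, hs2.le⟩)
    rw [hc'] at h4
    exact absurd h4 (not_lt.2 (div_nonpos_of_nonpos_of_nonneg (by linarith) (by linarith)))
  · obtain ⟨s, hs1, hs2⟩ : ∃ s, y < s ∧ s < min z (y + δ) := exists_between (lt_min hlt (by linarith))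
    have hsub : Icc y s ⊆ Y := fun r hr => hY.out hy hz ⟨hr.1, hr.2.trans (hs2.le.trans (min_le_left _ _))⟩
    obtain ⟨c, hc, hc'⟩ := exists_hasDerivAt_eq_slope φ φ' hs1
      (fun r hr => ((h1 r (hsub hr)).mono hsub).continuousWithinAt)
      (fun r hr => (h1 r (hsub (Ioo_subset_Icc_self hr))).hasDerivAt
        (mem_of_superset (Icc_mem_nhds hr.1 hr.2) hsub))
    have h3 := key c (hsub (Ioo_subset_Icc_self hc)) hc.1.ne'
      (by rw [abs_of_pos (by linarith [hc.1])]
          linarith [hc.2, hs2.trans_le (min_le_right z (y + δ))])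
    have h4 : φ' c < 0 := by
      by_contra! h
      exact absurd h3 (not_lt.2 (div_nonneg h (by linarith [hc.1])))
    have h5 := hmin s (hsub ⟨hs1.le, le_rfl⟩)
    rw [hc'] at h4
    exact absurd h4 (not_lt.2 (div_nonneg (by linarith) (by linarith)))

namespace BoundaryKind

variable {bc : BoundaryKind} {H : ℝ}

theorem uniqueDiffOn_yRange (bc : BoundaryKind) (hH : 0 < H) : UniqueDiffOn ℝ (bc.yRange H) := by
  cases bc
  · exact uniqueDiffOn_Icc hH
  · exact uniqueDiffOn_univ

theorem ordConnected_yRange (bc : BoundaryKind) (H : ℝ) : (bc.yRange H).OrdConnected := by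
  cases bc
  · exact ordConnected_Icc
  · exact ordConnected_univ

theorem Icc_subset_yRange (bc : BoundaryKind) (H : ℝ) : Icc 0 H ⊆ bc.yRange H := by
  cases bc
  · exact subset_rfl
  · exact subset_univ _

theorem strip_subset_domain (bc : BoundaryKind) (H : ℝ) : strip H ⊆ bc.domain H :=
  Set.prod_mono subset_rfl (bc.Icc_subset_yRange H)

theorem nontrivial_yRange (bc : BoundaryKind) (hH : 0 < H) : (bc.yRange H).Nontrivial :=
  ⟨0, bc.Icc_subset_yRange H ⟨le_rfl, hH.le⟩, H, bc.Icc_subset_yRange H ⟨hH.le, le_rfl⟩, hH.ne⟩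

/-- Every value of a function satisfying the boundary condition is taken on the period cell. -/
theorem TemperatureCondition.exists_mem_Icc {g : ℝ × ℝ → ℝ} (hg : bc.TemperatureCondition H g)
    (hH : 0 < H) {p : ℝ × ℝ} (hp : p ∈ bc.domain H) : ∃ y ∈ Icc 0 H, g (p.1, y) = g p := by
  cases bc
  · exact ⟨p.2, hp.2, rfl⟩
  · have hper : Function.Periodic (fun y => g (p.1, y)) H := fun y => hg p.1 y
    obtain ⟨y, hy, he⟩ := hper.exists_mem_Ico₀ hH p.2
    exact ⟨y, Ico_subset_Icc_self hy, he.symm⟩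

/-- At a minimum point over `y` the derivative in `y` vanishes, thanks to the boundary condition. -/
theorem TemperatureCondition.partialSnd_eq_zero {g : ℝ × ℝ → ℝ}
    (hg : bc.TemperatureCondition H g) {p : ℝ × ℝ} (hp : p ∈ bc.domain H)
    (hmin : ∀ y ∈ bc.yRange H, g p ≤ g (p.1, y)) : partialSnd (bc.yRange H) g p = 0 := by
  have hloc : bc.yRange H ∈ 𝓝 p.2 → partialSnd (bc.yRange H) g p = 0 := fun h => by
    have : IsLocalMin (fun s => g (p.1, s)) p.2 := mem_of_superset h hmin
    rw [partialSnd, derivWithin_of_mem_nhds h, this.deriv_eq_zero]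
  cases bc
  · have hy : p.2 ∈ Icc 0 H := hp.2
    rcases hy.1.eq_or_lt with h0 | h0
    · have := (hg p.1).1
      rwa [show p = (p.1, 0) from Prod.ext rfl h0.symm]
    rcases hy.2.eq_or_lt with h1 | h1
    · have := (hg p.1).2
      rwa [show p = (p.1, H) from Prod.ext rfl h1]
    · exact hloc (Icc_mem_nhds h0 h1)
  · exact hloc univ_mem

end BoundaryKind

variable {bc : BoundaryKind} {H : ℝ}

/-- Only earlier times are compared, so that a minimum at the final time is admitted. -/
theorem deriv_nonpos_of_left_min {ψ : ℝ → ℝ} {D t : ℝ} (ht : 0 < t) (h : HasDerivAt ψ D t)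
    (hmin : ∀ s ∈ Icc 0 t, ψ t ≤ ψ s) : D ≤ 0 := by
  have h1 : Tendsto (slope ψ t) (𝓝[<] t) (𝓝 D) :=
    (hasDerivAt_iff_tendsto_slope.1 h).mono_left (nhdsWithin_mono _ fun s hs => ne_of_lt hs)
  refine le_of_tendsto h1 ?_
  filter_upwards [Ioo_mem_nhdsLT ht] with s hs
  rw [slope_def_field]
  exact div_nonpos_of_nonneg_of_nonpos (by linarith [hmin s ⟨hs.1.le, hs.2.le⟩]) (by linarith [hs.2])

theorem hasDerivAt_exp_mul (k t : ℝ) :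
    HasDerivAt (fun s => Real.exp (k * s)) (Real.exp (k * t) * k) t := by
  simpa using ((hasDerivAt_id t).const_mul k).exp

set_option maxHeartbeats 400000 in
/-- **Comparison principle**: a supersolution that is bounded below and initially nonnegative
stays nonnegative. -/
theorem nonneg_of_supersolution {κ U L B : ℝ} {u : ℝ × ℝ → ℝ × ℝ} {w : ℝ → ℝ × ℝ → ℝ}
    (hH : 0 < H) (hκ : 0 ≤ κ) (hL : 0 ≤ L) (hU : ∀ p ∈ bc.domain H, |(u p).1| ≤ U)
    (hc : ContinuousOn (fun q : ℝ × (ℝ × ℝ) => w q.1 q.2) (Ici 0 ×ˢ bc.domain H))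
    (h2 : ∀ t, 0 < t → ContDiffOn ℝ 2 (w t) (bc.domain H))
    (hd : ∀ t, 0 < t → ∀ p ∈ bc.domain H, DifferentiableAt ℝ (fun s => w s p) t)
    (hbc : ∀ t, 0 ≤ t → bc.TemperatureCondition H (w t))
    (hB : ∀ t, 0 ≤ t → ∀ p ∈ bc.domain H, -B ≤ w t p)
    (h0 : ∀ p ∈ bc.domain H, 0 ≤ w 0 p)
    (heq : ∀ t, 0 < t → ∀ p ∈ bc.domain H, w t p < 0 →
      L * w t p ≤ deriv (fun s => w s p) t + advection (bc.yRange H) u (w t) p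
        - κ * laplacian (bc.yRange H) (w t) p) :
    ∀ t, 0 ≤ t → ∀ p ∈ bc.domain H, 0 ≤ w t p := by
  intro t₀ ht₀ p₀ hp₀
  by_contra! hneg
  obtain ⟨y₀, hy₀, hyw⟩ := (hbc t₀ ht₀).exists_mem_Icc hH hp₀
  have hU0 : 0 ≤ U := (abs_nonneg _).trans (hU p₀ hp₀)
  -- With this A the barrier e^{At}(1 + x²) is a strict supersolution: 2κ absorbs its Laplacian, and
  -- U absorbs the advection because |2x u₁| ≤ U(1 + x²).
  set A := 2 * κ + U + 1 with hA
  have hApos : 0 ≤ A := by positivity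
  -- The barrier takes back half of the negative value at (t₀, p₀), so ζ is still negative there.
  set ε := -(Real.exp (-L * t₀) * w t₀ p₀) / (2 * (Real.exp (A * t₀) * (1 + p₀.1 ^ 2))) with hε
  have hεpos : 0 < ε := by
    have := mul_neg_of_pos_of_neg (Real.exp_pos (-L * t₀)) hneg
    exact div_pos (by linarith) (by positivity)
  set ζ : ℝ × (ℝ × ℝ) → ℝ := fun q =>
    Real.exp (-L * q.1) * w q.1 q.2 + ε * Real.exp (A * q.1) * (1 + q.2.1 ^ 2) with hζ
  have hζ0 : ζ (t₀, (p₀.1, y₀)) < 0 := by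
    have h1 : ε * (2 * (Real.exp (A * t₀) * (1 + p₀.1 ^ 2))) = -(Real.exp (-L * t₀) * w t₀ p₀) :=
      div_mul_cancel₀ _ (by positivity)
    have := mul_neg_of_pos_of_neg (Real.exp_pos (-L * t₀)) hneg
    simp only [hζ, hyw]
    linarith
  -- For |x| > R the barrier exceeds |B|, so ζ can be negative only inside the box; the summand 1
  -- ensures R ≤ R².
  obtain ⟨R, hR⟩ : ∃ R, R = |p₀.1| + |B| / ε + 1 := ⟨_, rfl⟩
  have hBε : 0 ≤ |B| / ε := by positivity
  have hsub : Icc 0 t₀ ×ˢ (Icc (-R) R ×ˢ Icc 0 H) ⊆ Ici 0 ×ˢ bc.domain H :=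
    Set.prod_mono (fun s hs => hs.1) (Set.prod_mono (subset_univ _) (bc.Icc_subset_yRange H))
  have hmem0 : (t₀, (p₀.1, y₀)) ∈ Icc 0 t₀ ×ˢ (Icc (-R) R ×ˢ Icc 0 H) := by
    have := abs_le.1 (show |p₀.1| ≤ R by linarith)
    exact ⟨⟨ht₀, le_rfl⟩, this, hy₀⟩
  have hζc : ContinuousOn ζ (Icc 0 t₀ ×ˢ (Icc (-R) R ×ˢ Icc 0 H)) := by
    have := hc.mono hsub
    have h1 : ContinuousOn (fun q : ℝ × (ℝ × ℝ) => Real.exp (-L * q.1))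
      (Icc 0 t₀ ×ˢ (Icc (-R) R ×ˢ Icc 0 H)) := by fun_prop
    have h2 : ContinuousOn (fun q : ℝ × (ℝ × ℝ) => ε * Real.exp (A * q.1) * (1 + q.2.1 ^ 2))
      (Icc 0 t₀ ×ˢ (Icc (-R) R ×ˢ Icc 0 H)) := by fun_prop
    exact (h1.mul this).add h2
  obtain ⟨⟨t, p⟩, htp, hmin⟩ := (isCompact_Icc.prod (isCompact_Icc.prod isCompact_Icc)).exists_isMinOn
    ⟨_, hmem0⟩ hζc
  have hζneg : ζ (t, p) < 0 := (hmin hmem0).trans_lt hζ0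
  have hpd : p ∈ bc.domain H := (hsub htp).2
  have ht : t ∈ Icc 0 t₀ := htp.1
  -- the minimum is global in space
  have hglob : ∀ s ∈ Icc 0 t₀, ∀ q ∈ bc.domain H, ζ (t, p) ≤ ζ (s, q) := by
    intro s hs q hq
    by_cases hqR : q.1 ∈ Icc (-R) R
    · obtain ⟨y, hy, he⟩ := (hbc s hs.1).exists_mem_Icc hH hq
      have : ζ (s, (q.1, y)) = ζ (s, q) := by simp only [hζ, he]
      exact this ▸ hmin ⟨hs, hqR, hy⟩
    · refine hζneg.le.trans ?_
      have h1 : R < |q.1| := by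
        by_contra! h
        exact hqR (abs_le.1 h)
      have h2 : |B| ≤ ε * (1 + q.1 ^ 2) := by
        rw [← div_le_iff₀' hεpos, ← sq_abs]
        nlinarith [abs_nonneg p₀.1]
      have h3 : Real.exp (-L * s) ≤ 1 := Real.exp_le_one_iff.2 (by nlinarith [hs.1])
      have h4 : 1 ≤ Real.exp (A * s) := Real.one_le_exp (mul_nonneg hApos hs.1)
      have h5 : -|B| ≤ Real.exp (-L * s) * w s q := by
        have := (neg_le_neg (le_abs_self B)).trans (hB s hs.1 q hq)
        have := Real.exp_pos (-L * s)
        nlinarith [abs_nonneg B]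
      have h6 : ε * (1 + q.1 ^ 2) ≤ ε * Real.exp (A * s) * (1 + q.1 ^ 2) := by
        have : 0 ≤ ε * (1 + q.1 ^ 2) := by positivity
        nlinarith
      simp only [hζ]
      linarith
  have hwneg : w t p < 0 := by
    by_contra! h
    have : 0 ≤ ζ (t, p) := by simp only [hζ]; positivity
    linarith
  have htpos : 0 < t := by
    rcases ht.1.eq_or_lt with h | h
    · rw [← h] at hwneg
      exact absurd hwneg (not_lt.2 (h0 p hpd))
    · exact h
  have hY := bc.uniqueDiffOn_yRange hH
  have hC2 : ContDiffOn ℝ 2 (w t) (univ ×ˢ bc.yRange H) := h2 t htpos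
  have hC1 : ContDiffOn ℝ 1 (w t) (univ ×ˢ bc.yRange H) := hC2.of_le one_le_two
  set c := Real.exp (-L * t) with hcdef
  have hcpos : 0 < c := Real.exp_pos _
  set a := ε * Real.exp (A * t) with hadef
  have hapos : 0 < a := by positivity
  have hline : ∀ s : ℝ, (s, p.2) ∈ (univ : Set ℝ) ×ˢ bc.yRange H := fun s => ⟨mem_univ _, hpd.2⟩
  -- first variable
  have hx1 : ∀ s : ℝ, HasDerivAt (fun s => c * w t (s, p.2) + a * (1 + s ^ 2))
      (c * partialFst (w t) (s, p.2) + a * (2 * s)) s := fun s => by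
    have := hasDerivAt_partialFst isOpen_univ hC1 (hline s)
    have h : HasDerivAt (fun s : ℝ => 1 + s ^ 2) (2 * s) s := by
      simpa using (hasDerivAt_pow 2 s).const_add 1
    exact (this.const_mul c).add (h.const_mul a)
  have hx2 : HasDerivAt (fun s => c * partialFst (w t) (s, p.2) + a * (2 * s))
      (c * partialFst (partialFst (w t)) p + a * 2) p.1 := by
    have := hasDerivAt_partialFst isOpen_univ
      (contDiffOn_partialFst (m := 1) isOpen_univ hY hC2 (by norm_num)) hpd
    have h : HasDerivAt (fun s : ℝ => 2 * s) 2 p.1 := by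
      simpa using (hasDerivAt_id p.1).const_mul 2
    exact (this.const_mul c).add (h.const_mul a)
  have hxmin : ∀ s : ℝ, c * w t (p.1, p.2) + a * (1 + p.1 ^ 2) ≤ c * w t (s, p.2) + a * (1 + s ^ 2) :=
    fun s => hglob t ht (s, p.2) (hline s)
  have hx0 : c * partialFst (w t) p + a * (2 * p.1) = 0 :=
    IsLocalMin.hasDerivAt_eq_zero (f := fun s => c * w t (s, p.2) + a * (1 + s ^ 2))
      (Eventually.of_forall hxmin) (hx1 p.1)
  have hxx : 0 ≤ c * partialFst (partialFst (w t)) p + a * 2 :=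
    second_deriv_nonneg_of_min ordConnected_univ ⟨0, trivial, 1, trivial, zero_ne_one⟩ (mem_univ p.1)
      (fun s _ => (hx1 s).hasDerivWithinAt) hx2.hasDerivWithinAt hx0 (fun s _ => hxmin s)
  -- second variable
  have hymin : ∀ y ∈ bc.yRange H, w t p ≤ w t (p.1, y) := fun y hy => by
    have := hglob t ht (p.1, y) ⟨mem_univ _, hy⟩
    simp only [hζ] at this
    exact le_of_mul_le_mul_left (by linarith) hcpos
  have hy0 : partialSnd (bc.yRange H) (w t) p = 0 := (hbc t ht.1).partialSnd_eq_zero hpd hymin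
  have hyy : 0 ≤ partialSnd (bc.yRange H) (partialSnd (bc.yRange H) (w t)) p :=
    second_deriv_nonneg_of_min (φ := fun s => w t (p.1, s))
      (φ' := fun s => partialSnd (bc.yRange H) (w t) (p.1, s)) (bc.ordConnected_yRange H) (bc.nontrivial_yRange hH) hpd.2
      (fun s hs => hasDerivWithinAt_partialSnd hY hC1 (p := (p.1, s)) ⟨mem_univ _, hs⟩)
      (hasDerivWithinAt_partialSnd hY
        (contDiffOn_partialSnd (m := 1) isOpen_univ hY hC2 (by norm_num)) hpd) hy0 hymin
  -- time
  have htd : HasDerivAt (fun s => Real.exp (-L * s) * w s p + ε * Real.exp (A * s) * (1 + p.1 ^ 2))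
      (c * -L * w t p + c * deriv (fun s => w s p) t + a * A * (1 + p.1 ^ 2)) t := by
    refine (((hasDerivAt_exp_mul (-L) t).mul (hd t htpos p hpd).hasDerivAt).add
      (((hasDerivAt_exp_mul A t).const_mul ε).mul_const (1 + p.1 ^ 2))).congr_deriv ?_
    rw [hadef]; ring
  have htmin := deriv_nonpos_of_left_min htpos htd
    (fun s hs => hglob s ⟨hs.1, hs.2.trans ht.2⟩ p hpd)
  have hw := heq t htpos p hpd hwneg
  -- The y-derivative vanishes at the minimum, which is why a bound for u₁ alone is enough.
  simp only [advection, laplacian, hy0, mul_zero, add_zero] at hw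
  set wt := deriv (fun s => w s p) t
  set wx := partialFst (w t) p
  set wxx := partialFst (partialFst (w t)) p
  set wyy := partialSnd (bc.yRange H) (partialSnd (bc.yRange H) (w t)) p
  have hu := abs_le.1 (hU p hpd)
  have k1 : c * (L * w t p) ≤ c * (wt + (u p).1 * wx - κ * (wxx + wyy)) :=
    mul_le_mul_of_nonneg_left hw hcpos.le
  have k2 : (u p).1 * (c * wx) = -(a * (2 * p.1 * (u p).1)) := by
    have : c * wx = -(a * (2 * p.1)) := by linarith
    rw [this]; ring
  have k3 : 0 ≤ κ * (c * wxx + a * 2 + c * wyy) :=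
    mul_nonneg hκ (add_nonneg hxx (mul_nonneg hcpos.le hyy))
  have k4 : a * (2 * p.1 * (u p).1) ≥ a * (-(U * (1 + p.1 ^ 2))) := by
    refine mul_le_mul_of_nonneg_left ?_ hapos.le
    have := mul_nonneg (sub_nonneg.2 hu.2) (sq_nonneg (1 - p.1))
    have := mul_nonneg (by linarith [hu.1] : 0 ≤ U + (u p).1) (sq_nonneg (1 + p.1))
    nlinarith
  have k5 : 0 < a * (1 + p.1 ^ 2) := by positivity
  have k6 : 0 ≤ a * κ * p.1 ^ 2 := by positivity
  have k7 : a * A * (1 + p.1 ^ 2) = a * κ * 2 + a * κ * p.1 ^ 2 * 2 + a * (U * (1 + p.1 ^ 2)) + a * (1 + p.1 ^ 2) := by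
    rw [hA]; ring
  linarith

end Comparison

/-! ### Bounds for the data and comparison of regular functions. -/

section Solutions

variable {bc : BoundaryKind} {H : ℝ}

theorem domain_eq (bc : BoundaryKind) (H : ℝ) : bc.domain H = univ ×ˢ bc.yRange H := rfl

theorem IsFlow.exists_bound {u : ℝ × ℝ → ℝ × ℝ} (hu : IsFlow bc H u) (hH : 0 < H) :
    ∃ U, 0 ≤ U ∧ ∀ p ∈ bc.domain H, |(u p).1| ≤ U := by
  obtain ⟨L, hL, hper⟩ := hu.periodic_x
  have hcont : ContinuousOn (fun p => (u p).1) (Icc 0 L ×ˢ Icc 0 H) :=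
    (hu.contDiffOn.fst.continuousOn).mono
      (Set.prod_mono (subset_univ _) (bc.Icc_subset_yRange H))
  obtain ⟨U, hU⟩ := (isCompact_Icc.prod isCompact_Icc).exists_bound_of_continuousOn hcont
  refine ⟨U, (norm_nonneg _).trans (hU (0, 0) ⟨⟨le_rfl, hL.le⟩, ⟨le_rfl, hH.le⟩⟩), fun p hp => ?_⟩
  obtain ⟨y, hy, hyu⟩ : ∃ y ∈ Icc 0 H, u (p.1, y) = u p := by
    have hb := hu.boundary
    cases bc
    · exact ⟨p.2, hp.2, rfl⟩
    · have hp2 : Function.Periodic (fun y => u (p.1, y)) H := fun y => hb p.1 y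
      obtain ⟨y, hy, he⟩ := hp2.exists_mem_Ico₀ hH p.2
      exact ⟨y, Ico_subset_Icc_self hy, he.symm⟩
  have hpx : Function.Periodic (fun x => u (x, y)) L := fun x =>
    hper x y (bc.Icc_subset_yRange H hy)
  obtain ⟨x, hx, he⟩ := hpx.exists_mem_Ico₀ hL p.1
  rw [← hyu, show u (p.1, y) = u (x, y) from he]
  exact hU (x, y) ⟨Ico_subset_Icc_self hx, hy⟩

theorem IsReaction.nonneg_Icc {f : ℝ → ℝ} (hf : IsReaction f) {s : ℝ} (hs : s ∈ Icc (0 : ℝ) 1) :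
    0 ≤ f s := by
  rcases hs.1.eq_or_lt with h | h
  · rw [← h, hf.zero]
  rcases hs.2.eq_or_lt with h' | h'
  · rw [h', hf.one]
  · exact hf.nonneg s ⟨h, h'⟩

/-- The constant L is used twice: as zero-order rate in comparison arguments, and, since f vanishes
at 0 and 1, in f(θ) ≤ L min(θ, 1 - θ). -/
theorem IsReaction.exists_lipschitz {f : ℝ → ℝ} (hf : IsReaction f) :
    ∃ L, 0 < L ∧ ∀ a ∈ Icc (0 : ℝ) 1, ∀ b ∈ Icc (0 : ℝ) 1, |f a - f b| ≤ L * |a - b| := by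
  have hd := hf.contDiffOn.differentiableOn one_ne_zero
  obtain ⟨C, hC⟩ := isCompact_Icc.exists_bound_of_continuousOn
    (hf.contDiffOn.continuousOn_derivWithin (uniqueDiffOn_Icc zero_lt_one) le_rfl)
  refine ⟨|C| + 1, by positivity, fun a ha b hb => ?_⟩
  have := (convex_Icc (0 : ℝ) 1).norm_image_sub_le_of_norm_derivWithin_le hd hC hb ha
  rw [Real.norm_eq_abs, Real.norm_eq_abs] at this
  exact this.trans (mul_le_mul_of_nonneg_right ((le_abs_self C).trans (by linarith)) (abs_nonneg _))

/-! ### Regular functions and the parabolic operator -/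

/-- The regularity of classical solutions, together with the boundary condition. -/
structure IsRegular (bc : BoundaryKind) (H : ℝ) (v : ℝ → ℝ × ℝ → ℝ) : Prop where
  continuousOn : ContinuousOn (fun q : ℝ × (ℝ × ℝ) => v q.1 q.2) (Ici 0 ×ˢ bc.domain H)
  contDiffOn : ∀ t, 0 ≤ t → ContDiffOn ℝ 2 (v t) (bc.domain H)
  differentiableAt : ∀ t, 0 < t → ∀ p ∈ bc.domain H, DifferentiableAt ℝ (fun s => v s p) t
  boundary : ∀ t, 0 ≤ t → bc.TemperatureCondition H (v t)

/-- The operator `v_t + u · ∇v - κ Δv`. -/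
noncomputable def parabolic (Y : Set ℝ) (κ : ℝ) (u : ℝ × ℝ → ℝ × ℝ) (v : ℝ → ℝ × ℝ → ℝ) (t : ℝ)
    (p : ℝ × ℝ) : ℝ :=
  deriv (fun s => v s p) t + advection Y u (v t) p - κ * laplacian Y (v t) p

section Linearity

variable {X Y : Set ℝ} {g₁ g₂ : ℝ × ℝ → ℝ} {p : ℝ × ℝ}

theorem partialFst_sub (hX : IsOpen X) (h₁ : ContDiffOn ℝ 1 g₁ (X ×ˢ Y))
    (h₂ : ContDiffOn ℝ 1 g₂ (X ×ˢ Y)) (hp : p ∈ X ×ˢ Y) :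
    partialFst (fun q => g₁ q - g₂ q) p = partialFst g₁ p - partialFst g₂ p :=
  ((hasDerivAt_partialFst hX h₁ hp).sub (hasDerivAt_partialFst hX h₂ hp)).deriv

theorem partialSnd_sub (hY : UniqueDiffOn ℝ Y) (h₁ : ContDiffOn ℝ 1 g₁ (X ×ˢ Y))
    (h₂ : ContDiffOn ℝ 1 g₂ (X ×ˢ Y)) (hp : p ∈ X ×ˢ Y) :
    partialSnd Y (fun q => g₁ q - g₂ q) p = partialSnd Y g₁ p - partialSnd Y g₂ p :=
  ((hasDerivWithinAt_partialSnd hY h₁ hp).sub (hasDerivWithinAt_partialSnd hY h₂ hp)).derivWithin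
    (hY p.2 hp.2)

theorem laplacian_sub (hY : UniqueDiffOn ℝ Y) (h₁ : ContDiffOn ℝ 2 g₁ (univ ×ˢ Y))
    (h₂ : ContDiffOn ℝ 2 g₂ (univ ×ˢ Y)) (hp : p ∈ (univ : Set ℝ) ×ˢ Y) :
    laplacian Y (fun q => g₁ q - g₂ q) p = laplacian Y g₁ p - laplacian Y g₂ p := by
  have o₁ : ContDiffOn ℝ 1 g₁ (univ ×ˢ Y) := h₁.of_le one_le_two
  have o₂ : ContDiffOn ℝ 1 g₂ (univ ×ˢ Y) := h₂.of_le one_le_two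
  have e1 : partialFst (partialFst fun q => g₁ q - g₂ q) p =
      partialFst (fun q => partialFst g₁ q - partialFst g₂ q) p := by
    refine congrArg (fun φ => deriv φ p.1) (funext fun s => ?_)
    exact partialFst_sub isOpen_univ o₁ o₂ ⟨mem_univ _, hp.2⟩
  have e2 : partialSnd Y (partialSnd Y fun q => g₁ q - g₂ q) p =
      partialSnd Y (fun q => partialSnd Y g₁ q - partialSnd Y g₂ q) p := by
    refine derivWithin_congr (fun s hs => ?_) ?_
    · exact partialSnd_sub hY o₁ o₂ ⟨mem_univ _, hs⟩
    · exact partialSnd_sub hY o₁ o₂ ⟨mem_univ _, hp.2⟩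
  have n : (1 : WithTop ℕ∞) + 1 ≤ 2 := by norm_num
  rw [laplacian, e1, e2, partialFst_sub isOpen_univ (contDiffOn_partialFst isOpen_univ hY h₁ n)
    (contDiffOn_partialFst isOpen_univ hY h₂ n) hp,
    partialSnd_sub hY (contDiffOn_partialSnd isOpen_univ hY h₁ n)
    (contDiffOn_partialSnd isOpen_univ hY h₂ n) hp, laplacian, laplacian]
  ring

end Linearity

namespace IsRegular

variable {v z : ℝ → ℝ × ℝ → ℝ}

theorem sub (hH : 0 < H) (hv : IsRegular bc H v) (hz : IsRegular bc H z) :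
    IsRegular bc H (fun t p => v t p - z t p) where
  continuousOn := hv.continuousOn.sub hz.continuousOn
  contDiffOn t ht := (hv.contDiffOn t ht).sub (hz.contDiffOn t ht)
  differentiableAt t ht p hp := (hv.differentiableAt t ht p hp).sub (hz.differentiableAt t ht p hp)
  boundary t ht := by
    have h1 := hv.boundary t ht
    have h2 := hz.boundary t ht
    have c1 := (hv.contDiffOn t ht).of_le one_le_two
    have c2 := (hz.contDiffOn t ht).of_le one_le_two
    cases bc
    · intro x
      have hY : UniqueDiffOn ℝ (Icc 0 H) := uniqueDiffOn_Icc hH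
      constructor
      · rw [partialSnd_sub hY c1 c2 ⟨mem_univ _, le_rfl, hH.le⟩, (h1 x).1, (h2 x).1, sub_zero]
      · rw [partialSnd_sub hY c1 c2 ⟨mem_univ _, hH.le, le_rfl⟩, (h1 x).2, (h2 x).2, sub_zero]
    · intro x y
      simp only [h1 x y, h2 x y]

theorem parabolic_sub {κ : ℝ} {u : ℝ × ℝ → ℝ × ℝ} (hH : 0 < H) (hv : IsRegular bc H v)
    (hz : IsRegular bc H z) {t : ℝ} (ht : 0 < t) {p : ℝ × ℝ} (hp : p ∈ bc.domain H) :
    parabolic (bc.yRange H) κ u (fun t p => v t p - z t p) t p =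
      parabolic (bc.yRange H) κ u v t p - parabolic (bc.yRange H) κ u z t p := by
  have hY := bc.uniqueDiffOn_yRange hH
  have c1 := hv.contDiffOn t ht.le
  have c2 := hz.contDiffOn t ht.le
  have o1 := c1.of_le one_le_two
  have o2 := c2.of_le one_le_two
  rw [domain_eq] at c1 c2 o1 o2 hp
  simp only [parabolic, advection]
  rw [laplacian_sub hY c1 c2 hp, partialFst_sub isOpen_univ o1 o2 hp, partialSnd_sub hY o1 o2 hp,
    deriv_fun_sub (hv.differentiableAt t ht p hp) (hz.differentiableAt t ht p hp)]
  ring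

theorem const {g : ℝ × ℝ → ℝ} (hg : ContDiffOn ℝ 2 g (bc.domain H))
    (hb : bc.TemperatureCondition H g) : IsRegular bc H (fun _ => g) where
  continuousOn := hg.continuousOn.comp continuousOn_snd fun _ hq => hq.2
  contDiffOn _ _ := hg
  differentiableAt _ _ _ _ := differentiableAt_const _
  boundary _ _ := hb

theorem shift (hv : IsRegular bc H v) {s : ℝ} (hs : 0 ≤ s) : IsRegular bc H (fun t => v (t + s)) where
  continuousOn := hv.continuousOn.comp (f := fun q : ℝ × (ℝ × ℝ) => (q.1 + s, q.2)) (by fun_prop)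
    fun q hq => ⟨add_nonneg (mem_Ici.1 hq.1) hs, hq.2⟩
  contDiffOn t ht := hv.contDiffOn (t + s) (by positivity)
  differentiableAt t ht p hp := by
    have := hv.differentiableAt (t + s) (by positivity) p hp
    exact (this.hasDerivAt.comp_add_const t s).differentiableAt
  boundary t ht := hv.boundary (t + s) (by positivity)

/-- These are the barriers for the decay at infinity. Being independent of y, they meet either
boundary condition. -/
theorem exponential (bc : BoundaryKind) (H A k m : ℝ) :
    IsRegular bc H (fun t p => A * Real.exp (k * p.1 + m * t)) where
  continuousOn := by fun_prop
  contDiffOn t ht := by fun_prop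
  differentiableAt t ht p hp := by fun_prop
  boundary t ht := by
    cases bc
    · intro x
      simp [partialSnd]
    · intro x y
      rfl

theorem parabolic_exponential (Y : Set ℝ) (κ : ℝ) (u : ℝ × ℝ → ℝ × ℝ) (A k m t : ℝ) (p : ℝ × ℝ) :
    parabolic Y κ u (fun t p => A * Real.exp (k * p.1 + m * t)) t p =
      (m + (u p).1 * k - κ * k ^ 2) * (A * Real.exp (k * p.1 + m * t)) := by
  have hx : ∀ (B s : ℝ), HasDerivAt (fun s => B * Real.exp (k * s + m * t))
      (B * k * Real.exp (k * s + m * t)) s := fun B s => by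
    have := ((((hasDerivAt_id s).const_mul k).add_const (m * t)).exp).const_mul B
    exact this.congr_deriv (by simp; ring)
  have ht : HasDerivAt (fun s => A * Real.exp (k * p.1 + m * s))
      (A * m * Real.exp (k * p.1 + m * t)) t := by
    have := ((((hasDerivAt_id t).const_mul m).const_add (k * p.1)).exp).const_mul A
    exact this.congr_deriv (by simp; ring)
  have h1 : partialFst (fun p : ℝ × ℝ => A * Real.exp (k * p.1 + m * t)) =
      fun p => A * k * Real.exp (k * p.1 + m * t) := funext fun q => (hx A q.1).deriv
  have h2 : partialFst (fun p : ℝ × ℝ => A * k * Real.exp (k * p.1 + m * t)) =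
      fun p => A * k * k * Real.exp (k * p.1 + m * t) := funext fun q => (hx (A * k) q.1).deriv
  have h3 : partialSnd Y (fun p : ℝ × ℝ => A * Real.exp (k * p.1 + m * t)) = fun _ => 0 := by
    funext q; simp [partialSnd]
  have h4 : partialSnd Y (fun _ => 0) = fun _ => 0 := by
    funext q; simp [partialSnd]
  simp only [parabolic, advection, laplacian, h1, h2, h3, h4, ht.deriv]
  ring

end IsRegular

/-- Comparison of a subsolution `z` with a supersolution `v`. -/
theorem le_of_parabolic {κ U L B : ℝ} {u : ℝ × ℝ → ℝ × ℝ} {v z : ℝ → ℝ × ℝ → ℝ}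
    (hH : 0 < H) (hκ : 0 ≤ κ) (hL : 0 ≤ L) (hU : ∀ p ∈ bc.domain H, |(u p).1| ≤ U)
    (hv : IsRegular bc H v) (hz : IsRegular bc H z)
    (hB : ∀ t, 0 ≤ t → ∀ p ∈ bc.domain H, -B ≤ v t p - z t p)
    (h0 : ∀ p ∈ bc.domain H, z 0 p ≤ v 0 p)
    (heq : ∀ t, 0 < t → ∀ p ∈ bc.domain H, v t p < z t p → L * (v t p - z t p) ≤
      parabolic (bc.yRange H) κ u v t p - parabolic (bc.yRange H) κ u z t p)
    {t : ℝ} (ht : 0 ≤ t) {p : ℝ × ℝ} (hp : p ∈ bc.domain H) : z t p ≤ v t p := by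
  have hr := hv.sub hH hz
  refine sub_nonneg.1 (nonneg_of_supersolution hH hκ hL hU hr.continuousOn
    (fun t ht => hr.contDiffOn t ht.le) hr.differentiableAt hr.boundary hB
    (fun p hp => sub_nonneg.2 (h0 p hp)) (fun t ht p hp hneg => ?_) t ht p hp)
  exact (heq t ht p hp (sub_neg.1 hneg)).trans_eq (hv.parabolic_sub hH hz ht hp).symm

/-- This supplies the zero-order term of `le_of_parabolic`, which is only needed where the
supersolution lies below the subsolution. -/
theorem reaction_sub_le {κ v₀ L a b : ℝ} {f : ℝ → ℝ} (hκ : 0 < κ)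
    (hLf : ∀ a ∈ Icc (0 : ℝ) 1, ∀ b ∈ Icc (0 : ℝ) 1, |f a - f b| ≤ L * |a - b|)
    (ha : a ∈ Icc (0 : ℝ) 1) (hb : b ∈ Icc (0 : ℝ) 1) (hab : a ≤ b) :
    v₀ ^ 2 / κ * L * (a - b) ≤ v₀ ^ 2 / κ * f a - v₀ ^ 2 / κ * f b := by
  have h1 := (abs_le.1 (hLf a ha b hb)).1
  rw [abs_of_nonpos (sub_nonpos.2 hab)] at h1
  have : 0 ≤ v₀ ^ 2 / κ := by positivity
  nlinarith

/-! ### Monotonicity in time and decay at infinity. -/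

namespace IsSolution

variable {κ v₀ : ℝ} {f : ℝ → ℝ} {u : ℝ × ℝ → ℝ × ℝ} {T : ℝ → ℝ × ℝ → ℝ}

theorem isRegular (hT : IsSolution bc H κ v₀ f u T) : IsRegular bc H T :=
  ⟨hT.continuousOn, hT.contDiffOn, hT.differentiableAt, hT.boundary⟩

theorem parabolic_eq (hT : IsSolution bc H κ v₀ f u T) {t : ℝ} (ht : 0 < t) {p : ℝ × ℝ}
    (hp : p ∈ bc.domain H) : parabolic (bc.yRange H) κ u T t p = v₀ ^ 2 / κ * f (T t p) := by
  rw [parabolic, hT.equation t ht p hp]; ring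

/-- `InitialMonotonicity` says exactly that T₀, viewed as constant in time, is a subsolution. -/
theorem initial_le (hT : IsSolution bc H κ v₀ f u T) (hf : IsReaction f) (hu : IsFlow bc H u)
    (hH : 0 < H) (hκ : 0 < κ) (hmono : InitialMonotonicity bc H κ v₀ f u (T 0)) {t : ℝ}
    (ht : 0 ≤ t) {p : ℝ × ℝ} (hp : p ∈ bc.domain H) : T 0 p ≤ T t p := by
  obtain ⟨U, -, hU⟩ := hu.exists_bound hH
  obtain ⟨L, hL, hLf⟩ := hf.exists_lipschitz
  refine le_of_parabolic (v := T) (z := fun _ => T 0) (B := 1) (L := v₀ ^ 2 / κ * L) (κ := κ) hH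
    hκ.le (by positivity) hU
    hT.isRegular (IsRegular.const (hT.contDiffOn 0 le_rfl) (hT.boundary 0 le_rfl))
    (fun t ht p hp => ?_) (fun _ _ => le_rfl) (fun t ht p hp hlt => ?_) ht hp
  · linarith [(hT.mem_Icc t ht p hp).1, (hT.mem_Icc 0 le_rfl p hp).2]
  · have h1 := reaction_sub_le (v₀ := v₀) hκ hLf (hT.mem_Icc t ht.le p hp) (hT.mem_Icc 0 le_rfl p hp) hlt.le
    have h2 : parabolic (bc.yRange H) κ u (fun _ => T 0) t p ≤ v₀ ^ 2 / κ * f (T 0 p) := by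
      have := hmono p hp
      simp only [parabolic, deriv_const]
      linarith
    rw [hT.parabolic_eq ht hp]
    linarith

/-- The equation is autonomous, so a time translate is again a solution, and `initial_le` orders the
two at time 0. -/
theorem le_shift (hT : IsSolution bc H κ v₀ f u T) (hf : IsReaction f) (hu : IsFlow bc H u)
    (hH : 0 < H) (hκ : 0 < κ) (hmono : InitialMonotonicity bc H κ v₀ f u (T 0)) {s t : ℝ}
    (hs : 0 ≤ s) (ht : 0 ≤ t) {p : ℝ × ℝ} (hp : p ∈ bc.domain H) : T t p ≤ T (t + s) p := by
  obtain ⟨U, -, hU⟩ := hu.exists_bound hH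
  obtain ⟨L, hL, hLf⟩ := hf.exists_lipschitz
  refine le_of_parabolic (v := fun t => T (t + s)) (z := T) (B := 1) (L := v₀ ^ 2 / κ * L) (κ := κ)
    hH hκ.le (by positivity) hU (hT.isRegular.shift hs) hT.isRegular
    (fun t ht p hp => ?_) (fun p hp => ?_) (fun t ht p hp hlt => ?_) ht hp
  · linarith [(hT.mem_Icc (t + s) (by positivity) p hp).1, (hT.mem_Icc t ht p hp).2]
  · simpa using hT.initial_le hf hu hH hκ hmono hs hp
  · have hts : 0 < t + s := by positivity
    have h1 := reaction_sub_le (v₀ := v₀) hκ hLf (hT.mem_Icc _ hts.le p hp) (hT.mem_Icc t ht.le p hp) hlt.le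
    have h2 : parabolic (bc.yRange H) κ u (fun t => T (t + s)) t p =
        parabolic (bc.yRange H) κ u T (t + s) p := by
      simp only [parabolic]
      rw [deriv_comp_add_const (fun r => T r p) s t]
    rw [h2, hT.parabolic_eq ht hp, hT.parabolic_eq hts hp]
    linarith

theorem deriv_nonneg (hT : IsSolution bc H κ v₀ f u T) (hf : IsReaction f) (hu : IsFlow bc H u)
    (hH : 0 < H) (hκ : 0 < κ) (hmono : InitialMonotonicity bc H κ v₀ f u (T 0)) {t : ℝ}
    (ht : 0 < t) {p : ℝ × ℝ} (hp : p ∈ bc.domain H) : 0 ≤ deriv (fun s => T s p) t := by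
  have h := (hT.differentiableAt t ht p hp).hasDerivAt.neg
  have := deriv_nonpos_of_left_min ht h fun s hs => neg_le_neg (by
    have := hT.le_shift hf hu hH hκ hmono (sub_nonneg.2 hs.2) hs.1 hp
    rwa [add_sub_cancel] at this)
  linarith

/-- Exponential decay persists in time. -/
theorem exists_decay (hT : IsSolution bc H κ v₀ f u T) (hf : IsReaction f) (hu : IsFlow bc H u)
    (hH : 0 < H) (hκ : 0 < κ) (hdec : InitialDecay bc H (T 0)) {t : ℝ} (ht : 0 ≤ t) :
    ∃ lam A : ℝ, 0 < lam ∧ 0 ≤ A ∧ ∀ p ∈ bc.domain H,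
      T t p ≤ A * Real.exp (-lam * p.1) ∧ 1 - T t p ≤ A * Real.exp (lam * p.1) := by
  obtain ⟨U, hU0, hU⟩ := hu.exists_bound hH
  obtain ⟨L, hL, hLf⟩ := hf.exists_lipschitz
  obtain ⟨lam, A₀, hlam, hdec⟩ := hdec
  set r := v₀ ^ 2 / κ with hr
  have hr0 : 0 ≤ r := by positivity
  -- A ≥ 1 puts each barrier above its function also on the half-line where `InitialDecay` does not
  -- bound that function.
  set A := max A₀ 1 with hA
  have hA1 : 1 ≤ A := le_max_right _ _
  -- The three summands pay for reaction, advection and diffusion, so both exponentials are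
  -- supersolutions.
  set m := r * L + U * lam + κ * lam ^ 2 with hm
  have hm0 : 0 ≤ m := by positivity
  have hexp : ∀ k x s : ℝ, 0 ≤ A * Real.exp (k * x + s) := fun k x s => by positivity
  refine ⟨lam, A * Real.exp (m * t), hlam, by positivity, fun p hp => ⟨?_, ?_⟩⟩
  · have := le_of_parabolic (v := fun t p => A * Real.exp (-lam * p.1 + m * t)) (z := T) (B := 1)
      (L := r * L) (κ := κ) hH hκ.le (by positivity) hU (IsRegular.exponential bc H A (-lam) m)
      hT.isRegular (fun t ht p hp => ?_) (fun p hp => ?_) (fun t ht p hp hlt => ?_) ht hp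
    · rw [Real.exp_add] at this
      linarith
    · linarith [(hT.mem_Icc t ht p hp).2, hexp (-lam) p.1 (m * t)]
    · have hT0 := hT.mem_Icc 0 le_rfl p hp
      rw [mul_zero, add_zero]
      rcases le_or_gt p.1 0 with h | h
      · have : 1 ≤ Real.exp (-lam * p.1) := Real.one_le_exp (by nlinarith)
        nlinarith [hT0.2]
      · exact (le_abs_self _).trans (((hdec p hp).2.1 h).trans
          (mul_le_mul_of_nonneg_right (le_max_left _ _) (Real.exp_pos _).le))
    · have hTt := hT.mem_Icc t ht.le p hp
      have h1 := reaction_sub_le (v₀ := v₀) hκ hLf ⟨le_rfl, zero_le_one⟩ hTt hTt.1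
      rw [hf.zero] at h1
      rw [hT.parabolic_eq ht hp, IsRegular.parabolic_exponential]
      have hu1 := abs_le.1 (hU p hp)
      have h2 : r * L ≤ m + (u p).1 * -lam - κ * (-lam) ^ 2 := by
        rw [hm]; nlinarith
      have := mul_le_mul_of_nonneg_right h2 (hexp (-lam) p.1 (m * t))
      linarith
  · have hone : IsRegular bc H (fun _ _ => (1 : ℝ)) := IsRegular.const contDiffOn_const (by
      cases bc
      · intro x; simp [partialSnd]
      · intro x y; rfl)
    -- The parabolic operator sends 1 - T to -r f(T) ≤ 0, so no zero-order term is needed here and L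
    -- = 0.
    have := le_of_parabolic (v := fun t p => A * Real.exp (lam * p.1 + m * t))
      (z := fun t p => 1 - T t p) (B := 1) (L := 0) (κ := κ) hH hκ.le le_rfl hU
      (IsRegular.exponential bc H A lam m) (hone.sub hH hT.isRegular)
      (fun t ht p hp => ?_) (fun p hp => ?_) (fun t ht p hp hlt => ?_) ht hp
    · rw [Real.exp_add] at this
      linarith
    · linarith [(hT.mem_Icc t ht p hp).1, hexp lam p.1 (m * t)]
    · have hT0 := hT.mem_Icc 0 le_rfl p hp
      rw [mul_zero, add_zero]
      rcases le_or_gt 0 p.1 with h | h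
      · have : 1 ≤ Real.exp (lam * p.1) := Real.one_le_exp (by positivity)
        nlinarith [hT0.1]
      · exact (le_abs_self _).trans (((hdec p hp).1 h).trans
          (mul_le_mul_of_nonneg_right (le_max_left _ _) (Real.exp_pos _).le))
    · have hz : parabolic (bc.yRange H) κ u (fun _ _ => (1 : ℝ)) t p = 0 := by
        have h3 : partialSnd (bc.yRange H) (fun _ => (1 : ℝ)) = fun _ => 0 := by
          funext q; simp [partialSnd]
        have h4 : partialFst (fun _ => (1 : ℝ)) = fun _ => 0 := by
          funext q; simp [partialFst]
        simp [parabolic, advection, laplacian, h3, h4]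
        simp [partialFst, partialSnd]
      rw [hone.parabolic_sub hH hT.isRegular ht hp, hz, hT.parabolic_eq ht hp,
        IsRegular.parabolic_exponential]
      have hu1 := abs_le.1 (hU p hp)
      have h2 : 0 ≤ m + (u p).1 * lam - κ * lam ^ 2 := by
        have : 0 ≤ r * L := by positivity
        rw [hm]; nlinarith
      have := mul_nonneg h2 (hexp lam p.1 (m * t))
      have := mul_nonneg hr0 (hf.nonneg_Icc (hT.mem_Icc t ht.le p hp))
      linarith

end IsSolution

end Solutions

/-! ### Energy identities on a time slice. -/

/-- A time slice `θ` of a solution, with time derivative `τ`. -/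
structure IsProfile (bc : BoundaryKind) (H κ r : ℝ) (f : ℝ → ℝ) (u : ℝ × ℝ → ℝ × ℝ)
    (θ τ : ℝ × ℝ → ℝ) : Prop where
  contDiffOn : ContDiffOn ℝ 2 θ (bc.domain H)
  mem_Icc : ∀ p ∈ bc.domain H, θ p ∈ Icc (0 : ℝ) 1
  equation : ∀ p ∈ bc.domain H,
    τ p + advection (bc.yRange H) u θ p = κ * laplacian (bc.yRange H) θ p + r * f (θ p)
  nonneg : ∀ p ∈ bc.domain H, 0 ≤ τ p
  boundary : bc.TemperatureCondition H θ
  decay : ∃ lam A : ℝ, 0 < lam ∧ 0 ≤ A ∧ ∀ p ∈ bc.domain H,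
    θ p ≤ A * Real.exp (-lam * p.1) ∧ 1 - θ p ≤ A * Real.exp (lam * p.1)

/-- The squared length of the gradient. -/
noncomputable def gradSq (Y : Set ℝ) (θ : ℝ × ℝ → ℝ) (p : ℝ × ℝ) : ℝ :=
  partialFst θ p ^ 2 + partialSnd Y θ p ^ 2

theorem gradSq_nonneg (Y : Set ℝ) (θ : ℝ × ℝ → ℝ) (p : ℝ × ℝ) : 0 ≤ gradSq Y θ p := by
  unfold gradSq; positivity

theorem measurableSet_strip (H : ℝ) : MeasurableSet (strip H) :=
  MeasurableSet.univ.prod measurableSet_Icc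

theorem rectangle_subset_strip (a b H : ℝ) : Icc a b ×ˢ Icc 0 H ⊆ strip H :=
  Set.prod_mono (subset_univ _) subset_rfl

theorem aecover_rectangle {H : ℝ} {a b : ℕ → ℝ} (ha : Tendsto a atTop atBot)
    (hb : Tendsto b atTop atTop) :
    AECover (volume.restrict (strip H)) atTop (fun n => Icc (a n) (b n) ×ˢ Icc 0 H) where
  ae_eventually_mem := by
    filter_upwards [ae_restrict_mem (measurableSet_strip H)] with p hp
    filter_upwards [ha.eventually (eventually_le_atBot p.1),
      hb.eventually (eventually_ge_atTop p.1)] with n h1 h2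
    exact ⟨⟨h1, h2⟩, hp.2⟩
  measurableSet n := measurableSet_Icc.prod measurableSet_Icc

theorem restrict_strip_rectangle (a b H : ℝ) :
    (volume.restrict (strip H)).restrict (Icc a b ×ˢ Icc 0 H) =
      (volume : Measure (ℝ × ℝ)).restrict (Icc a b ×ˢ Icc 0 H) :=
  Measure.restrict_restrict_of_subset (rectangle_subset_strip a b H)

theorem integrable_min_exp {lam : ℝ} (h : 0 < lam) :
    Integrable (fun x : ℝ => min (Real.exp (-lam * x)) (Real.exp (lam * x))) := by
  have h1 : IntegrableOn (fun x : ℝ => min (Real.exp (-lam * x)) (Real.exp (lam * x))) (Iic 0) := by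
    refine (integrableOn_exp_mul_Iic h 0).mono' (by fun_prop) (ae_of_all _ fun x => ?_)
    rw [Real.norm_of_nonneg (le_min (Real.exp_pos _).le (Real.exp_pos _).le)]
    exact min_le_right _ _
  have h2 : IntegrableOn (fun x : ℝ => min (Real.exp (-lam * x)) (Real.exp (lam * x))) (Ioi 0) := by
    refine (integrableOn_exp_mul_Ioi (neg_lt_zero.2 h) 0).mono' (by fun_prop)
      (ae_of_all _ fun x => ?_)
    rw [Real.norm_of_nonneg (le_min (Real.exp_pos _).le (Real.exp_pos _).le)]
    exact min_le_left _ _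
  rw [← integrableOn_univ, ← Iic_union_Ioi (a := (0 : ℝ))]
  exact h1.union h2

namespace IsProfile

variable {bc : BoundaryKind} {H κ r : ℝ} {f : ℝ → ℝ} {u : ℝ × ℝ → ℝ × ℝ} {θ τ : ℝ × ℝ → ℝ}

theorem continuousOn_gradSq (hθ : IsProfile bc H κ r f u θ τ) (hH : 0 < H) :
    ContinuousOn (gradSq (bc.yRange H) θ) (bc.domain H) := by
  have hY := bc.uniqueDiffOn_yRange hH
  have n : (0 : WithTop ℕ∞) + 1 ≤ 2 := by norm_num
  exact ((contDiffOn_partialFst isOpen_univ hY hθ.contDiffOn n).continuousOn.pow 2).add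
    ((contDiffOn_partialSnd isOpen_univ hY hθ.contDiffOn n).continuousOn.pow 2)

theorem continuousOn_reaction (hθ : IsProfile bc H κ r f u θ τ) (hf : IsReaction f) :
    ContinuousOn (fun p => f (θ p)) (bc.domain H) :=
  hf.contDiffOn.continuousOn.comp hθ.contDiffOn.continuousOn hθ.mem_Icc

/-- `IsSolution` contains no continuity of T_t; the equation expresses τ through θ and its space
derivatives, which are continuous. -/
theorem continuousOn_time_deriv (hθ : IsProfile bc H κ r f u θ τ) (hf : IsReaction f)
    (hu : IsFlow bc H u) (hH : 0 < H) : ContinuousOn τ (bc.domain H) := by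
  have hY := bc.uniqueDiffOn_yRange hH
  have n : (1 : WithTop ℕ∞) + 1 ≤ 2 := by norm_num
  have m : (0 : WithTop ℕ∞) + 1 ≤ 1 := by norm_num
  have hx := contDiffOn_partialFst isOpen_univ hY hθ.contDiffOn n
  have hy := contDiffOn_partialSnd isOpen_univ hY hθ.contDiffOn n
  have hxx := (contDiffOn_partialFst isOpen_univ hY hx m).continuousOn
  have hyy := (contDiffOn_partialSnd isOpen_univ hY hy m).continuousOn
  have hfc := hθ.continuousOn_reaction hf
  have hu1 := hu.contDiffOn.fst.continuousOn
  have hu2 := hu.contDiffOn.snd.continuousOn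
  refine (((continuousOn_const (c := κ)).mul (hxx.add hyy)).add ((continuousOn_const (c := r)).mul hfc) |>.sub
    ((hu1.mul hx.continuousOn).add (hu2.mul hy.continuousOn))).congr fun p hp => ?_
  exact eq_sub_of_add_eq (hθ.equation p hp)

/-- Because f vanishes at both limits 0 and 1, f(θ) ≤ L min(θ, 1 - θ), which decays exponentially in
both directions. -/
theorem integrableOn_reaction (hθ : IsProfile bc H κ r f u θ τ) (hf : IsReaction f) :
    IntegrableOn (fun p => f (θ p)) (strip H) := by
  obtain ⟨L, hL, hLf⟩ := hf.exists_lipschitz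
  obtain ⟨lam, A, hlam, hA, hdec⟩ := hθ.decay
  have hdom := ((integrable_min_exp hlam).integrableOn (s := univ)).integrable.mul_prod
    (integrable_const (L * A) : Integrable (fun _ : ℝ => L * A) (volume.restrict (Icc 0 H)))
  rw [Measure.prod_restrict] at hdom
  refine hdom.mono' (((hθ.continuousOn_reaction hf).mono
    (bc.strip_subset_domain H)).aestronglyMeasurable (measurableSet_strip H)) ?_
  filter_upwards [ae_restrict_mem (measurableSet_strip H)] with p hp
  have hpd := bc.strip_subset_domain H hp
  have hm := hθ.mem_Icc p hpd
  have h0 := hf.nonneg_Icc hm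
  have h1 := hLf (θ p) hm 0 ⟨le_rfl, zero_le_one⟩
  have h2 := hLf (θ p) hm 1 ⟨zero_le_one, le_rfl⟩
  rw [hf.zero, sub_zero, sub_zero, abs_of_nonneg h0, abs_of_nonneg hm.1] at h1
  rw [hf.one, sub_zero, abs_of_nonneg h0, abs_of_nonpos (by linarith [hm.2]), neg_sub] at h2
  rw [Real.norm_of_nonneg h0]
  rcases min_cases (Real.exp (-lam * p.1)) (Real.exp (lam * p.1)) with ⟨e, -⟩ | ⟨e, -⟩ <;> rw [e]
  · nlinarith [mul_le_mul_of_nonneg_left (hdec p hpd).1 hL.le]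
  · nlinarith [mul_le_mul_of_nonneg_left (hdec p hpd).2 hL.le]

theorem tendsto_zero (hθ : IsProfile bc H κ r f u θ τ) {ι : Type*} {l : Filter ι} {q : ι → ℝ × ℝ}
    (hq : ∀ i, q i ∈ bc.domain H) (hl : Tendsto (fun i => (q i).1) l atTop) :
    Tendsto (fun i => θ (q i)) l (𝓝 0) := by
  obtain ⟨lam, A, hlam, hA, hdec⟩ := hθ.decay
  have h : Tendsto (fun i => A * Real.exp (-lam * (q i).1)) l (𝓝 0) := by
    simpa using (Real.tendsto_exp_atBot.comp
      (hl.const_mul_atTop_of_neg (neg_lt_zero.2 hlam))).const_mul A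
  exact squeeze_zero (fun i => (hθ.mem_Icc _ (hq i)).1) (fun i => (hdec _ (hq i)).1) h

theorem tendsto_one (hθ : IsProfile bc H κ r f u θ τ) {ι : Type*} {l : Filter ι} {q : ι → ℝ × ℝ}
    (hq : ∀ i, q i ∈ bc.domain H) (hl : Tendsto (fun i => (q i).1) l atBot) :
    Tendsto (fun i => θ (q i)) l (𝓝 1) := by
  obtain ⟨lam, A, hlam, hA, hdec⟩ := hθ.decay
  have h : Tendsto (fun i => A * Real.exp (lam * (q i).1)) l (𝓝 0) := by
    simpa using (Real.tendsto_exp_atBot.comp (hl.const_mul_atBot hlam)).const_mul A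
  have := squeeze_zero (fun i => sub_nonneg.2 (hθ.mem_Icc _ (hq i)).2) (fun i => (hdec _ (hq i)).2) h
  simpa using this.const_sub 1

theorem continuous_line {φ : ℝ × ℝ → ℝ} (hφ : ContinuousOn φ (bc.domain H)) (x : ℝ) :
    ContinuousOn (fun y => φ (x, y)) (Icc 0 H) :=
  hφ.comp (by fun_prop) fun _ hy => ⟨mem_univ _, bc.Icc_subset_yRange H hy⟩

/-- Convergence of integrals over cross-sections that move to infinity. -/
theorem tendsto_section (hθ : IsProfile bc H κ r f u θ τ) (hH : 0 < H) {G : ℝ → ℝ}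
    (hG : Continuous G) {w : ℝ × ℝ → ℝ} (hw : ContinuousOn w (bc.domain H)) {U : ℝ}
    (hU : ∀ p ∈ bc.domain H, |w p| ≤ U) {c : ℝ} {b : ℕ → ℝ}
    (hb : ∀ y ∈ Icc 0 H, Tendsto (fun n => θ (b n, y)) atTop (𝓝 c)) :
    Tendsto (fun n => ∫ y in 0..H, w (b n, y) * (G (θ (b n, y)) - G c)) atTop (𝓝 0) := by
  obtain ⟨M, hM⟩ := isCompact_Icc.exists_bound_of_continuousOn (s := Icc (0 : ℝ) 1)
    (f := fun s => G s - G c) (by fun_prop)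
  have hsub : ∀ y ∈ uIoc 0 H, y ∈ Icc 0 H := fun y hy => by
    rw [uIoc_of_le hH.le] at hy
    exact Ioc_subset_Icc_self hy
  have hmem : ∀ x, ∀ y ∈ Icc 0 H, (x, y) ∈ bc.domain H := fun x y hy =>
    ⟨mem_univ _, bc.Icc_subset_yRange H hy⟩
  suffices h : Tendsto (fun n => ∫ y in 0..H, w (b n, y) * (G (θ (b n, y)) - G c)) atTop
      (𝓝 (∫ y in 0..H, (0 : ℝ))) by simpa using h
  refine intervalIntegral.tendsto_integral_filter_of_dominated_convergence (fun _ => U * M)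
    (Eventually.of_forall fun n => ?_) (Eventually.of_forall fun n => ae_of_all _ fun y hy => ?_)
    intervalIntegrable_const (ae_of_all _ fun y hy => ?_)
  · have h1 : ContinuousOn (fun y => w (b n, y) * (G (θ (b n, y)) - G c)) (Icc 0 H) :=
      continuous_line (hw.mul ((hG.comp_continuousOn hθ.contDiffOn.continuousOn).sub
        continuousOn_const)) (b n)
    exact (h1.mono hsub).aestronglyMeasurable measurableSet_uIoc
  · have hp := hmem (b n) y (hsub y hy)
    rw [norm_mul]
    exact mul_le_mul (hU _ hp) (hM _ (hθ.mem_Icc _ hp)) (norm_nonneg _)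
      ((abs_nonneg _).trans (hU _ hp))
  · have h1 : Tendsto (fun n => G (θ (b n, y)) - G c) atTop (𝓝 0) := by
      simpa using ((hG.tendsto c).comp (hb y (hsub y hy))).sub_const (G c)
    refine squeeze_zero_norm (a := fun n => U * ‖G (θ (b n, y)) - G c‖) (fun n => ?_) ?_
    · rw [norm_mul]
      exact mul_le_mul_of_nonneg_right (hU _ (hmem (b n) y (hsub y hy))) (norm_nonneg _)
    · simpa using h1.norm.const_mul U

/-- The boundary terms of the energy identities vanish along a sequence of cross-sections. -/
theorem exists_sections (hθ : IsProfile bc H κ r f u θ τ) (hu : IsFlow bc H u) (hH : 0 < H)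
    {g G : ℝ → ℝ} (hg : Continuous g) (hG : ∀ s, HasDerivAt G (g s) s) {c : ℝ} {z : ℕ → ℝ}
    (hz : ∀ b : ℕ → ℝ, (∀ n, b n ∈ Icc (z n) (z n + 1)) →
      ∀ y ∈ Icc 0 H, Tendsto (fun n => θ (b n, y)) atTop (𝓝 c)) :
    ∃ b : ℕ → ℝ, (∀ n, b n ∈ Icc (z n) (z n + 1)) ∧
      Tendsto (fun n => ∫ y in 0..H, fluxFst κ u g G θ (b n, y)) atTop (𝓝 0) := by
  have hY := bc.uniqueDiffOn_yRange hH
  have hGc : Continuous G := continuous_iff_continuousAt.2 fun s => (hG s).continuousAt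
  have hθ1 : ContDiffOn ℝ 1 θ (univ ×ˢ bc.yRange H) := hθ.contDiffOn.of_le one_le_two
  have hθc := hθ.contDiffOn.continuousOn
  have hxc : ContinuousOn (partialFst θ) (bc.domain H) :=
    (contDiffOn_partialFst (m := 0) isOpen_univ hY hθ.contDiffOn (by norm_num)).continuousOn
  have hmem : ∀ x, ∀ y ∈ Icc 0 H, (x, y) ∈ bc.domain H := fun x y hy =>
    ⟨mem_univ _, bc.Icc_subset_yRange H hy⟩
  have hsub : ∀ y ∈ uIoc 0 H, y ∈ Icc 0 H := fun y hy => by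
    rw [uIoc_of_le hH.le] at hy
    exact Ioc_subset_Icc_self hy
  have hFc : ContinuousOn (fun p => g (θ p) * partialFst θ p) (bc.domain H) :=
    (hg.comp_continuousOn hθc).mul hxc
  have hGθ : ContinuousOn (fun p => G (θ p)) (bc.domain H) := hGc.comp_continuousOn hθc
  -- There is no pointwise decay of ∇θ at hand. However, the section integral of g(θ)θ_x is the
  -- x-derivative of that of G(θ), so by the mean value theorem each unit interval contains a
  -- section where it equals a difference of two values with a common limit.
  have hderiv : ∀ x, HasDerivAt (fun x => ∫ y in 0..H, G (θ (x, y)))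
      (∫ y in 0..H, g (θ (x, y)) * partialFst θ (x, y)) x := by
    intro x
    obtain ⟨M, hM⟩ := (isCompact_Icc.prod isCompact_Icc).exists_bound_of_continuousOn
      (hFc.mono (fun p hp => hmem p.1 p.2 hp.2 : Icc (x - 1) (x + 1) ×ˢ Icc 0 H ⊆ bc.domain H))
    refine (intervalIntegral.hasDerivAt_integral_of_dominated_loc_of_deriv_le
      (F := fun x y => G (θ (x, y))) (F' := fun x y => g (θ (x, y)) * partialFst θ (x, y))
      (bound := fun _ => M) (Icc_mem_nhds (by linarith : x - 1 < x) (by linarith : x < x + 1))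
      (Eventually.of_forall fun s => ?_) ?_ ?_ (ae_of_all _ fun y hy s hs => ?_)
      intervalIntegrable_const (ae_of_all _ fun y hy s hs => ?_)).2
    · exact ((continuous_line hGθ s).mono hsub).aestronglyMeasurable measurableSet_uIoc
    · exact ContinuousOn.intervalIntegrable_of_Icc hH.le (continuous_line hGθ x)
    · exact ((continuous_line hFc x).mono hsub).aestronglyMeasurable measurableSet_uIoc
    · exact hM (s, y) ⟨hs, hsub y hy⟩
    · exact (hG _).comp s (hasDerivAt_partialFst isOpen_univ hθ1 (p := (s, y))
        (hmem s y (hsub y hy)))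
  have hslope : ∀ n, ∃ b ∈ Ioo (z n) (z n + 1),
      ∫ y in 0..H, g (θ (b, y)) * partialFst θ (b, y) =
        (∫ y in 0..H, G (θ (z n + 1, y))) - ∫ y in 0..H, G (θ (z n, y)) := fun n => by
    obtain ⟨b, hb, he⟩ := exists_hasDerivAt_eq_slope _ _ (by linarith : z n < z n + 1)
      (fun x _ => (hderiv x).continuousAt.continuousWithinAt) (fun x _ => hderiv x)
    exact ⟨b, hb, by simpa using he⟩
  choose b hb he using hslope
  have hb' : ∀ n, b n ∈ Icc (z n) (z n + 1) := fun n => Ioo_subset_Icc_self (hb n)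
  refine ⟨b, hb', ?_⟩
  obtain ⟨U, -, hU⟩ := hu.exists_bound hH
  have hu1 : ContinuousOn (fun p => (u p).1) (bc.domain H) := hu.contDiffOn.fst.continuousOn
  have t1 := hθ.tendsto_section hH hGc hu1 hU (hz b hb')
  have hone : ∀ p ∈ bc.domain H, |(fun _ : ℝ × ℝ => (1 : ℝ)) p| ≤ 1 := fun p _ => by simp
  have t2 := hθ.tendsto_section hH hGc continuousOn_const hone
    (hz (fun n => z n + 1) fun n => ⟨by linarith, le_rfl⟩)
  have t3 := hθ.tendsto_section hH hGc continuousOn_const hone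
    (hz z fun n => ⟨le_rfl, by linarith⟩)
  have t4 := ((t2.sub t3).const_mul κ).sub t1
  simp only [sub_zero, mul_zero] at t4
  refine t4.congr fun n => ?_
  have iG : ∀ x, IntervalIntegrable (fun y => G (θ (x, y))) volume 0 H := fun x =>
    ContinuousOn.intervalIntegrable_of_Icc hH.le (continuous_line hGθ x)
  have iF : IntervalIntegrable (fun y => g (θ (b n, y)) * partialFst θ (b n, y)) volume 0 H :=
    ContinuousOn.intervalIntegrable_of_Icc hH.le (continuous_line hFc _)
  have iu : IntervalIntegrable (fun y => (u (b n, y)).1) volume 0 H :=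
    ContinuousOn.intervalIntegrable_of_Icc hH.le (continuous_line hu1 _)
  have iuG : IntervalIntegrable (fun y => (u (b n, y)).1 * G (θ (b n, y))) volume 0 H :=
    ContinuousOn.intervalIntegrable_of_Icc hH.le (continuous_line (hu1.mul hGθ) _)
  have k1 : ∫ y in 0..H, fluxFst κ u g G θ (b n, y) =
      κ * (∫ y in 0..H, g (θ (b n, y)) * partialFst θ (b n, y)) -
        ∫ y in 0..H, (u (b n, y)).1 * G (θ (b n, y)) := by
    simp only [fluxFst]
    rw [intervalIntegral.integral_sub (iF.const_mul κ) iuG, intervalIntegral.integral_const_mul]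
  -- The zero mean of u₁ allows G(c) to be subtracted, so the convective term vanishes at infinity
  -- whatever the limit c is.
  have k2 : ∫ y in 0..H, (u (b n, y)).1 * (G (θ (b n, y)) - G c) =
      ∫ y in 0..H, (u (b n, y)).1 * G (θ (b n, y)) := by
    simp only [mul_sub]
    rw [intervalIntegral.integral_sub iuG (iu.mul_const _), intervalIntegral.integral_mul_const,
      hu.mean_zero, zero_mul, sub_zero]
  rw [k1, he, k2]
  simp only [one_mul]
  rw [intervalIntegral.integral_sub (iG _) intervalIntegrable_const,
    intervalIntegral.integral_sub (iG _) intervalIntegrable_const]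
  ring

/-- Consequently the top and bottom of a rectangle cancel in the divergence theorem: both fluxes
vanish at walls, and they agree by periodicity otherwise. -/
theorem fluxSnd_eq (hθ : IsProfile bc H κ r f u θ τ) (hu : IsFlow bc H u) (g G : ℝ → ℝ) (x : ℝ) :
    fluxSnd (bc.yRange H) κ u g G θ (x, H) = fluxSnd (bc.yRange H) κ u g G θ (x, 0) := by
  have h1 := hθ.boundary
  have h2 := hu.boundary
  cases bc
  · have e1 : partialSnd (BoundaryKind.neumann.yRange H) θ (x, 0) = 0 := (h1 x).1
    have e2 : partialSnd (BoundaryKind.neumann.yRange H) θ (x, H) = 0 := (h1 x).2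
    simp [fluxSnd, e1, e2, (h2 x).1, (h2 x).2]
  · have e1 : θ (x, H) = θ (x, 0) := by simpa using h1 x 0
    have e2 : u (x, H) = u (x, 0) := by simpa using h2 x 0
    have e3 : partialSnd univ θ (x, H) = partialSnd univ θ (x, 0) := by
      simp only [partialSnd, derivWithin_univ]
      have : (fun s => θ (x, s)) = fun s => θ (x, s + H) := funext fun s => (h1 x s).symm
      conv_rhs => rw [this, deriv_comp_add_const (fun s => θ (x, s)) H 0, zero_add]
    have e4 : partialSnd (BoundaryKind.periodic.yRange H) θ (x, H) =
      partialSnd (BoundaryKind.periodic.yRange H) θ (x, 0) := e3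
    simp only [fluxSnd, e1, e2, e4]

/-- The energy identities in the limit of infinitely long rectangles. -/
theorem exists_rectangles (hθ : IsProfile bc H κ r f u θ τ) (hu : IsFlow bc H u) (hH : 0 < H)
    {g G : ℝ → ℝ} (hg : ContDiff ℝ 1 g) (hG : ContDiff ℝ 1 G) (hGg : ∀ s, deriv G s = g s) :
    ∃ a b : ℕ → ℝ, Tendsto a atTop atBot ∧ Tendsto b atTop atTop ∧
      Tendsto (fun n => ∫ p in Icc (a n) (b n) ×ˢ Icc 0 H,
        (κ * (deriv g (θ p) * gradSq (bc.yRange H) θ p) + g (θ p) * (τ p - r * f (θ p))))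
        atTop (𝓝 0) := by
  have hY := bc.uniqueDiffOn_yRange hH
  have hGd : ∀ s, HasDerivAt G (g s) s := fun s =>
    hGg s ▸ (hG.differentiable one_ne_zero s).hasDerivAt
  have hnat : Tendsto (fun n : ℕ => (n : ℝ)) atTop atTop := tendsto_natCast_atTop_atTop
  have hmem : ∀ x, ∀ y ∈ Icc 0 H, (x, y) ∈ bc.domain H := fun x y hy =>
    ⟨mem_univ _, bc.Icc_subset_yRange H hy⟩
  have hbtop : ∀ b : ℕ → ℝ, (∀ n : ℕ, b n ∈ Icc (n : ℝ) (n + 1)) → Tendsto b atTop atTop :=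
    fun b hb => tendsto_atTop_mono (fun n => (hb n).1) hnat
  have habot : ∀ a : ℕ → ℝ, (∀ n : ℕ, a n ∈ Icc (-n - 1 : ℝ) (-n - 1 + 1)) →
      Tendsto a atTop atBot := fun a ha =>
    tendsto_atBot_mono (fun n => by linarith [(ha n).2] : ∀ n : ℕ, a n ≤ -n)
      (tendsto_neg_atTop_atBot.comp hnat)
  obtain ⟨b, hb, hbt⟩ := hθ.exists_sections hu hH hg.continuous hGd (c := 0)
    (z := fun n => n) (fun b hb y hy => hθ.tendsto_zero (q := fun n => (b n, y))
      (fun n => hmem _ y hy) (hbtop b hb))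
  obtain ⟨a, ha, hat⟩ := hθ.exists_sections hu hH hg.continuous hGd (c := 1)
    (z := fun n => -n - 1) (fun a ha y hy => hθ.tendsto_one (q := fun n => (a n, y))
      (fun n => hmem _ y hy) (habot a ha))
  refine ⟨a, b, habot a ha, hbtop b hb, ?_⟩
  have hlim := hbt.sub hat
  rw [sub_zero] at hlim
  refine hlim.congr fun n => ?_
  have hab : a n ≤ b n := by
    have := (ha n).2; have := (hb n).1; have : (0 : ℝ) ≤ n := n.cast_nonneg
    linarith
  have hdiv := integral_divergence_rectangle isOpen_univ hY
    (contDiffOn_fluxFst (κ := κ) hY hu.contDiffOn hg hG hθ.contDiffOn)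
    (contDiffOn_fluxSnd (κ := κ) hY hu.contDiffOn hg hG hθ.contDiffOn) hab hH.le
    (Set.prod_mono (subset_univ _) (bc.Icc_subset_yRange H))
  simp only [hθ.fluxSnd_eq hu g G, sub_self, zero_add] at hdiv
  rw [← hdiv]
  refine setIntegral_congr_fun (measurableSet_Icc.prod measurableSet_Icc) fun p hp => ?_
  have hpd : p ∈ bc.domain H := hmem p.1 p.2 hp.2
  simp only [divergence_flux hY hu.contDiffOn hu.incompressible hg hG hGg hθ.contDiffOn hpd]
  rw [gradSq]
  linear_combination (-g (θ p)) * hθ.equation p hpd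

end IsProfile

/-! ### The cutoff in temperature, the total energy and the flow-free lower bound. -/

/-- A cutoff function `g` of the temperature, with primitive `G`, that is controlled by the
reaction rate. -/
structure IsCutoff (f g G : ℝ → ℝ) (B : ℝ) : Prop where
  contDiff : ContDiff ℝ 1 g
  contDiff_primitive : ContDiff ℝ 1 G
  deriv_primitive : ∀ s, deriv G s = g s
  nonneg : ∀ s, 0 ≤ g s
  le_one : ∀ s, g s ≤ 1
  le_reaction : ∀ s ∈ Icc (0 : ℝ) 1, g s ≤ B * f s
  deriv_le : ∀ s, |deriv g s| ≤ B
  one_le : 1 ≤ B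
  lt : G 0 < G 1

/-- Near a point s₀ with f(s₀) > 0 one has f > f(s₀)/2; a smooth bump supported there satisfies g ≤
1 ≤ (2/f(s₀)) f on its support. All the data are chosen from f alone, so the final constant depends
only on f and K. -/
theorem IsReaction.exists_isCutoff {f : ℝ → ℝ} (hf : IsReaction f) :
    ∃ (g G : ℝ → ℝ) (B : ℝ), IsCutoff f g G B := by
  obtain ⟨s₀, hs₀, hne⟩ := hf.nontrivial
  have hpos : 0 < f s₀ := lt_of_le_of_ne (hf.nonneg s₀ hs₀) hne.symm
  have hcont : ContinuousAt f s₀ := hf.contDiffOn.continuousOn.continuousAt (Icc_mem_nhds hs₀.1 hs₀.2)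
  obtain ⟨δ, hδ, hball⟩ := Metric.mem_nhds_iff.1
    (inter_mem (hcont.eventually (lt_mem_nhds (half_lt_self hpos))) (Ioo_mem_nhds hs₀.1 hs₀.2))
  let φ : ContDiffBump s₀ := ⟨δ / 2, δ, by positivity, by linarith⟩
  have hφ1 : ContDiff ℝ 1 φ := φ.contDiff
  have hφc : Continuous φ := φ.continuous
  obtain ⟨M, hM⟩ := (φ.hasCompactSupport.deriv).exists_bound_of_continuous
    (hφ1.continuous_deriv le_rfl)
  have hG : ∀ s, HasDerivAt (fun s => ∫ x in (0 : ℝ)..s, φ x) (φ s) s := fun s =>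
    intervalIntegral.integral_hasDerivAt_right (hφc.intervalIntegrable _ _)
      (hφc.stronglyMeasurableAtFilter _ _) hφc.continuousAt
  refine ⟨φ, fun s => ∫ x in (0 : ℝ)..s, φ x, max 1 (max M (2 / f s₀)), ?_⟩
  refine ⟨hφ1, ?_, fun s => (hG s).deriv, fun s => φ.nonneg, fun s => φ.le_one, fun s hs => ?_,
    fun s => (hM s).trans ((le_max_left _ _).trans (le_max_right _ _)), le_max_left _ _, ?_⟩
  · rw [contDiff_one_iff_deriv]
    refine ⟨fun s => (hG s).differentiableAt, ?_⟩
    rwa [show deriv (fun s => ∫ x in (0 : ℝ)..s, φ x) = φ from funext fun s => (hG s).deriv]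
  · by_cases h : s ∈ Metric.ball s₀ δ
    · have h1 : f s₀ / 2 < f s := (hball h).1
      have h2 : 2 / f s₀ ≤ max 1 (max M (2 / f s₀)) := (le_max_right _ _).trans (le_max_right _ _)
      refine φ.le_one.trans (le_trans ?_ (mul_le_mul h2 h1.le (by positivity) (by positivity)))
      rw [div_mul_div_cancel₀ hpos.ne', div_self two_ne_zero]
    · rw [φ.zero_of_le_dist (by simpa [Metric.mem_ball] using h)]
      exact mul_nonneg (by positivity) (hf.nonneg_Icc hs)
  · simp only [intervalIntegral.integral_same]
    refine intervalIntegral.integral_pos zero_lt_one hφc.continuousOn (fun _ _ => φ.nonneg)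
      ⟨s₀, Ioo_subset_Icc_self hs₀, ?_⟩
    rw [φ.one_of_mem_closedBall (Metric.mem_closedBall_self φ.rIn_pos.le)]
    exact zero_lt_one

namespace IsProfile

variable {bc : BoundaryKind} {H κ r : ℝ} {f : ℝ → ℝ} {u : ℝ × ℝ → ℝ × ℝ} {θ τ : ℝ × ℝ → ℝ}

theorem integrableOn_rectangle {φ : ℝ × ℝ → ℝ} (hφ : ContinuousOn φ (bc.domain H)) (a b : ℝ) :
    IntegrableOn φ (Icc a b ×ˢ Icc 0 H) :=
  (hφ.mono ((rectangle_subset_strip a b H).trans (bc.strip_subset_domain H))).integrableOn_compact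
    (isCompact_Icc.prod isCompact_Icc)

/-- The burning rate is the total reaction. -/
theorem integral_time_deriv (hθ : IsProfile bc H κ r f u θ τ) (hf : IsReaction f)
    (hu : IsFlow bc H u) (hH : 0 < H) :
    IntegrableOn τ (strip H) ∧ ∫ p in strip H, τ p = r * ∫ p in strip H, f (θ p) := by
  -- With g = 1 the identity says that the integral of τ - r f(θ) tends to zero along the
  -- rectangles.
  obtain ⟨a, b, ha, hb, hlim⟩ := hθ.exists_rectangles hu hH (g := fun _ => 1) (G := fun s => s)
    contDiff_const contDiff_id (fun s => by simp)
  have hcov := aecover_rectangle (H := H) ha hb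
  have hfi := hθ.integrableOn_reaction hf
  have hτc := hθ.continuousOn_time_deriv hf hu hH
  have hf' := hcov.integral_tendsto_of_countably_generated hfi
  simp only [restrict_strip_rectangle] at hf'
  have hτ : Tendsto (fun n => ∫ p in Icc (a n) (b n) ×ˢ Icc 0 H, τ p) atTop
      (𝓝 (r * ∫ p in strip H, f (θ p))) := by
    have := hlim.add (hf'.const_mul r)
    rw [zero_add] at this
    refine this.congr fun n => ?_
    rw [← integral_const_mul, ← integral_add]
    · refine integral_congr_ae (ae_of_all _ fun p => ?_)
      simp
    · refine IntegrableOn.congr_fun (f := fun p => τ p - r * f (θ p))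
        (integrableOn_rectangle (hτc.sub (continuousOn_const.mul
          (hθ.continuousOn_reaction hf))) _ _) (fun p _ => by simp)
        (measurableSet_Icc.prod measurableSet_Icc)
    · exact (integrableOn_rectangle (hθ.continuousOn_reaction hf) _ _).const_mul r
  have hnn : ∀ᵐ p ∂(volume.restrict (strip H)), 0 ≤ τ p := by
    filter_upwards [ae_restrict_mem (measurableSet_strip H)] with p hp
    exact hθ.nonneg p (bc.strip_subset_domain H hp)
  have hτi : ∀ n, IntegrableOn τ (Icc (a n) (b n) ×ˢ Icc 0 H) (volume.restrict (strip H)) := fun n => by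
    rw [IntegrableOn, restrict_strip_rectangle]
    exact integrableOn_rectangle hτc _ _
  have hτ' : Tendsto (fun n => ∫ p in Icc (a n) (b n) ×ˢ Icc 0 H, τ p ∂(volume.restrict (strip H)))
      atTop (𝓝 (r * ∫ p in strip H, f (θ p))) := by
    simpa only [restrict_strip_rectangle] using hτ
  -- Since τ ≥ 0, convergence along one exhaustion already gives integrability.
  exact ⟨hcov.integrable_of_integral_tendsto_of_nonneg_ae _ hτi hnn hτ',
    hcov.integral_eq_of_tendsto_of_nonneg_ae _ hnn hτi hτ'⟩

/-- The total dissipation is bounded by the burning rate. -/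
theorem integral_gradSq_le (hθ : IsProfile bc H κ r f u θ τ) (hf : IsReaction f)
    (hu : IsFlow bc H u) (hH : 0 < H) (hκ : 0 < κ) (hr : 0 ≤ r) :
    IntegrableOn (gradSq (bc.yRange H) θ) (strip H) ∧
      κ * ∫ p in strip H, gradSq (bc.yRange H) θ p ≤ r * ∫ p in strip H, f (θ p) := by
  -- With g(s) = s the identity becomes κ∫|∇θ|² = ∫θ(r f(θ) - τ), and the right side is at most
  -- r∫f(θ) because 0 ≤ θ ≤ 1 and τ ≥ 0.
  obtain ⟨a, b, ha, hb, hlim⟩ := hθ.exists_rectangles hu hH (g := fun s => s)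
    (G := fun s => s ^ 2 / 2) contDiff_id (by fun_prop) (fun s => by simp)
  have hcov := aecover_rectangle (H := H) ha hb
  have hfi := hθ.integrableOn_reaction hf
  have hτc := hθ.continuousOn_time_deriv hf hu hH
  have hgc := hθ.continuousOn_gradSq hH
  have hfc := hθ.continuousOn_reaction hf
  obtain ⟨hτi, -⟩ := hθ.integral_time_deriv hf hu hH
  have hmem : ∀ᵐ p ∂(volume.restrict (strip H)), p ∈ bc.domain H := by
    filter_upwards [ae_restrict_mem (measurableSet_strip H)] with p hp
    exact bc.strip_subset_domain H hp
  have hwc : ContinuousOn (fun p => θ p * (r * f (θ p) - τ p)) (bc.domain H) :=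
    hθ.contDiffOn.continuousOn.mul ((continuousOn_const.mul hfc).sub hτc)
  have hwi : IntegrableOn (fun p => θ p * (r * f (θ p) - τ p)) (strip H) := by
    refine ((hfi.const_mul r).add hτi).mono' ((hwc.mono
      (bc.strip_subset_domain H)).aestronglyMeasurable (measurableSet_strip H)) ?_
    filter_upwards [hmem] with p hp
    have h1 := hθ.mem_Icc p hp
    have h2 := hθ.nonneg p hp
    have h3 := mul_nonneg hr (hf.nonneg_Icc h1)
    rw [norm_mul, Real.norm_of_nonneg h1.1]
    refine (mul_le_of_le_one_left (norm_nonneg _) h1.2).trans (abs_le.2 ⟨?_, ?_⟩) <;>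
    simp only [Pi.add_apply] <;> linarith
  have hw' := hcov.integral_tendsto_of_countably_generated hwi
  have hκg : Tendsto (fun n => ∫ p in Icc (a n) (b n) ×ˢ Icc 0 H,
      κ * gradSq (bc.yRange H) θ p ∂(volume.restrict (strip H))) atTop
      (𝓝 (∫ p in strip H, θ p * (r * f (θ p) - τ p))) := by
    simp only [restrict_strip_rectangle] at hw' ⊢
    have := hlim.add hw'
    rw [zero_add] at this
    refine this.congr fun n => ?_
    rw [← integral_add]
    · refine integral_congr_ae (ae_of_all _ fun p => ?_)
      simp only [deriv_id'']
      ring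
    · refine IntegrableOn.congr_fun (f := fun p => κ * gradSq (bc.yRange H) θ p -
        θ p * (r * f (θ p) - τ p)) (integrableOn_rectangle ((continuousOn_const.mul hgc).sub hwc) _ _)
        (fun p _ => ?_) (measurableSet_Icc.prod measurableSet_Icc)
      simp only [deriv_id'']
      ring
    · exact integrableOn_rectangle hwc _ _
  have hnn : ∀ᵐ p ∂(volume.restrict (strip H)), 0 ≤ κ * gradSq (bc.yRange H) θ p :=
    ae_of_all _ fun p => mul_nonneg hκ.le (gradSq_nonneg _ _ _)
  have hgi : ∀ n, IntegrableOn (fun p => κ * gradSq (bc.yRange H) θ p)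
      (Icc (a n) (b n) ×ˢ Icc 0 H) (volume.restrict (strip H)) := fun n => by
    rw [IntegrableOn, restrict_strip_rectangle]
    exact integrableOn_rectangle (continuousOn_const.mul hgc) _ _
  have hint := hcov.integrable_of_integral_tendsto_of_nonneg_ae _ hgi hnn hκg
  refine ⟨(hint.const_mul κ⁻¹).congr (ae_of_all _ fun p => inv_mul_cancel_left₀ hκ.ne' _), ?_⟩
  rw [← integral_const_mul, ← integral_const_mul,
    hcov.integral_eq_of_tendsto_of_nonneg_ae _ hnn hgi hκg]
  refine integral_mono_ae hwi (hfi.const_mul r) ?_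
  filter_upwards [hmem] with p hp
  have h1 := hθ.mem_Icc p hp
  have h2 := hθ.nonneg p hp
  have h3 := mul_nonneg hr (hf.nonneg_Icc h1)
  nlinarith [mul_nonneg h1.1 h2, mul_le_of_le_one_left h3 h1.2]

/-- The lower bound for the burning rate that does not use the flow. -/
theorem speed_le (hθ : IsProfile bc H κ r f u θ τ) (hf : IsReaction f) (hu : IsFlow bc H u)
    (hH : 0 < H) (hκ : 0 < κ) (hr : 0 < r) {g G : ℝ → ℝ} {B v₀ : ℝ} (hg : IsCutoff f g G B)
    (hv2 : v₀ ^ 2 = κ * r) :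
    (G 1 - G 0) * (v₀ * H) ≤ B * (r * ∫ p in strip H, f (θ p)) := by
  have hY := bc.uniqueDiffOn_yRange hH
  obtain ⟨hgi, hgle⟩ := hθ.integral_gradSq_le hf hu hH hκ hr.le
  have hfi := hθ.integrableOn_reaction hf
  have hmem : ∀ x, ∀ y ∈ Icc 0 H, (x, y) ∈ bc.domain H := fun x y hy =>
    ⟨mem_univ _, bc.Icc_subset_yRange H hy⟩
  have hθ1 : ContDiffOn ℝ 1 θ (univ ×ˢ bc.yRange H) := hθ.contDiffOn.of_le one_le_two
  have hGθ : ContDiffOn ℝ 1 (fun p => G (θ p)) (univ ×ˢ bc.yRange H) :=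
    hg.contDiff_primitive.comp_contDiffOn hθ1
  have hGc := hg.contDiff_primitive.continuous
  have hnat : Tendsto (fun n : ℕ => (n : ℝ)) atTop atTop := tendsto_natCast_atTop_atTop
  have hone : ∀ p ∈ bc.domain H, |(fun _ : ℝ × ℝ => (1 : ℝ)) p| ≤ 1 := fun p _ => by simp
  have t0 := hθ.tendsto_section hH hGc continuousOn_const hone (b := fun n => n) (c := 0)
    fun y hy => hθ.tendsto_zero (q := fun n : ℕ => ((n : ℝ), y)) (fun n => hmem _ y hy) hnat
  have t1 := hθ.tendsto_section hH hGc continuousOn_const hone (b := fun n => -n) (c := 1)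
    fun y hy => hθ.tendsto_one (q := fun n : ℕ => (-(n : ℝ), y)) (fun n => hmem _ y hy)
      (tendsto_neg_atTop_atBot.comp hnat)
  have t2 := (t1.sub t0).add_const ((G 1 - G 0) * H)
  rw [sub_zero, zero_add] at t2
  -- The bracket is minus the integral of ∂ₓG(θ) over a rectangle, arranged so that all but the last
  -- summand tend to zero.
  have key : ∀ n : ℕ, v₀ * ((∫ y in (0 : ℝ)..H, (1 : ℝ) * (G (θ (-(n : ℝ), y)) - G 1)) -
      (∫ y in (0 : ℝ)..H, (1 : ℝ) * (G (θ ((n : ℝ), y)) - G 0)) + (G 1 - G 0) * H) ≤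
      B * (r * ∫ p in strip H, f (θ p)) := by
    intro n
    have hn : (-(n : ℝ)) ≤ n := by
      have : (0 : ℝ) ≤ n := n.cast_nonneg
      linarith
    have hdiv := integral_divergence_rectangle isOpen_univ hY hGθ
      (contDiffOn_const (c := (0 : ℝ))) hn hH.le (Set.prod_mono (subset_univ _)
      (bc.Icc_subset_yRange H))
    have h0 : ∀ p, partialSnd (bc.yRange H) (fun _ => (0 : ℝ)) p = 0 := fun p => by
      simp [partialSnd]
    simp only [h0, add_zero, sub_self, zero_add] at hdiv
    have iG : ∀ x, IntervalIntegrable (fun y => G (θ (x, y))) volume 0 H := fun x =>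
      ContinuousOn.intervalIntegrable_of_Icc hH.le (continuous_line hGθ.continuousOn x)
    have e1 : (∫ y in (0 : ℝ)..H, (1 : ℝ) * (G (θ (-(n : ℝ), y)) - G 1)) -
      (∫ y in (0 : ℝ)..H, (1 : ℝ) * (G (θ ((n : ℝ), y)) - G 0)) + (G 1 - G 0) * H =
      -∫ p in Icc (-(n : ℝ)) n ×ˢ Icc 0 H, partialFst (fun p => G (θ p)) p := by
      rw [hdiv]
      simp only [one_mul]
      rw [intervalIntegral.integral_sub (iG _) intervalIntegrable_const,
        intervalIntegral.integral_sub (iG _) intervalIntegrable_const]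
      simp
      ring
    have hcx : ContinuousOn (partialFst fun p => G (θ p)) (bc.domain H) :=
      (contDiffOn_partialFst (m := 0) isOpen_univ hY hGθ (by simp)).continuousOn
    have hsub := rectangle_subset_strip (-(n : ℝ)) n H
    have hdom : IntegrableOn (fun p => κ * gradSq (bc.yRange H) θ p + r * (B * f (θ p))) (strip H) :=
      (hgi.const_mul κ).add ((hfi.const_mul B).const_mul r)
    have hpt : ∀ p ∈ bc.domain H, v₀ * -partialFst (fun p => G (θ p)) p ≤
        1 / 2 * (κ * gradSq (bc.yRange H) θ p + r * (B * f (θ p))) := fun p hp => by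
      have e2 : partialFst (fun p => G (θ p)) p = g (θ p) * partialFst θ p := by
        have hGd : HasDerivAt G (g (θ p)) (θ p) := hg.deriv_primitive (θ p) ▸
          (hg.contDiff_primitive.differentiable one_ne_zero _).hasDerivAt
        exact (hGd.comp p.1 (hasDerivAt_partialFst isOpen_univ hθ1 hp)).deriv
      have hm := hθ.mem_Icc p hp
      have h1 := hg.le_reaction _ hm
      have h2 := hg.nonneg (θ p)
      have h3 := hg.le_one (θ p)
      have h4 : g (θ p) ^ 2 ≤ B * f (θ p) := by nlinarith
      have h5 : r * g (θ p) ^ 2 ≤ r * (B * f (θ p)) := mul_le_mul_of_nonneg_left h4 hr.le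
      have h6 : partialFst θ p ^ 2 ≤ gradSq (bc.yRange H) θ p := by
        unfold gradSq; linarith [sq_nonneg (partialSnd (bc.yRange H) θ p)]
      have h7 := mul_le_mul_of_nonneg_left h6 hκ.le
      -- Young's inequality -2v₀gθ_x ≤ κθ_x² + r g² without square roots: by v₀² = κr this square
      -- has the factor κr, which is divided out below.
      have h8 : 0 ≤ κ * (v₀ * partialFst θ p + r * g (θ p)) ^ 2 := by positivity
      have h9 : κ * (v₀ * partialFst θ p + r * g (θ p)) ^ 2 =
        κ * r * (κ * partialFst θ p ^ 2 + r * g (θ p) ^ 2 + 2 * (v₀ * (g (θ p) * partialFst θ p))) := by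
        have : (v₀ * partialFst θ p + r * g (θ p)) ^ 2 = v₀ ^ 2 * partialFst θ p ^ 2 +
          2 * v₀ * partialFst θ p * r * g (θ p) + r ^ 2 * g (θ p) ^ 2 := by ring
        rw [this, hv2]; ring
      rw [h9] at h8
      have h10 := nonneg_of_mul_nonneg_right h8 (by positivity)
      rw [e2]
      linarith
    rw [e1, ← integral_neg, ← integral_const_mul]
    calc ∫ p in Icc (-(n : ℝ)) n ×ˢ Icc 0 H, v₀ * -partialFst (fun p => G (θ p)) p
        ≤ ∫ p in Icc (-(n : ℝ)) n ×ˢ Icc 0 H,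
          1 / 2 * (κ * gradSq (bc.yRange H) θ p + r * (B * f (θ p))) := by
          refine setIntegral_mono_on ((integrableOn_rectangle hcx _ _).neg.const_mul v₀)
            ((hdom.mono_set hsub).const_mul _) (measurableSet_Icc.prod measurableSet_Icc)
            fun p hp => hpt p (bc.strip_subset_domain H (hsub hp))
      _ ≤ ∫ p in strip H, 1 / 2 * (κ * gradSq (bc.yRange H) θ p + r * (B * f (θ p))) := by
          refine setIntegral_mono_set (hdom.const_mul _) ?_ hsub.eventuallyLE
          filter_upwards [ae_restrict_mem (measurableSet_strip H)] with p hp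
          have := hf.nonneg_Icc (hθ.mem_Icc p (bc.strip_subset_domain H hp))
          have := gradSq_nonneg (bc.yRange H) θ p
          have := hg.one_le
          simp only [Pi.zero_apply]
          positivity
      _ = 1 / 2 * (κ * (∫ p in strip H, gradSq (bc.yRange H) θ p)
            + B * (r * ∫ p in strip H, f (θ p))) := by
          rw [integral_const_mul, integral_add (hgi.const_mul κ) ((hfi.const_mul B).const_mul r),
            integral_const_mul, integral_const_mul, integral_const_mul]
          ring
      _ ≤ _ := by
          have h1 : 0 ≤ r * ∫ p in strip H, f (θ p) := mul_nonneg hr.le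
            (setIntegral_nonneg (measurableSet_strip H) fun p hp =>
              hf.nonneg_Icc (hθ.mem_Icc p (bc.strip_subset_domain H hp)))
          -- The dissipation is at most the reaction, and (1 + B)/2 ≤ B.
          nlinarith [hg.one_le]
  have := le_of_tendsto' (t2.const_mul v₀) key
  linarith

end IsProfile

/-! ### Tube coordinates and the pull-back of plane fields. -/

theorem euclLength_nonneg (v : ℝ × ℝ) : 0 ≤ euclLength v := Real.sqrt_nonneg _

theorem euclLength_sq (v : ℝ × ℝ) : euclLength v ^ 2 = v.1 ^ 2 + v.2 ^ 2 :=
  Real.sq_sqrt (by positivity)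

/-- The cross product of two plane vectors. -/
def cross (v w : ℝ × ℝ) : ℝ := v.1 * w.2 - v.2 * w.1

theorem cross_sq_add (v w : ℝ × ℝ) :
    cross v w ^ 2 + (v.1 * w.1 + v.2 * w.2) ^ 2 = (euclLength v * euclLength w) ^ 2 := by
  rw [mul_pow, euclLength_sq, euclLength_sq, cross]; ring

theorem abs_cross_le (v w : ℝ × ℝ) : |cross v w| ≤ euclLength v * euclLength w := by
  refine abs_le_of_sq_le_sq ?_ (mul_nonneg (euclLength_nonneg _) (euclLength_nonneg _))
  nlinarith [cross_sq_add v w, sq_nonneg (v.1 * w.1 + v.2 * w.2)]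

theorem abs_cross_eq {v w : ℝ × ℝ} (h : v.1 * w.1 + v.2 * w.2 = 0) :
    |cross v w| = euclLength v * euclLength w := by
  have := cross_sq_add v w
  rw [h, zero_pow two_ne_zero, add_zero] at this
  rw [← abs_of_nonneg (mul_nonneg (euclLength_nonneg v) (euclLength_nonneg w))]
  exact (sq_eq_sq_iff_abs_eq_abs _ _).1 this

namespace Tube

/-- The Jacobian determinant of the coordinates. -/
noncomputable def jacobian (D : Tube) (q : ℝ × ℝ) : ℝ := cross (D.tangentRho q) (D.tangentXi q)

theorem isOpen_coords (D : Tube) : IsOpen D.coords := isOpen_Ioo.prod isOpen_univ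

theorem contDiffOn_tangents {D : Tube} (hD : ContDiffOn ℝ 2 D.map D.coords) :
    ContDiffOn ℝ 1 (fun q => (D.tangentRho q).1) D.coords ∧
    ContDiffOn ℝ 1 (fun q => (D.tangentRho q).2) D.coords ∧
    ContDiffOn ℝ 1 (fun q => (D.tangentXi q).1) D.coords ∧
    ContDiffOn ℝ 1 (fun q => (D.tangentXi q).2) D.coords := by
  have n : (1 : WithTop ℕ∞) + 1 ≤ 2 := by norm_num
  exact ⟨contDiffOn_partialFst isOpen_Ioo uniqueDiffOn_univ hD.fst n,
    contDiffOn_partialFst isOpen_Ioo uniqueDiffOn_univ hD.snd n,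
    contDiffOn_partialSnd isOpen_Ioo uniqueDiffOn_univ hD.fst n,
    contDiffOn_partialSnd isOpen_Ioo uniqueDiffOn_univ hD.snd n⟩

/-- The pull-back of a plane field: first component. -/
noncomputable def pullFst (D : Tube) (F₁ F₂ : ℝ × ℝ → ℝ) (q : ℝ × ℝ) : ℝ :=
  cross (F₁ (D.map q), F₂ (D.map q)) (D.tangentXi q)

/-- The pull-back of a plane field: second component. -/
noncomputable def pullSnd (D : Tube) (F₁ F₂ : ℝ × ℝ → ℝ) (q : ℝ × ℝ) : ℝ :=
  -cross (F₁ (D.map q), F₂ (D.map q)) (D.tangentRho q)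

section Pull

variable {D : Tube} {Y : Set ℝ} {F₁ F₂ : ℝ × ℝ → ℝ}

theorem contDiffOn_pull (hD : ContDiffOn ℝ 2 D.map D.coords)
    (hm : MapsTo D.map D.coords (univ ×ˢ Y))
    (h₁ : ContDiffOn ℝ 1 F₁ (univ ×ˢ Y)) (h₂ : ContDiffOn ℝ 1 F₂ (univ ×ˢ Y)) :
    ContDiffOn ℝ 1 (D.pullFst F₁ F₂) D.coords ∧ ContDiffOn ℝ 1 (D.pullSnd F₁ F₂) D.coords := by
  obtain ⟨r1, r2, x1, x2⟩ := contDiffOn_tangents hD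
  have hD1 : ContDiffOn ℝ 1 D.map D.coords := hD.of_le one_le_two
  have c1 := h₁.comp hD1 hm
  have c2 := h₂.comp hD1 hm
  exact ⟨(c1.mul x2).sub (c2.mul x1), ((c1.mul r2).sub (c2.mul r1)).neg⟩

/-- The divergence in curvilinear coordinates (the Piola identity). -/
theorem divergence_pull (hY : UniqueDiffOn ℝ Y) (hD : ContDiffOn ℝ 2 D.map D.coords)
    (hm : MapsTo D.map D.coords (univ ×ˢ Y))
    (h₁ : ContDiffOn ℝ 1 F₁ (univ ×ˢ Y)) (h₂ : ContDiffOn ℝ 1 F₂ (univ ×ˢ Y)) {q : ℝ × ℝ}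
    (hq : q ∈ D.coords) :
    HasDerivAt (fun s => D.pullFst F₁ F₂ (s, q.2)) (partialFst (D.pullFst F₁ F₂) q) q.1 ∧
    partialFst (D.pullFst F₁ F₂) q + partialSnd univ (D.pullSnd F₁ F₂) q =
      (partialFst F₁ (D.map q) + partialSnd Y F₂ (D.map q)) * D.jacobian q := by
  obtain ⟨r1, r2, x1, x2⟩ := contDiffOn_tangents hD
  have hD1 : ContDiffOn ℝ 1 D.map D.coords := hD.of_le one_le_two
  have hρ : ∀ {F : ℝ × ℝ → ℝ}, ContDiffOn ℝ 1 F (univ ×ˢ Y) →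
      HasDerivAt (fun s => F (D.map (s, q.2))) (partialFst F (D.map q) * (D.tangentRho q).1 +
        partialSnd Y F (D.map q) * (D.tangentRho q).2) q.1 := fun {F} hF =>
    (hasDerivWithinAt_comp_plane (γ := fun s => D.map (s, q.2)) (S := Ioo (D.c - D.h) (D.c + D.h))
      isOpen_univ hY hF (hasDerivAt_partialFst isOpen_Ioo hD1.fst hq).hasDerivWithinAt
      (hasDerivAt_partialFst isOpen_Ioo hD1.snd hq).hasDerivWithinAt
      (fun s hs => hm ⟨hs, mem_univ _⟩) hq.1).hasDerivAt (isOpen_Ioo.mem_nhds hq.1)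
  have hξ : ∀ {F : ℝ × ℝ → ℝ}, ContDiffOn ℝ 1 F (univ ×ˢ Y) →
      HasDerivWithinAt (fun s => F (D.map (q.1, s))) (partialFst F (D.map q) * (D.tangentXi q).1 +
        partialSnd Y F (D.map q) * (D.tangentXi q).2) univ q.2 := fun {F} hF =>
    hasDerivWithinAt_comp_plane (γ := fun s => D.map (q.1, s)) (S := univ)
      isOpen_univ hY hF (hasDerivWithinAt_partialSnd uniqueDiffOn_univ hD1.fst hq)
      (hasDerivWithinAt_partialSnd uniqueDiffOn_univ hD1.snd hq)
      (fun s hs => hm ⟨hq.1, hs⟩) (mem_univ _)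
  have a1 := ((hρ h₁).mul (hasDerivAt_partialFst isOpen_Ioo x2 hq)).sub
    ((hρ h₂).mul (hasDerivAt_partialFst isOpen_Ioo x1 hq))
  have a2 := (((hξ h₁).mul (hasDerivWithinAt_partialSnd uniqueDiffOn_univ r2 hq)).sub
    ((hξ h₂).mul (hasDerivWithinAt_partialSnd uniqueDiffOn_univ r1 hq))).neg
  have e1 : partialFst (D.pullFst F₁ F₂) q = _ := a1.deriv
  have e2 : partialSnd univ (D.pullSnd F₁ F₂) q = _ := a2.derivWithin uniqueDiffWithinAt_univ
  -- The terms in which the field itself is not differentiated cancel by equality of the mixed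
  -- derivatives of the coordinates.
  have m1 := partialSnd_partialFst_comm isOpen_Ioo hD.fst hq
  have m2 := partialSnd_partialFst_comm isOpen_Ioo hD.snd hq
  refine ⟨e1 ▸ a1, ?_⟩
  rw [e1, e2]
  simp only [Prod.mk.eta, jacobian, cross, tangentRho, tangentXi] at *
  linear_combination (-F₁ (D.map q)) * m2 + F₂ (D.map q) * m1

end Pull

/-- The derivative of the coordinates has determinant `jacobian`. -/
theorem det_fderiv_map {D : Tube} (hD : ContDiffOn ℝ 2 D.map D.coords) {q : ℝ × ℝ}
    (hq : q ∈ D.coords) : (fderivWithin ℝ D.map D.coords q).det = D.jacobian q := by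
  have hd : DifferentiableWithinAt ℝ D.map D.coords q := hD.differentiableOn two_ne_zero q hq
  have hu : UniqueDiffWithinAt ℝ D.coords q := D.isOpen_coords.uniqueDiffWithinAt hq
  have f1 : ∀ v, (fderivWithin ℝ D.map D.coords q v).1 =
      fderivWithin ℝ (fun r => (D.map r).1) D.coords q v := fun v => by
    rw [(hd.hasFDerivWithinAt.fst).fderivWithin hu]; rfl
  have f2 : ∀ v, (fderivWithin ℝ D.map D.coords q v).2 =
      fderivWithin ℝ (fun r => (D.map r).2) D.coords q v := fun v => by
    rw [(hd.hasFDerivWithinAt.snd).fderivWithin hu]; rfl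
  rw [ContinuousLinearMap.det, ← LinearMap.det_toMatrix (Module.Basis.finTwoProd ℝ),
    Matrix.det_fin_two]
  simp only [LinearMap.toMatrix_apply, Module.Basis.finTwoProd_zero, Module.Basis.finTwoProd_one,
    Module.Basis.coe_finTwoProd_repr, ContinuousLinearMap.coe_coe, Matrix.cons_val_zero,
    Matrix.cons_val_one, f1, f2]
  rw [jacobian, cross, tangentRho, tangentXi]
  simp only
  rw [(partialFst_eq_fderivWithin (g := fun r => (D.map r).1) isOpen_Ioo hd.fst hq).2,
    (partialFst_eq_fderivWithin (g := fun r => (D.map r).2) isOpen_Ioo hd.snd hq).2,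
    (partialSnd_eq_fderivWithin (g := fun r => (D.map r).1) uniqueDiffOn_univ hd.fst hq).2,
    (partialSnd_eq_fderivWithin (g := fun r => (D.map r).2) uniqueDiffOn_univ hd.snd hq).2]
  simp only [coords]
  ring

namespace IsPercolating

variable {D : Tube} {bc : BoundaryKind} {H K : ℝ} {u : ℝ × ℝ → ℝ × ℝ} {q : ℝ × ℝ}

theorem E₁_pos (hD : D.IsPercolating bc H K u) (hK : 0 < K) (hq : q ∈ D.coords) : 0 < D.E₁ q :=
  (inv_pos.2 hK).trans_le (hD.le_E₁ q hq)

theorem E₂_pos (hD : D.IsPercolating bc H K u) (hK : 0 < K) (hq : q ∈ D.coords) : 0 < D.E₂ q :=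
  (inv_pos.2 hK).trans_le (hD.le_E₂ q hq)

theorem abs_jacobian (hD : D.IsPercolating bc H K u) (hq : q ∈ D.coords) :
    |D.jacobian q| = D.E₁ q * D.E₂ q := abs_cross_eq (hD.orthogonal q hq)

/-- This and the next two bounds trade lengths of coordinate vectors for the area element |J| =
E₁E₂, so that estimates can be integrated over the plane. -/
theorem E₂_le (hD : D.IsPercolating bc H K u) (hK : 0 < K) (hq : q ∈ D.coords) :
    D.E₂ q ≤ K * |D.jacobian q| := by
  have h1 : 1 ≤ K * D.E₁ q := by
    rw [← mul_inv_cancel₀ hK.ne']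
    exact mul_le_mul_of_nonneg_left (hD.le_E₁ q hq) hK.le
  rw [hD.abs_jacobian hq, ← mul_assoc]
  exact le_mul_of_one_le_left (hD.E₂_pos hK hq).le h1

theorem E₁_sq_le (hD : D.IsPercolating bc H K u) (hK : 0 < K) (hq : q ∈ D.coords) :
    D.E₁ q ^ 2 ≤ K * |D.jacobian q| := by
  have h1 := hD.E₁_pos hK hq
  have h2 : D.E₁ q ≤ K * D.E₂ q := by
    have := hD.le_omega q hq
    rw [omega, le_div_iff₀ h1] at this
    have := mul_le_mul_of_nonneg_left this hK.le
    rwa [← mul_assoc, mul_inv_cancel₀ hK.ne', one_mul] at this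
  rw [hD.abs_jacobian hq]
  nlinarith

theorem one_le_jacobian (hD : D.IsPercolating bc H K u) (hK : 0 < K) (hq : q ∈ D.coords) :
    1 ≤ K ^ 2 * |D.jacobian q| := by
  have := mul_le_mul (hD.le_E₁ q hq) (hD.le_E₂ q hq) (inv_pos.2 hK).le (hD.E₁_pos hK hq).le
  have h2 := mul_le_mul_of_nonneg_left this (sq_nonneg K)
  rw [hD.abs_jacobian hq]
  calc (1 : ℝ) = K ^ 2 * (K⁻¹ * K⁻¹) := by field_simp
    _ ≤ _ := h2

/-- `u` is parallel to the coordinate lines `ρ = const`. -/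
theorem cross_tangentXi (hD : D.IsPercolating bc H K u) (hK : 0 < K) (hq : q ∈ D.coords) :
    cross (u (D.map q)) (D.tangentXi q) = 0 := by
  have h1 := hD.orthogonal q hq
  have h2 := hD.streamlines q hq
  have h3 : D.E₁ q ^ 2 ≠ 0 := (pow_pos (hD.E₁_pos hK hq) 2).ne'
  rw [E₁, euclLength_sq] at h3
  refine (mul_eq_zero.1 (?_ : ((D.tangentRho q).1 ^ 2 + (D.tangentRho q).2 ^ 2) * _ = 0)).resolve_left h3
  rw [cross]
  linear_combination (-(D.tangentRho q).1 * (u (D.map q)).2 + (D.tangentRho q).2 * (u (D.map q)).1) * h1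
    + ((D.tangentRho q).1 * (D.tangentXi q).2 - (D.tangentRho q).2 * (D.tangentXi q).1) * h2

theorem abs_cross_tangentRho (hD : D.IsPercolating bc H K u) (hq : q ∈ D.coords) :
    |cross (u (D.map q)) (D.tangentRho q)| = D.E₁ q * euclLength (u (D.map q)) := by
  rw [abs_cross_eq (hD.streamlines q hq), mul_comm, E₁]

/-- The flux density does not depend on `ξ`. -/
theorem cross_tangentRho_eq (hD : D.IsPercolating bc H K u) (hK : 0 < K) (hH : 0 < H)
    (hu : IsFlow bc H u) {ρ : ℝ} (hρ : ρ ∈ Ioo (D.c - D.h) (D.c + D.h)) (ξ η : ℝ) :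
    cross (u (D.map (ρ, ξ))) (D.tangentRho (ρ, ξ)) =
      cross (u (D.map (ρ, η))) (D.tangentRho (ρ, η)) := by
  have hY := bc.uniqueDiffOn_yRange hH
  have hpull := contDiffOn_pull hD.contDiffOn hD.mapsTo hu.contDiffOn.fst hu.contDiffOn.snd
  have hder : ∀ s, HasDerivAt (fun s => cross (u (D.map (ρ, s))) (D.tangentRho (ρ, s))) 0 s := by
    intro s
    have hq : (ρ, s) ∈ D.coords := ⟨hρ, mem_univ _⟩
    have h1 := hasDerivWithinAt_partialSnd uniqueDiffOn_univ hpull.2 hq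
    obtain ⟨h2, h3⟩ := divergence_pull hY hD.contDiffOn hD.mapsTo hu.contDiffOn.fst
      hu.contDiffOn.snd hq
    -- The pull-back of u has vanishing first component, so div u = 0 leaves only the ξ-derivative
    -- of the second one, which must be zero.
    have h4 : partialFst (D.pullFst (fun q => (u q).1) (fun q => (u q).2)) (ρ, s) = 0 := by
      have h5 : (fun r => D.pullFst (fun q => (u q).1) (fun q => (u q).2) (r, s)) =ᶠ[𝓝 ρ]
          fun _ => 0 := by
        filter_upwards [isOpen_Ioo.mem_nhds hρ] with r hr
        exact hD.cross_tangentXi hK (q := (r, s)) ⟨hr, mem_univ _⟩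
      exact h5.deriv_eq.trans (deriv_const _ _)
    rw [h4, zero_add, hu.incompressible _ (hD.mapsTo hq), zero_mul] at h3
    rw [h3, hasDerivWithinAt_univ] at h1
    have h6 := h1.neg
    rw [neg_zero] at h6
    exact h6.congr_of_eventuallyEq (Eventually.of_forall fun s => (neg_neg _).symm)
  exact is_const_of_deriv_eq_zero (fun s => (hder s).differentiableAt) (fun s => (hder s).deriv) ξ η

end IsPercolating

end Tube

/-! ### The energy flux through a tube. -/

/-- The density of burning, dissipation and reaction. -/
noncomputable def energyDensity (Y : Set ℝ) (κ r : ℝ) (f : ℝ → ℝ) (θ τ : ℝ × ℝ → ℝ) (p : ℝ × ℝ) : ℝ :=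
  τ p + κ * gradSq Y θ p + r * f (θ p)

/-- The parabolic cross-sectional profile of a cutoff that is supported in the inner half of the tube. -/
noncomputable def Tube.bump (D : Tube) (ρ : ℝ) : ℝ := 1 - ((ρ - D.c) / (D.h / 2)) ^ 2

/-- An integrable function on the line is small somewhere far out. -/
theorem exists_seq_tendsto_zero_of_integrable {N : ℝ → ℝ} (hN : Integrable N) {S : ℕ → Set ℝ}
    (hS : ∀ n, volume (S n) = ⊤) :
    ∃ b : ℕ → ℝ, (∀ n, b n ∈ S n) ∧ Tendsto (fun n => N (b n)) atTop (𝓝 0) := by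
  have h : ∀ n : ℕ, ∃ b ∈ S n, ‖N b‖ < 1 / ((n : ℝ) + 1) := by
    intro n
    by_contra! hcon
    -- By Chebyshev, the set where ‖N‖ is at least 1/(n + 1) has finite measure, so it cannot
    -- contain `S n`.
    have hfin := hN.measure_norm_ge_lt_top (ε := 1 / ((n : ℝ) + 1)) (by positivity)
    exact absurd ((measure_mono (fun b hb => hcon b hb :
      S n ⊆ {b | 1 / ((n : ℝ) + 1) ≤ ‖N b‖})).trans_lt hfin) (by simp [hS])
  choose b hb hlt using h
  exact ⟨b, hb, squeeze_zero_norm (fun n => (hlt n).le) tendsto_one_div_add_atTop_nhds_zero_nat⟩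

namespace Tube

variable {D : Tube} {ρ : ℝ}

theorem bump_le_one : D.bump ρ ≤ 1 := by
  unfold bump; linarith [sq_nonneg ((ρ - D.c) / (D.h / 2))]

theorem bump_nonneg (hh : 0 < D.h) (hρ : ρ ∈ Icc (D.c - D.h / 2) (D.c + D.h / 2)) :
    0 ≤ D.bump ρ := by
  have : |(ρ - D.c) / (D.h / 2)| ≤ 1 := by
    rw [abs_div, abs_of_pos (by positivity : 0 < D.h / 2), div_le_one (by positivity), abs_le]
    constructor <;> linarith [hρ.1, hρ.2]
  have := (sq_le_one_iff_abs_le_one _).2 this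
  unfold bump; linarith

theorem hasDerivAt_bump (D : Tube) (ρ : ℝ) :
    HasDerivAt D.bump (-(2 * ((ρ - D.c) / (D.h / 2)) * (1 / (D.h / 2)))) ρ := by
  have := (((((hasDerivAt_id ρ).sub_const D.c).div_const (D.h / 2)).pow 2).const_sub 1)
  exact this.congr_deriv (by simp)

theorem abs_deriv_bump_le (hh : 0 < D.h) (hρ : ρ ∈ Icc (D.c - D.h / 2) (D.c + D.h / 2)) :
    |-(2 * ((ρ - D.c) / (D.h / 2)) * (1 / (D.h / 2)))| ≤ 4 / D.h := by
  have : |(ρ - D.c) / (D.h / 2)| ≤ 1 := by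
    rw [abs_div, abs_of_pos (by positivity : 0 < D.h / 2), div_le_one (by positivity), abs_le]
    constructor <;> linarith [hρ.1, hρ.2]
  rw [abs_neg, abs_mul, abs_mul, abs_of_pos (by positivity : 0 < 1 / (D.h / 2)), abs_two]
  calc 2 * |(ρ - D.c) / (D.h / 2)| * (1 / (D.h / 2)) ≤ 2 * 1 * (1 / (D.h / 2)) := by gcongr
    _ = 4 / D.h := by field_simp; norm_num

theorem continuous_bump (D : Tube) : Continuous D.bump := by unfold bump; fun_prop

theorem integral_bump (hh : 0 < D.h) :
    ∫ ρ in (D.c - D.h / 2)..(D.c + D.h / 2), D.bump ρ = 2 * D.h / 3 := by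
  have hd : ∀ ρ, HasDerivAt (fun ρ => ρ - (ρ - D.c) ^ 3 / (3 * (D.h / 2) ^ 2)) (D.bump ρ) ρ := by
    intro ρ
    have := (hasDerivAt_id ρ).sub ((((hasDerivAt_id ρ).sub_const D.c).pow 3).div_const
      (3 * (D.h / 2) ^ 2))
    refine this.congr_deriv ?_
    simp only [id, bump]
    field_simp
    norm_num
    ring
  rw [intervalIntegral.integral_eq_sub_of_hasDerivAt (fun ρ _ => hd ρ)
    (D.continuous_bump.intervalIntegrable _ _)]
  field_simp
  ring

theorem bump_left (hh : 0 < D.h) : D.bump (D.c - D.h / 2) = 0 := by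
  unfold bump; field_simp; ring

theorem bump_right (hh : 0 < D.h) : D.bump (D.c + D.h / 2) = 0 := by
  unfold bump; field_simp; ring

end Tube

namespace IsProfile

variable {bc : BoundaryKind} {H κ r K B v₀ : ℝ} {f g G : ℝ → ℝ} {u : ℝ × ℝ → ℝ × ℝ}
  {θ τ : ℝ × ℝ → ℝ} {D : Tube}

/-- Young's inequality with κr = v₀², followed by g² ≤ g ≤ B f. The weight v₀ is what turns κ|∇θ|
into l = κ/v₀ times the energy density. -/
theorem sqrt_gradSq_le (hθ : IsProfile bc H κ r f u θ τ)
    (hg : IsCutoff f g G B) (hκ : 0 < κ) (hv : 0 < v₀) (hr : r = v₀ ^ 2 / κ) {p : ℝ × ℝ}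
    (hp : p ∈ bc.domain H) :
    2 * v₀ * (g (θ p) * euclLength (partialFst θ p, partialSnd (bc.yRange H) θ p)) ≤
      B * energyDensity (bc.yRange H) κ r f θ τ p := by
  set s := euclLength (partialFst θ p, partialSnd (bc.yRange H) θ p) with hs
  have hs2 : s ^ 2 = gradSq (bc.yRange H) θ p := euclLength_sq _
  have hr0 : 0 ≤ r := by rw [hr]; positivity
  have hm := hθ.mem_Icc p hp
  have h1 := hg.le_reaction _ hm
  have h2 := hg.nonneg (θ p)
  have h3 := hg.le_one (θ p)
  have h4 : r * g (θ p) ^ 2 ≤ r * (B * f (θ p)) :=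
    mul_le_mul_of_nonneg_left (by nlinarith) hr0
  have h5 : 2 * v₀ * (g (θ p) * s) ≤ κ * s ^ 2 + r * g (θ p) ^ 2 := by
    have : κ * s ^ 2 + r * g (θ p) ^ 2 - 2 * v₀ * (g (θ p) * s) =
        (κ * s - v₀ * g (θ p)) ^ 2 / κ := by
      rw [hr]; field_simp; ring
    have : 0 ≤ (κ * s - v₀ * g (θ p)) ^ 2 / κ := by positivity
    linarith
  have h6 : 0 ≤ τ p := hθ.nonneg p hp
  have h7 : 0 ≤ κ * gradSq (bc.yRange H) θ p := mul_nonneg hκ.le (gradSq_nonneg _ _ _)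
  have h8 := hg.one_le
  rw [hs2] at h5
  unfold energyDensity
  nlinarith

/-- The convective part drops out because u is parallel to ∂(x, y)/∂ξ: only diffusion crosses the
streamlines. -/
theorem pullFst_flux (hD : D.IsPercolating bc H K u) (hK : 0 < K) {q : ℝ × ℝ} (hq : q ∈ D.coords) :
    D.pullFst (fluxFst κ u g G θ) (fluxSnd (bc.yRange H) κ u g G θ) q = κ * (g (θ (D.map q)) *
      cross (partialFst θ (D.map q), partialSnd (bc.yRange H) θ (D.map q)) (D.tangentXi q)) := by
  have := hD.cross_tangentXi hK hq
  simp only [Tube.pullFst, fluxFst, fluxSnd, cross] at this ⊢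
  linear_combination (-G (θ (D.map q))) * this

theorem pullSnd_flux (q : ℝ × ℝ) :
    D.pullSnd (fluxFst κ u g G θ) (fluxSnd (bc.yRange H) κ u g G θ) q =
      G (θ (D.map q)) * cross (u (D.map q)) (D.tangentRho q) - κ * (g (θ (D.map q)) *
      cross (partialFst θ (D.map q), partialSnd (bc.yRange H) θ (D.map q)) (D.tangentRho q)) := by
  simp only [Tube.pullSnd, fluxFst, fluxSnd, cross]
  ring

/-- The divergence of the cut-off energy flux in a tube is controlled by the energy density. -/
theorem abs_divergence_bump_le (hθ : IsProfile bc H κ r f u θ τ) (hf : IsReaction f)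
    (hu : IsFlow bc H u) (hH : 0 < H) (hg : IsCutoff f g G B) (hκ : 0 < κ) (hv : 0 < v₀)
    (hr : r = v₀ ^ 2 / κ) (hK : 0 < K) (hD : D.IsPercolating bc H K u) {q : ℝ × ℝ}
    (hq : q.1 ∈ Icc (D.c - D.h / 2) (D.c + D.h / 2)) :
    |partialFst (fun q => D.bump q.1 *
        D.pullFst (fluxFst κ u g G θ) (fluxSnd (bc.yRange H) κ u g G θ) q) q +
      partialSnd univ (fun q => D.bump q.1 *
        D.pullSnd (fluxFst κ u g G θ) (fluxSnd (bc.yRange H) κ u g G θ) q) q| ≤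
      B * (1 + 2 * K) * (1 + κ / v₀ / D.h) *
        (energyDensity (bc.yRange H) κ r f θ τ (D.map q) * |D.jacobian q|) := by
  have hh := hD.h_pos
  have hqc : q ∈ D.coords := ⟨⟨by linarith [hq.1], by linarith [hq.2]⟩, mem_univ _⟩
  have hY := bc.uniqueDiffOn_yRange hH
  have c1 := contDiffOn_fluxFst (κ := κ) hY hu.contDiffOn hg.contDiff hg.contDiff_primitive hθ.contDiffOn
  have c2 := contDiffOn_fluxSnd (κ := κ) hY hu.contDiffOn hg.contDiff hg.contDiff_primitive hθ.contDiffOn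
  have hpd : D.map q ∈ bc.domain H := hD.mapsTo hqc
  obtain ⟨hder, hdiv⟩ := Tube.divergence_pull hY hD.contDiffOn hD.mapsTo c1 c2 hqc
  have hpull := Tube.contDiffOn_pull hD.contDiffOn hD.mapsTo c1 c2
  rw [divergence_flux hY hu.contDiffOn hu.incompressible hg.contDiff hg.contDiff_primitive
    hg.deriv_primitive hθ.contDiffOn hpd] at hdiv
  have e1 : partialFst (fun q => D.bump q.1 *
        D.pullFst (fluxFst κ u g G θ) (fluxSnd (bc.yRange H) κ u g G θ) q) q = _ :=
    ((D.hasDerivAt_bump q.1).mul hder).deriv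
  have e2 : partialSnd univ (fun q => D.bump q.1 *
        D.pullSnd (fluxFst κ u g G θ) (fluxSnd (bc.yRange H) κ u g G θ) q) q = _ :=
    ((hasDerivWithinAt_partialSnd uniqueDiffOn_univ hpull.2 hqc).const_mul
      (D.bump q.1)).derivWithin uniqueDiffWithinAt_univ
  rw [e1, e2]
  simp only [Prod.mk.eta]
  -- What remains is the derivative of the cutoff times the diffusive flux across streamlines, plus
  -- the cutoff times the divergence in the plane times the Jacobian.
  rw [add_assoc, ← mul_add, hdiv, pullFst_flux hD hK hqc]
  set p := D.map q
  set J := |D.jacobian q| with hJ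
  set W := energyDensity (bc.yRange H) κ r f θ τ p with hW
  set s := euclLength (partialFst θ p, partialSnd (bc.yRange H) θ p) with hs
  have hJ0 : 0 ≤ J := abs_nonneg _
  have hr0 : 0 ≤ r := by rw [hr]; positivity
  have hS := gradSq_nonneg (bc.yRange H) θ p
  have hm := hθ.mem_Icc p hpd
  have hf0 : 0 ≤ r * f (θ p) := mul_nonneg hr0 (hf.nonneg_Icc hm)
  have hτ0 := hθ.nonneg p hpd
  have hB := hg.one_le
  have g0 := hg.nonneg (θ p)
  have g1 := hg.le_one (θ p)
  have hs0 : 0 ≤ s := euclLength_nonneg _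
  have hκS : 0 ≤ κ * gradSq (bc.yRange H) θ p := mul_nonneg hκ.le hS
  have hW0 : 0 ≤ W := by rw [hW, energyDensity]; positivity
  have k1 : |κ * (deriv g (θ p) * (partialFst θ p ^ 2 + partialSnd (bc.yRange H) θ p ^ 2)) +
      g (θ p) * (κ * laplacian (bc.yRange H) θ p - advection (bc.yRange H) u θ p)| ≤ B * W := by
    have e3 : κ * laplacian (bc.yRange H) θ p - advection (bc.yRange H) u θ p = τ p - r * f (θ p) := by
      linarith [hθ.equation p hpd]
    rw [e3]
    refine (abs_add_le _ _).trans ?_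
    have h1 : |κ * (deriv g (θ p) * (partialFst θ p ^ 2 + partialSnd (bc.yRange H) θ p ^ 2))| ≤
        B * (κ * gradSq (bc.yRange H) θ p) := by
      change |κ * (deriv g (θ p) * gradSq (bc.yRange H) θ p)| ≤ _
      rw [abs_mul, abs_mul, abs_of_pos hκ, abs_of_nonneg hS]
      have := mul_le_mul_of_nonneg_right (hg.deriv_le (θ p)) hκS
      linarith
    have h2 : |g (θ p) * (τ p - r * f (θ p))| ≤ τ p + r * f (θ p) := by
      rw [abs_mul, abs_of_nonneg g0]
      refine (mul_le_of_le_one_left (abs_nonneg _) g1).trans (abs_le.2 ⟨?_, ?_⟩) <;> linarith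
    have h3 : τ p + r * f (θ p) ≤ B * (τ p + r * f (θ p)) :=
      le_mul_of_one_le_left (by positivity) hB
    rw [hW, energyDensity]
    linarith
  -- Here the ratio l/h appears: the cutoff has slope at most 4/h, E₂ ≤ K|J|, and κ g|∇θ| is at most
  -- (l/2)B times the energy density.
  have k2 : |-(2 * ((q.1 - D.c) / (D.h / 2)) * (1 / (D.h / 2))) * (κ * (g (θ p) *
      cross (partialFst θ p, partialSnd (bc.yRange H) θ p) (D.tangentXi q)))| ≤
      B * (2 * K) * (κ / v₀ / D.h) * (W * J) := by
    have h1 := Tube.abs_deriv_bump_le hh hq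
    have h2 := (abs_cross_le (partialFst θ p, partialSnd (bc.yRange H) θ p) (D.tangentXi q)).trans
      (mul_le_mul_of_nonneg_left (hD.E₂_le hK hqc) hs0)
    have h3 := hθ.sqrt_gradSq_le hg hκ hv hr hpd
    rw [abs_mul, abs_mul, abs_mul, abs_of_pos hκ, abs_of_nonneg g0]
    calc _ ≤ 4 / D.h * (κ * (g (θ p) * (s * (K * J)))) := by gcongr
      _ = 2 * K * (κ / v₀ / D.h) * J * (2 * v₀ * (g (θ p) * s)) := by
        field_simp; ring
      _ ≤ 2 * K * (κ / v₀ / D.h) * J * (B * W) := by gcongr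
      _ = _ := by ring
  have hb0 := Tube.bump_nonneg hh hq
  have hb1 := D.bump_le_one (ρ := q.1)
  have k3 : |D.bump q.1 * ((κ * (deriv g (θ p) * (partialFst θ p ^ 2 +
      partialSnd (bc.yRange H) θ p ^ 2)) + g (θ p) * (κ * laplacian (bc.yRange H) θ p -
      advection (bc.yRange H) u θ p)) * D.jacobian q)| ≤ B * (W * J) := by
    rw [abs_mul, abs_mul, abs_of_nonneg hb0, ← mul_assoc B]
    refine (mul_le_of_le_one_left (by positivity) hb1).trans (mul_le_mul_of_nonneg_right k1 hJ0)
  refine (abs_add_le _ _).trans ((add_le_add k2 k3).trans ?_)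
  have hWJ : 0 ≤ W * J := by positivity
  have hl : 0 ≤ κ / v₀ / D.h := by positivity
  have : B * (1 + 2 * K) * (1 + κ / v₀ / D.h) * (W * J) - (B * (2 * K) * (κ / v₀ / D.h) * (W * J) +
    B * (W * J)) = B * (κ / v₀ / D.h) * (W * J) + B * (2 * K) * (W * J) := by ring
  have : 0 ≤ B * (κ / v₀ / D.h) * (W * J) + B * (2 * K) * (W * J) := by positivity
  linarith

/-- The diffusive boundary term is controlled by the energy density. -/
theorem abs_diffusive_le (hθ : IsProfile bc H κ r f u θ τ) (hf : IsReaction f)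
    (hg : IsCutoff f g G B) (hκ : 0 < κ) (hr : 0 < r) (hK : 0 < K)
    (hD : D.IsPercolating bc H K u) {q : ℝ × ℝ} (hq : q ∈ D.coords) :
    |g (θ (D.map q)) * cross (partialFst θ (D.map q), partialSnd (bc.yRange H) θ (D.map q))
        (D.tangentRho q)| ≤ (K ^ 2 * B / r + K / κ) *
      (energyDensity (bc.yRange H) κ r f θ τ (D.map q) * |D.jacobian q|) := by
  have hpd : D.map q ∈ bc.domain H := hD.mapsTo hq
  have h1 := abs_cross_le (partialFst θ (D.map q), partialSnd (bc.yRange H) θ (D.map q))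
    (D.tangentRho q)
  have h2 : D.E₁ q ^ 2 ≤ _ := hD.E₁_sq_le hK hq
  have h3 := hD.one_le_jacobian hK hq
  have hs2 : euclLength (partialFst θ (D.map q), partialSnd (bc.yRange H) θ (D.map q)) ^ 2 =
    gradSq (bc.yRange H) θ (D.map q) := euclLength_sq _
  rw [show euclLength (D.tangentRho q) = D.E₁ q from rfl] at h1
  set p := D.map q
  set J := |D.jacobian q|
  set s := euclLength (partialFst θ p, partialSnd (bc.yRange H) θ p)
  have hm := hθ.mem_Icc p hpd
  have hS := gradSq_nonneg (bc.yRange H) θ p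
  have hf0 := hf.nonneg_Icc hm
  have hτ0 := hθ.nonneg p hpd
  have g0 := hg.nonneg (θ p)
  have g1 := hg.le_one (θ p)
  have hgf := hg.le_reaction _ hm
  have hJ0 : 0 ≤ J := abs_nonneg _
  have hB := hg.one_le
  rw [abs_mul, abs_of_nonneg g0]
  -- The product g · (|∇θ|E₁) is split by Young's inequality. Its constant does not enter the final
  -- bound: the estimate only serves to make the diffusive boundary terms integrable along the tube.
  have k1 : g (θ p) ^ 2 ≤ B * f (θ p) * (K ^ 2 * J) :=
    (show g (θ p) ^ 2 ≤ B * f (θ p) by nlinarith).trans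
      (le_mul_of_one_le_right (by positivity) h3)
  have k2 : s ^ 2 * D.E₁ q ^ 2 ≤ gradSq (bc.yRange H) θ p * (K * J) := by
    rw [hs2]; exact mul_le_mul_of_nonneg_left h2 hS
  have k3 : g (θ p) * |cross (partialFst θ p, partialSnd (bc.yRange H) θ p) (D.tangentRho q)| ≤
      g (θ p) * (s * D.E₁ q) := mul_le_mul_of_nonneg_left h1 g0
  have k4 : 2 * (g (θ p) * (s * D.E₁ q)) ≤ g (θ p) ^ 2 + s ^ 2 * D.E₁ q ^ 2 := by
    nlinarith [sq_nonneg (g (θ p) - s * D.E₁ q)]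
  have k5 : 0 ≤ g (θ p) ^ 2 + s ^ 2 * D.E₁ q ^ 2 := by positivity
  have e1 : B * f (θ p) * (K ^ 2 * J) = K ^ 2 * B / r * (r * f (θ p) * J) := by field_simp
  have e2 : gradSq (bc.yRange H) θ p * (K * J) = K / κ * (κ * gradSq (bc.yRange H) θ p * J) := by
    field_simp
  have m1 : r * f (θ p) * J ≤ energyDensity (bc.yRange H) κ r f θ τ p * J := by
    refine mul_le_mul_of_nonneg_right ?_ hJ0
    have : 0 ≤ κ * gradSq (bc.yRange H) θ p := by positivity
    rw [energyDensity]; linarith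
  have m2 : κ * gradSq (bc.yRange H) θ p * J ≤ energyDensity (bc.yRange H) κ r f θ τ p * J := by
    refine mul_le_mul_of_nonneg_right ?_ hJ0
    have : 0 ≤ r * f (θ p) := by positivity
    rw [energyDensity]; linarith
  have n1 := mul_le_mul_of_nonneg_left m1 (show 0 ≤ K ^ 2 * B / r by positivity)
  have n2 := mul_le_mul_of_nonneg_left m2 (show 0 ≤ K / κ by positivity)
  rw [add_mul]
  linarith

end IsProfile

namespace IsProfile

variable {bc : BoundaryKind} {H κ r K B v₀ : ℝ} {f g G : ℝ → ℝ} {u : ℝ × ℝ → ℝ × ℝ}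
  {θ τ : ℝ × ℝ → ℝ} {D : Tube}

/-- The net flux of energy through two cross-sections of a tube. -/
theorem abs_sub_sections_le (hθ : IsProfile bc H κ r f u θ τ) (hf : IsReaction f)
    (hu : IsFlow bc H u) (hH : 0 < H) (hg : IsCutoff f g G B) (hκ : 0 < κ) (hv : 0 < v₀)
    (hr : r = v₀ ^ 2 / κ) (hK : 0 < K) (hD : D.IsPercolating bc H K u)
    (hint : IntegrableOn (fun q => energyDensity (bc.yRange H) κ r f θ τ (D.map q) *
      |D.jacobian q|) D.coords) {a b : ℝ} (hab : a ≤ b) :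
    |(∫ ρ in (D.c - D.h / 2)..(D.c + D.h / 2), D.bump ρ *
        D.pullSnd (fluxFst κ u g G θ) (fluxSnd (bc.yRange H) κ u g G θ) (ρ, b)) -
      ∫ ρ in (D.c - D.h / 2)..(D.c + D.h / 2), D.bump ρ *
        D.pullSnd (fluxFst κ u g G θ) (fluxSnd (bc.yRange H) κ u g G θ) (ρ, a)| ≤
      B * (1 + 2 * K) * (1 + κ / v₀ / D.h) *
        ∫ q in D.coords, energyDensity (bc.yRange H) κ r f θ τ (D.map q) * |D.jacobian q| := by
  have hh := hD.h_pos
  have hY := bc.uniqueDiffOn_yRange hH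
  have hpull := Tube.contDiffOn_pull hD.contDiffOn hD.mapsTo
    (contDiffOn_fluxFst (κ := κ) hY hu.contDiffOn hg.contDiff hg.contDiff_primitive hθ.contDiffOn)
    (contDiffOn_fluxSnd (κ := κ) hY hu.contDiffOn hg.contDiff hg.contDiff_primitive hθ.contDiffOn)
  have hbump : ContDiffOn ℝ 1 (fun q : ℝ × ℝ => D.bump q.1) D.coords := by
    unfold Tube.bump; fun_prop
  have hsub : Icc (D.c - D.h / 2) (D.c + D.h / 2) ×ˢ Icc a b ⊆
      Ioo (D.c - D.h) (D.c + D.h) ×ˢ univ := fun q hq =>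
    ⟨⟨by linarith [hq.1.1], by linarith [hq.1.2]⟩, mem_univ _⟩
  have hdiv := integral_divergence_rectangle isOpen_Ioo uniqueDiffOn_univ (hbump.mul hpull.1)
    (hbump.mul hpull.2) (by linarith : D.c - D.h / 2 ≤ D.c + D.h / 2) hab hsub
  -- The cutoff vanishes at c ± h/2, so the two sides of the rectangle contribute nothing.
  simp only [Tube.bump_left hh, Tube.bump_right hh, zero_mul, intervalIntegral.integral_zero,
    sub_zero, add_zero] at hdiv
  rw [← hdiv, ← integral_const_mul, ← Real.norm_eq_abs]
  have hm : MeasurableSet (Icc (D.c - D.h / 2) (D.c + D.h / 2) ×ˢ Icc a b) :=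
    measurableSet_Icc.prod measurableSet_Icc
  have hB := hg.one_le
  have hr0 : 0 ≤ r := by rw [hr]; positivity
  have hW0 : ∀ q ∈ D.coords, 0 ≤ energyDensity (bc.yRange H) κ r f θ τ (D.map q) := fun q hq => by
    have hp := hD.mapsTo hq
    have := hf.nonneg_Icc (hθ.mem_Icc _ hp)
    have := hθ.nonneg _ hp
    have := gradSq_nonneg (bc.yRange H) θ (D.map q)
    unfold energyDensity; positivity
  have hdom := hint.const_mul (B * (1 + 2 * K) * (1 + κ / v₀ / D.h))
  refine (norm_integral_le_of_norm_le (IntegrableOn.mono_set hdom hsub) ?_).trans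
    (setIntegral_mono_set hdom ?_ hsub.eventuallyLE)
  · filter_upwards [ae_restrict_mem hm] with q hq
    exact hθ.abs_divergence_bump_le hf hu hH hg hκ hv hr hK hD hq.1
  · filter_upwards [ae_restrict_mem D.isOpen_coords.measurableSet] with q hq
    have := hW0 q hq
    simp only [Pi.zero_apply]
    positivity

/-- The diffusive boundary terms vanish along a sequence of cross-sections of the tube. -/
theorem exists_tube_sections (hθ : IsProfile bc H κ r f u θ τ) (hf : IsReaction f)
    (hH : 0 < H) (hg : IsCutoff f g G B) (hκ : 0 < κ) (hr : 0 < r) (hK : 0 < K)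
    (hD : D.IsPercolating bc H K u)
    (hint : IntegrableOn (fun q => energyDensity (bc.yRange H) κ r f θ τ (D.map q) *
      |D.jacobian q|) D.coords) {S : ℕ → Set ℝ} (hS : ∀ n, volume (S n) = ⊤) :
    ∃ b : ℕ → ℝ, (∀ n, b n ∈ S n) ∧ Tendsto (fun n =>
      ∫ ρ in (D.c - D.h / 2)..(D.c + D.h / 2), D.bump ρ * (g (θ (D.map (ρ, b n))) *
        cross (partialFst θ (D.map (ρ, b n)), partialSnd (bc.yRange H) θ (D.map (ρ, b n)))
          (D.tangentRho (ρ, b n)))) atTop (𝓝 0) := by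
  have hh := hD.h_pos
  have hY := bc.uniqueDiffOn_yRange hH
  have hcd : D.c - D.h / 2 ≤ D.c + D.h / 2 := by linarith
  have hsub : Icc (D.c - D.h / 2) (D.c + D.h / 2) ×ˢ (univ : Set ℝ) ⊆ D.coords := fun q hq =>
    ⟨⟨by linarith [hq.1.1], by linarith [hq.1.2]⟩, mem_univ _⟩
  obtain ⟨r1, r2, -, -⟩ := Tube.contDiffOn_tangents hD.contDiffOn
  have hmc := hD.contDiffOn.continuousOn
  have hθc := hθ.contDiffOn.continuousOn.comp hmc hD.mapsTo
  have hxc : ContinuousOn (partialFst θ) (bc.domain H) :=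
    (contDiffOn_partialFst (m := 0) isOpen_univ hY hθ.contDiffOn (by norm_num)).continuousOn
  have hyc : ContinuousOn (partialSnd (bc.yRange H) θ) (bc.domain H) :=
    (contDiffOn_partialSnd (m := 0) isOpen_univ hY hθ.contDiffOn (by norm_num)).continuousOn
  have hnc : ContinuousOn (fun q : ℝ × ℝ => D.bump q.1 * (g (θ (D.map q)) *
        cross (partialFst θ (D.map q), partialSnd (bc.yRange H) θ (D.map q))
          (D.tangentRho q))) D.coords :=
    (D.continuous_bump.comp_continuousOn continuousOn_fst).mul
      ((hg.contDiff.continuous.comp_continuousOn hθc).mul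
        (((hxc.comp hmc hD.mapsTo).mul r2.continuousOn).sub
          ((hyc.comp hmc hD.mapsTo).mul r1.continuousOn)))
  have hi : IntegrableOn (fun q : ℝ × ℝ => D.bump q.1 * (g (θ (D.map q)) *
        cross (partialFst θ (D.map q), partialSnd (bc.yRange H) θ (D.map q))
          (D.tangentRho q))) (Icc (D.c - D.h / 2) (D.c + D.h / 2) ×ˢ univ) := by
    refine ((hint.mono_set hsub).const_mul (K ^ 2 * B / r + K / κ)).mono'
      ((hnc.mono hsub).aestronglyMeasurable (measurableSet_Icc.prod MeasurableSet.univ)) ?_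
    filter_upwards [ae_restrict_mem (measurableSet_Icc.prod MeasurableSet.univ)] with q hq
    rw [norm_mul, Real.norm_of_nonneg (Tube.bump_nonneg hh hq.1)]
    exact (mul_le_of_le_one_left (norm_nonneg _) D.bump_le_one).trans
      (hθ.abs_diffusive_le hf hg hκ hr hK hD (hsub hq))
  -- By Fubini the section integrals form an integrable function of ξ, which is therefore small
  -- somewhere in every set of infinite measure.
  rw [IntegrableOn, Measure.volume_eq_prod, ← Measure.prod_restrict, Measure.restrict_univ] at hi
  obtain ⟨b, hb, hlim⟩ := exists_seq_tendsto_zero_of_integrable hi.integral_prod_right hS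
  refine ⟨b, hb, hlim.congr fun n => ?_⟩
  rw [intervalIntegral.integral_of_le hcd, integral_Icc_eq_integral_Ioc]

/-- The convective boundary terms converge. -/
theorem tendsto_convective (hθ : IsProfile bc H κ r f u θ τ) (hu : IsFlow bc H u)
    (hH : 0 < H) (hg : IsCutoff f g G B) (hK : 0 < K)
    (hD : D.IsPercolating bc H K u) {c : ℝ} {b : ℕ → ℝ}
    (hb : ∀ ρ ∈ Ioo (D.c - D.h) (D.c + D.h), Tendsto (fun n => θ (D.map (ρ, b n))) atTop (𝓝 c)) :
    Tendsto (fun n => ∫ ρ in (D.c - D.h / 2)..(D.c + D.h / 2), D.bump ρ *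
      (G (θ (D.map (ρ, b n))) * cross (u (D.map (ρ, b n))) (D.tangentRho (ρ, b n)))) atTop
      (𝓝 (G c * ∫ ρ in (D.c - D.h / 2)..(D.c + D.h / 2), D.bump ρ *
        cross (u (D.map (ρ, 0))) (D.tangentRho (ρ, 0)))) := by
  have hh := hD.h_pos
  have hcd : D.c - D.h / 2 ≤ D.c + D.h / 2 := by linarith
  have hinner : ∀ ρ ∈ uIoc (D.c - D.h / 2) (D.c + D.h / 2), ρ ∈ Ioo (D.c - D.h) (D.c + D.h) ∧
      ρ ∈ Icc (D.c - D.h / 2) (D.c + D.h / 2) := fun ρ hρ => by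
    rw [uIoc_of_le hcd] at hρ
    exact ⟨⟨by linarith [hρ.1], by linarith [hρ.2]⟩, Ioc_subset_Icc_self hρ⟩
  obtain ⟨r1, r2, -, -⟩ := Tube.contDiffOn_tangents hD.contDiffOn
  have hmc := hD.contDiffOn.continuousOn
  have hθc := hθ.contDiffOn.continuousOn.comp hmc hD.mapsTo
  have hGc := hg.contDiff_primitive.continuous
  have hac : ContinuousOn (fun q => cross (u (D.map q)) (D.tangentRho q)) D.coords :=
    ((hu.contDiffOn.fst.continuousOn.comp hmc hD.mapsTo).mul r2.continuousOn).sub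
      ((hu.contDiffOn.snd.continuousOn.comp hmc hD.mapsTo).mul r1.continuousOn)
  have hline : ∀ {φ : ℝ × ℝ → ℝ}, ContinuousOn φ D.coords → ∀ ξ : ℝ,
      ContinuousOn (fun ρ => φ (ρ, ξ)) (uIoc (D.c - D.h / 2) (D.c + D.h / 2)) := fun hφ ξ =>
    hφ.comp (by fun_prop) fun ρ hρ => ⟨(hinner ρ hρ).1, mem_univ _⟩
  obtain ⟨M, hM⟩ := hD.oscillation
  obtain ⟨R, hR⟩ := isCompact_Icc.exists_bound_of_continuousOn (s := Icc (0 : ℝ) 1)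
    hGc.continuousOn
  rw [← intervalIntegral.integral_const_mul]
  refine intervalIntegral.tendsto_integral_filter_of_dominated_convergence (fun _ => R * M)
    (Eventually.of_forall fun n => ?_)
    (Eventually.of_forall fun n => ae_of_all _ fun ρ hρ => ?_)
    intervalIntegrable_const (ae_of_all _ fun ρ hρ => ?_)
  · exact (D.continuous_bump.continuousOn.mul (hline ((hGc.comp_continuousOn hθc).mul hac)
      (b n))).aestronglyMeasurable measurableSet_uIoc
  · obtain ⟨h1, h2⟩ := hinner ρ hρ
    have hq : (ρ, b n) ∈ D.coords := ⟨h1, mem_univ _⟩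
    rw [norm_mul, Real.norm_of_nonneg (Tube.bump_nonneg hh h2), norm_mul]
    refine (mul_le_of_le_one_left (by positivity) D.bump_le_one).trans
      (mul_le_mul (hR _ (hθ.mem_Icc _ (hD.mapsTo hq))) ?_ (norm_nonneg _)
        ((norm_nonneg _).trans (hR 0 ⟨le_rfl, zero_le_one⟩)))
    rw [Real.norm_eq_abs, hD.abs_cross_tangentRho hq]
    exact (hM _ hq).2
  · obtain ⟨h1, h2⟩ := hinner ρ hρ
    have h3 : ∀ n, cross (u (D.map (ρ, b n))) (D.tangentRho (ρ, b n)) =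
      cross (u (D.map (ρ, 0))) (D.tangentRho (ρ, 0)) := fun n =>
      hD.cross_tangentRho_eq hK hH hu h1 _ _
    simp only [h3]
    have := (((hGc.tendsto c).comp (hb ρ h1)).mul_const
      (cross (u (D.map (ρ, 0))) (D.tangentRho (ρ, 0)))).const_mul (D.bump ρ)
    rw [mul_left_comm] at this
    exact this

/-- The flux through a tube is controlled by the energy in the tube. -/
theorem flux_le (hθ : IsProfile bc H κ r f u θ τ) (hf : IsReaction f)
    (hu : IsFlow bc H u) (hH : 0 < H) (hg : IsCutoff f g G B) (hκ : 0 < κ) (hv : 0 < v₀)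
    (hr : r = v₀ ^ 2 / κ) (hK : 0 < K) (hD : D.IsPercolating bc H K u)
    (hint : IntegrableOn (fun q => energyDensity (bc.yRange H) κ r f θ τ (D.map q) *
      |D.jacobian q|) D.coords) (ξ : ℝ) :
    (G 1 - G 0) * D.flux u ξ ≤ 6 * (B * (1 + 2 * K) * (1 + κ / v₀ / D.h) *
        ∫ q in D.coords, energyDensity (bc.yRange H) κ r f θ τ (D.map q) * |D.jacobian q|) := by
  have hh := hD.h_pos
  have hr0 : 0 < r := by rw [hr]; positivity
  have hcd : D.c - D.h / 2 ≤ D.c + D.h / 2 := by linarith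
  have hY := bc.uniqueDiffOn_yRange hH
  set C := B * (1 + 2 * K) * (1 + κ / v₀ / D.h) *
        ∫ q in D.coords, energyDensity (bc.yRange H) κ r f θ τ (D.map q) * |D.jacobian q| with hC
  set α : ℝ → ℝ := fun ρ => cross (u (D.map (ρ, 0))) (D.tangentRho (ρ, 0)) with hα
  have hinner : Icc (D.c - D.h / 2) (D.c + D.h / 2) ⊆ Ioo (D.c - D.h) (D.c + D.h) := fun ρ hρ =>
    ⟨by linarith [hρ.1], by linarith [hρ.2]⟩
  obtain ⟨r1, r2, -, -⟩ := Tube.contDiffOn_tangents hD.contDiffOn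
  have hmc := hD.contDiffOn.continuousOn
  -- passage to the limit
  have hmain : (G 1 - G 0) * |∫ ρ in (D.c - D.h / 2)..(D.c + D.h / 2), D.bump ρ * α ρ| ≤ C := by
    obtain ⟨b, hb, hbt⟩ := hθ.exists_tube_sections hf hH hg hκ hr0 hK hD hint
      (S := fun n : ℕ => Ioi (n : ℝ)) (fun n => by simp)
    obtain ⟨a, ha, hat⟩ := hθ.exists_tube_sections hf hH hg hκ hr0 hK hD hint
      (S := fun n : ℕ => Iio (-n : ℝ)) (fun n => by simp)
    have hnat : Tendsto (fun n : ℕ => (n : ℝ)) atTop atTop := tendsto_natCast_atTop_atTop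
    have hbtop : Tendsto b atTop atTop := tendsto_atTop_mono (fun n => le_of_lt (hb n)) hnat
    have habot : Tendsto a atTop atBot := tendsto_atBot_mono (fun n => le_of_lt (ha n))
      (tendsto_neg_atTop_atBot.comp hnat)
    have hmem : ∀ ρ ∈ Ioo (D.c - D.h) (D.c + D.h), ∀ ξ, D.map (ρ, ξ) ∈ bc.domain H := fun ρ hρ ξ =>
      hD.mapsTo ⟨hρ, mem_univ _⟩
    have cb := hθ.tendsto_convective hu hH hg hK hD (b := b) fun ρ hρ =>
      hθ.tendsto_zero (fun n => hmem ρ hρ (b n)) ((hD.right_end ρ hρ).comp hbtop)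
    have ca := hθ.tendsto_convective hu hH hg hK hD (b := a) fun ρ hρ =>
      hθ.tendsto_one (fun n => hmem ρ hρ (a n)) ((hD.left_end ρ hρ).comp habot)
    have hlim := (((cb.sub (hbt.const_mul κ)).sub (ca.sub (hat.const_mul κ)))).abs
    rw [mul_zero, sub_zero, sub_zero] at hlim
    have hle := le_of_tendsto' hlim (b := C) (fun n => ?_)
    · rw [← sub_mul, abs_mul, abs_sub_comm, abs_of_pos (sub_pos.2 hg.lt)] at hle
      exact hle
    · have hab : a n ≤ b n := by
        have := mem_Iio.1 (ha n); have := mem_Ioi.1 (hb n); have : (0 : ℝ) ≤ n := n.cast_nonneg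
        linarith
      have h := hθ.abs_sub_sections_le hf hu hH hg hκ hv hr hK hD hint hab
      have hsplit : ∀ ξ : ℝ, ∫ ρ in (D.c - D.h / 2)..(D.c + D.h / 2), D.bump ρ *
          D.pullSnd (fluxFst κ u g G θ) (fluxSnd (bc.yRange H) κ u g G θ) (ρ, ξ) =
          (∫ ρ in (D.c - D.h / 2)..(D.c + D.h / 2), D.bump ρ *
            (G (θ (D.map (ρ, ξ))) * cross (u (D.map (ρ, ξ))) (D.tangentRho (ρ, ξ)))) -
          κ * ∫ ρ in (D.c - D.h / 2)..(D.c + D.h / 2), D.bump ρ * (g (θ (D.map (ρ, ξ))) *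
            cross (partialFst θ (D.map (ρ, ξ)), partialSnd (bc.yRange H) θ (D.map (ρ, ξ)))
            (D.tangentRho (ρ, ξ))) := by
        intro ξ
        have hline : ∀ {φ : ℝ × ℝ → ℝ}, ContinuousOn φ D.coords →
            IntervalIntegrable (fun ρ => D.bump ρ * φ (ρ, ξ)) volume (D.c - D.h / 2)
              (D.c + D.h / 2) := fun hφ =>
          ContinuousOn.intervalIntegrable_of_Icc hcd (D.continuous_bump.continuousOn.mul
            (hφ.comp (by fun_prop) fun ρ hρ => ⟨hinner hρ, mem_univ _⟩))
        have hθc := hθ.contDiffOn.continuousOn.comp hmc hD.mapsTo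
        have hxc : ContinuousOn (partialFst θ) (bc.domain H) :=
          (contDiffOn_partialFst (m := 0) isOpen_univ hY hθ.contDiffOn (by norm_num)).continuousOn
        have hyc : ContinuousOn (partialSnd (bc.yRange H) θ) (bc.domain H) :=
          (contDiffOn_partialSnd (m := 0) isOpen_univ hY hθ.contDiffOn (by norm_num)).continuousOn
        have i1 := hline (φ := fun q => G (θ (D.map q)) * cross (u (D.map q)) (D.tangentRho q))
          ((hg.contDiff_primitive.continuous.comp_continuousOn hθc).mul
          (((hu.contDiffOn.fst.continuousOn.comp hmc hD.mapsTo).mul r2.continuousOn).sub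
            ((hu.contDiffOn.snd.continuousOn.comp hmc hD.mapsTo).mul r1.continuousOn)))
        have i2 := hline (φ := fun q => g (θ (D.map q)) *
            cross (partialFst θ (D.map q), partialSnd (bc.yRange H) θ (D.map q)) (D.tangentRho q))
          ((hg.contDiff.continuous.comp_continuousOn hθc).mul
          (((hxc.comp hmc hD.mapsTo).mul r2.continuousOn).sub
            ((hyc.comp hmc hD.mapsTo).mul r1.continuousOn)))
        rw [← intervalIntegral.integral_const_mul, ← intervalIntegral.integral_sub i1
          (i2.const_mul κ)]
        refine intervalIntegral.integral_congr fun ρ _ => ?_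
        simp only [pullSnd_flux]
        ring
      rw [hsplit, hsplit] at h
      exact h
  -- the flux density has a sign and oscillates little
  obtain ⟨M, hM⟩ := hD.oscillation
  have hαabs : ∀ ρ ∈ Icc (D.c - D.h / 2) (D.c + D.h / 2), M / 2 ≤ |α ρ| := fun ρ hρ => by
    rw [hα, hD.abs_cross_tangentRho ⟨hinner hρ, mem_univ _⟩]
    exact (hM _ ⟨hinner hρ, mem_univ _⟩).1
  have hαne : ∀ ρ ∈ Icc (D.c - D.h / 2) (D.c + D.h / 2), α ρ ≠ 0 := fun ρ hρ h0 => by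
    have hq : (ρ, (0 : ℝ)) ∈ D.coords := ⟨hinner hρ, mem_univ _⟩
    have h1 := hD.abs_cross_tangentRho hq
    have h2 : cross (u (D.map (ρ, 0))) (D.tangentRho (ρ, 0)) = 0 := h0
    rw [h2, abs_zero] at h1
    have h3 : euclLength (u (D.map (ρ, 0))) = 0 :=
      (mul_eq_zero.1 h1.symm).resolve_left (hD.E₁_pos hK hq).ne'
    have h4 := euclLength_sq (u (D.map (ρ, 0)))
    rw [h3] at h4
    have h5 : (u (D.map (ρ, 0))).1 = 0 := by nlinarith
    have h6 : (u (D.map (ρ, 0))).2 = 0 := by nlinarith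
    have := hD.direction _ hq
    rw [h5, h6] at this
    simp at this
  have hαc : ContinuousOn α (Icc (D.c - D.h / 2) (D.c + D.h / 2)) := by
    have : ContinuousOn (fun q => cross (u (D.map q)) (D.tangentRho q)) D.coords :=
      ((hu.contDiffOn.fst.continuousOn.comp hmc hD.mapsTo).mul r2.continuousOn).sub
        ((hu.contDiffOn.snd.continuousOn.comp hmc hD.mapsTo).mul r1.continuousOn)
    exact this.comp (by fun_prop) fun ρ hρ => ⟨hinner hρ, mem_univ _⟩
  have hαi : IntervalIntegrable (fun ρ => D.bump ρ * α ρ) volume (D.c - D.h / 2) (D.c + D.h / 2) :=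
    ContinuousOn.intervalIntegrable_of_Icc hcd (D.continuous_bump.continuousOn.mul hαc)
  have hbi : IntervalIntegrable (fun ρ => D.bump ρ * (M / 2)) volume (D.c - D.h / 2)
      (D.c + D.h / 2) := (D.continuous_bump.intervalIntegrable _ _).mul_const _
  have hbint : ∫ ρ in (D.c - D.h / 2)..(D.c + D.h / 2), D.bump ρ * (M / 2) = M * D.h / 3 := by
    rw [intervalIntegral.integral_mul_const, Tube.integral_bump hh]; ring
  -- α is continuous and never zero, so it keeps one sign and no cancellation occurs: M/2 times the
  -- mass 2h/3 of the cutoff is a lower bound.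
  have hlow : M * D.h / 3 ≤ |∫ ρ in (D.c - D.h / 2)..(D.c + D.h / 2), D.bump ρ * α ρ| := by
    have hsign : (∀ ρ ∈ Icc (D.c - D.h / 2) (D.c + D.h / 2), 0 < α ρ) ∨
        ∀ ρ ∈ Icc (D.c - D.h / 2) (D.c + D.h / 2), α ρ < 0 := by
      by_contra! hcon
      obtain ⟨⟨ρ₁, h1, h1'⟩, ρ₂, h2, h2'⟩ := hcon
      obtain ⟨ρ, hρ, h0⟩ := isPreconnected_Icc.intermediate_value h1 h2 hαc ⟨h1', h2'⟩
      exact hαne ρ hρ h0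
    rcases hsign with hs | hs
    · refine le_trans ?_ (le_abs_self _)
      rw [← hbint]
      refine intervalIntegral.integral_mono_on hcd hbi hαi fun ρ hρ => ?_
      have := hαabs ρ hρ
      rw [abs_of_pos (hs ρ hρ)] at this
      exact mul_le_mul_of_nonneg_left this (Tube.bump_nonneg hh hρ)
    · refine le_trans ?_ (neg_le_abs _)
      rw [← hbint, ← intervalIntegral.integral_neg]
      refine intervalIntegral.integral_mono_on hcd hbi hαi.neg fun ρ hρ => ?_
      have := hαabs ρ hρ
      rw [abs_of_neg (hs ρ hρ)] at this
      have := mul_le_mul_of_nonneg_left this (Tube.bump_nonneg hh hρ)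
      linarith
  have hflux : D.flux u ξ ≤ 2 * D.h * M := by
    refine (le_abs_self _).trans ?_
    have hle : D.c - D.h ≤ D.c + D.h := by linarith
    have := intervalIntegral.norm_integral_le_of_norm_le_const_ae (C := M) (a := D.c - D.h)
      (b := D.c + D.h) (f := fun ρ => euclLength (u (D.map (ρ, ξ))) * D.E₁ (ρ, ξ)) ?_
    · rw [Real.norm_eq_abs, show D.c + D.h - (D.c - D.h) = 2 * D.h by ring,
        abs_of_pos (by positivity : 0 < 2 * D.h)] at this
      exact this.trans_eq (mul_comm _ _)
    -- The half-open interval of integration contains c + h, which lies outside the open coordinate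
    -- domain.
    · have hne : ∀ᵐ ρ : ℝ, ρ ≠ D.c + D.h := by
        rw [ae_iff]; simp
      filter_upwards [hne] with ρ hρ hmem
      rw [uIoc_of_le hle] at hmem
      have hq : (ρ, ξ) ∈ D.coords := ⟨⟨hmem.1, lt_of_le_of_ne hmem.2 hρ⟩, mem_univ _⟩
      rw [Real.norm_of_nonneg (mul_nonneg (euclLength_nonneg _) (hD.E₁_pos hK hq).le), mul_comm]
      exact (hM _ hq).2
  have hγ : 0 < G 1 - G 0 := sub_pos.2 hg.lt
  -- The factor 6 is the ratio of the upper bound 2hM for the full flux to the lower bound Mh/3 for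
  -- the cut-off flux.
  calc (G 1 - G 0) * D.flux u ξ ≤ (G 1 - G 0) * (2 * D.h * M) := by gcongr
    _ = 6 * ((G 1 - G 0) * (M * D.h / 3)) := by ring
    _ ≤ 6 * ((G 1 - G 0) * |∫ ρ in (D.c - D.h / 2)..(D.c + D.h / 2), D.bump ρ * α ρ|) := by gcongr
    _ ≤ 6 * C := by gcongr

end IsProfile

/-! ### Disjoint tubes -/

section Unfold

open scoped ENNReal

/-- A set that does not overlap its vertical translates has no more mass than a period cell. -/
theorem lintegral_le_strip_of_disjoint_translates {H : ℝ} (hH : 0 < H) {w : ℝ × ℝ → ℝ≥0∞}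
    (hw : ∀ x y, w (x, y + H) = w (x, y)) {A : Set (ℝ × ℝ)} (hA : MeasurableSet A)
    (hdisj : ∀ p ∈ A, ∀ q ∈ A, ∀ n : ℤ, p = q + (0, n * H) → n = 0) :
    ∫⁻ p in A, w p ≤ ∫⁻ p in strip H, w p := by
  have hper : ∀ (x y : ℝ) (n : ℤ), w (x, y + n * H) = w (x, y) := fun x y n => by
    have h : Function.Periodic (fun y => w (x, y)) H := fun y => hw x y
    exact h.int_mul n y
  -- A is cut by horizontal strips of height H and each piece is moved into the base strip. The
  -- moved pieces stay disjoint, since an overlap would give two points of A that differ by a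
  -- nonzero multiple of (0, H).
  set S : ℤ → Set (ℝ × ℝ) := fun n => univ ×ˢ Ico (n * H) ((n + 1) * H) with hS
  have hSm : ∀ n, MeasurableSet (S n) := fun n => MeasurableSet.univ.prod measurableSet_Ico
  have hSmem : ∀ n p, p ∈ S n ↔ ⌊p.2 / H⌋ = n := fun n p => by
    rw [Int.floor_eq_iff, le_div_iff₀ hH, div_lt_iff₀ hH]
    exact ⟨fun h => h.2, fun h => ⟨mem_univ _, h⟩⟩
  have hSun : A = ⋃ n, A ∩ S n := by
    ext p
    simp only [mem_iUnion, mem_inter_iff, hSmem]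
    exact ⟨fun h => ⟨_, h, rfl⟩, fun ⟨_, h, _⟩ => h⟩
  have hSd : Pairwise (Function.onFun Disjoint fun n => A ∩ S n) := fun m n hmn =>
    Set.disjoint_left.2 fun p hp hp' => hmn (((hSmem _ _).1 hp.2).symm.trans ((hSmem _ _).1 hp'.2))
  set B : ℤ → Set (ℝ × ℝ) := fun n => (fun p : ℝ × ℝ => p + (0, n * H)) ⁻¹' (A ∩ S n) with hB
  have hmp : ∀ n : ℤ, MeasurePreserving (fun p : ℝ × ℝ => p + (0, (n : ℝ) * H)) volume volume :=
    fun n => measurePreserving_add_right volume (0, (n : ℝ) * H)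
  have hBm : ∀ n, MeasurableSet (B n) := fun n => (hmp n).measurable (hA.inter (hSm n))
  have hBd : Pairwise (Function.onFun Disjoint B) := fun m n hmn =>
    Set.disjoint_left.2 fun p hp hp' => hmn <| by
      have := hdisj _ hp.1 _ hp'.1 (m - n) (by
        refine Prod.ext ?_ ?_ <;> simp
        ring)
      omega
  have hBs : ∀ n, B n ⊆ strip H := fun n p hp => by
    have h1 : (p + (0, (n : ℝ) * H)) ∈ S n := hp.2
    have h2 : p.2 + n * H ∈ Ico (n * H) ((n + 1) * H) := h1.2
    exact ⟨mem_univ _, by linarith [h2.1], by linarith [h2.2]⟩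
  have heq : ∀ n, ∫⁻ p in A ∩ S n, w p = ∫⁻ p in B n, w p := fun n => by
    have he : MeasurableEmbedding (fun p : ℝ × ℝ => p + (0, (n : ℝ) * H)) :=
      measurableEmbedding_addRight _
    rw [← (hmp n).setLIntegral_comp_preimage_emb he w (A ∩ S n)]
    refine lintegral_congr fun p => ?_
    change w (p.1 + 0, p.2 + n * H) = w p
    rw [add_zero, hper]
  calc ∫⁻ p in A, w p = ∑' n, ∫⁻ p in A ∩ S n, w p := by
        conv_lhs => rw [hSun]
        exact lintegral_iUnion (fun n => hA.inter (hSm n)) hSd _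
    _ = ∑' n, ∫⁻ p in B n, w p := by simp only [heq]
    _ = ∫⁻ p in ⋃ n, B n, w p := (lintegral_iUnion hBm hBd _).symm
    _ ≤ ∫⁻ p in strip H, w p := lintegral_mono_set (iUnion_subset hBs)

end Unfold

theorem Tube.IsPercolating.hasFDerivWithinAt {D : Tube} {bc : BoundaryKind} {H K : ℝ}
    {u : ℝ × ℝ → ℝ × ℝ} (hD : D.IsPercolating bc H K u) {q : ℝ × ℝ} (hq : q ∈ D.coords) :
    HasFDerivWithinAt D.map (fderivWithin ℝ D.map D.coords q) D.coords q :=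
  (hD.contDiffOn.differentiableOn two_ne_zero q hq).hasFDerivWithinAt

/-- A nonnegative density, integrated over disjoint tubes, is at most its integral over a period
cell. -/
theorem sum_integral_tubes_le {bc : BoundaryKind} {H K : ℝ} {u : ℝ × ℝ → ℝ × ℝ} (hH : 0 < H)
    {N : ℕ} {D : Fin N → Tube} (hD : ∀ j, (D j).IsPercolating bc H K u) (hdisj : TubesDisjoint H D)
    {W : ℝ × ℝ → ℝ} (hW0 : ∀ p ∈ bc.domain H, 0 ≤ W p) (hWc : ContinuousOn W (bc.domain H))
    (hWi : IntegrableOn W (strip H))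
    (hper : bc = BoundaryKind.periodic → ∀ x y, W (x, y + H) = W (x, y)) :
    (∀ j, IntegrableOn (fun q => W ((D j).map q) * |(D j).jacobian q|) (D j).coords) ∧
      ∑ j, ∫ q in (D j).coords, W ((D j).map q) * |(D j).jacobian q| ≤ ∫ p in strip H, W p := by
  set A : Fin N → Set (ℝ × ℝ) := fun j => (D j).map '' (D j).coords with hA
  have hinj : ∀ j, InjOn (D j).map (D j).coords := fun j p hp q hq h =>
    (hdisj j j p hp q hq 0 (by simp [h, ← Prod.zero_eq_mk])).2
  have hAm : ∀ j, MeasurableSet (A j) := fun j =>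
    (D j).isOpen_coords.measurableSet.image_of_continuousOn_injOn (hD j).contDiffOn.continuousOn
      (hinj j)
  have hAd : Pairwise (Function.onFun Disjoint A) := fun i j hij =>
    Set.disjoint_left.2 fun _ ⟨q, hq, e⟩ ⟨q', hq', e'⟩ =>
      hij (hdisj i j q hq q' hq' 0 (by simp [e, e', ← Prod.zero_eq_mk])).1
  have hAsub : ∀ j, A j ⊆ bc.domain H := fun j => (hD j).mapsTo.image_subset
  -- Between walls the tubes lie in the strip itself. In the periodic problem they may wander
  -- through the plane and are folded into one cell.
  have hle : ∫⁻ p in ⋃ j, A j, ENNReal.ofReal (W p) ≤ ∫⁻ p in strip H, ENNReal.ofReal (W p) := by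
    cases bc
    · exact lintegral_mono_set (iUnion_subset hAsub)
    · refine lintegral_le_strip_of_disjoint_translates hH (fun x y => by rw [hper rfl])
        (MeasurableSet.iUnion hAm) ?_
      intro p hp q hq n h
      obtain ⟨i, p', hp', rfl⟩ := mem_iUnion.1 hp
      obtain ⟨j, q', hq', rfl⟩ := mem_iUnion.1 hq
      obtain ⟨rfl, rfl⟩ := hdisj i j p' hp' q' hq' n h
      have h2 : ((D i).map p').2 = ((D i).map p').2 + n * H := congrArg Prod.snd h
      have h3 : (n : ℝ) * H = 0 := by linarith
      exact_mod_cast (mul_eq_zero.1 h3).resolve_right hH.ne'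
  rw [lintegral_iUnion hAm hAd, tsum_fintype] at hle
  have hfin : ∫⁻ p in strip H, ENNReal.ofReal (W p) < ⊤ := hWi.lintegral_lt_top
  have hdet : ∀ j, EqOn (fun q => |(fderivWithin ℝ (D j).map (D j).coords q).det| • W ((D j).map q))
      (fun q => W ((D j).map q) * |(D j).jacobian q|) (D j).coords := fun j q hq => by
    simp only [Tube.det_fderiv_map (hD j).contDiffOn hq, smul_eq_mul, mul_comm]
  have hAi : ∀ j, IntegrableOn W (A j) := fun j => by
    refine ⟨(hWc.mono (hAsub j)).aestronglyMeasurable (hAm j), ?_⟩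
    rw [hasFiniteIntegral_iff_ofReal]
    · exact (Finset.single_le_sum (f := fun j => ∫⁻ p in A j, ENNReal.ofReal (W p))
        (fun _ _ => zero_le) (Finset.mem_univ j)).trans_lt (hle.trans_lt hfin)
    · filter_upwards [ae_restrict_mem (hAm j)] with p hp
      exact hW0 p (hAsub j hp)
  have hcv : ∀ j, ∫ q in (D j).coords, W ((D j).map q) * |(D j).jacobian q| = ∫ p in A j, W p :=
    fun j => by
      rw [hA, integral_image_eq_integral_abs_det_fderiv_smul volume
        (D j).isOpen_coords.measurableSet (fun q hq => (hD j).hasFDerivWithinAt hq) (hinj j)]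
      exact (setIntegral_congr_fun (D j).isOpen_coords.measurableSet (hdet j)).symm
  refine ⟨fun j => ?_, ?_⟩
  · have := (integrableOn_image_iff_integrableOn_abs_det_fderiv_smul volume
      (D j).isOpen_coords.measurableSet (fun q hq => (hD j).hasFDerivWithinAt hq) (hinj j) W).1
      (hAi j)
    exact this.congr_fun (hdet j) (D j).isOpen_coords.measurableSet
  · simp only [hcv]
    have hof : ∀ j, ENNReal.ofReal (∫ p in A j, W p) = ∫⁻ p in A j, ENNReal.ofReal (W p) := fun j =>
      ofReal_integral_eq_lintegral_ofReal (hAi j) (by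
        filter_upwards [ae_restrict_mem (hAm j)] with p hp
        exact hW0 p (hAsub j hp))
    have hofs : ENNReal.ofReal (∫ p in strip H, W p) = ∫⁻ p in strip H, ENNReal.ofReal (W p) :=
      ofReal_integral_eq_lintegral_ofReal hWi (by
        filter_upwards [ae_restrict_mem (measurableSet_strip H)] with p hp
        exact hW0 p (bc.strip_subset_domain H hp))
    have hA0 : ∀ j, 0 ≤ ∫ p in A j, W p := fun j =>
      setIntegral_nonneg (hAm j) fun p hp => hW0 p (hAsub j hp)
    have hs0 : 0 ≤ ∫ p in strip H, W p :=
      setIntegral_nonneg (measurableSet_strip H) fun p hp => hW0 p (bc.strip_subset_domain H hp)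
    simp only [← hof, ← hofs] at hle
    rw [← ENNReal.ofReal_sum_of_nonneg fun j _ => hA0 j] at hle
    exact (ENNReal.ofReal_le_ofReal_iff hs0).1 hle

/-! ### Assembly of the lower bound. -/

theorem IsSolution.isProfile {bc : BoundaryKind} {H κ v₀ : ℝ} {f : ℝ → ℝ} {u : ℝ × ℝ → ℝ × ℝ}
    {T : ℝ → ℝ × ℝ → ℝ} (hT : IsSolution bc H κ v₀ f u T) (hf : IsReaction f) (hu : IsFlow bc H u)
    (hH : 0 < H) (hκ : 0 < κ) (hdec : InitialDecay bc H (T 0))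
    (hmono : InitialMonotonicity bc H κ v₀ f u (T 0)) {t : ℝ} (ht : 0 < t) :
    IsProfile bc H κ (v₀ ^ 2 / κ) f u (T t) (fun p => deriv (fun s => T s p) t) where
  contDiffOn := hT.contDiffOn t ht.le
  mem_Icc := hT.mem_Icc t ht.le
  equation := hT.equation t ht
  nonneg _ hp := hT.deriv_nonneg hf hu hH hκ hmono ht hp
  boundary := hT.boundary t ht.le
  decay := hT.exists_decay hf hu hH hκ hdec ht.le

/-- The energy density of a solution of the periodic problem is periodic. -/
theorem IsSolution.energyDensity_periodic {H κ v₀ r : ℝ} {f : ℝ → ℝ} {u : ℝ × ℝ → ℝ × ℝ}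
    {T : ℝ → ℝ × ℝ → ℝ} (hT : IsSolution .periodic H κ v₀ f u T) {t : ℝ} (ht : 0 < t) (x y : ℝ) :
    energyDensity univ κ r f (T t) (fun p => deriv (fun s => T s p) t) (x, y + H) =
      energyDensity univ κ r f (T t) (fun p => deriv (fun s => T s p) t) (x, y) := by
  have hper : ∀ s, 0 ≤ s → ∀ x y, T s (x, y + H) = T s (x, y) := fun s hs => hT.boundary s hs
  have e1 : deriv (fun s => T s (x, y + H)) t = deriv (fun s => T s (x, y)) t := by
    refine EventuallyEq.deriv_eq ?_
    filter_upwards [lt_mem_nhds ht] with s hs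
    exact hper s (le_of_lt hs) x y
  have e2 : partialFst (T t) (x, y + H) = partialFst (T t) (x, y) := by
    simp only [partialFst, hper t ht.le]
  have e3 : partialSnd univ (T t) (x, y + H) = partialSnd univ (T t) (x, y) := by
    simp only [partialSnd, derivWithin_univ]
    rw [← deriv_comp_add_const (fun s => T t (x, s)) H y]
    simp only [hper t ht.le]
  simp only [energyDensity, gradSq, e1, e2, e3, hper t ht.le]

end PercolatingFlow

theorem theorem4 (f : ℝ → ℝ) (hf : IsReaction f) (K : ℝ) (hK : 0 < K) :
    ∃ C : ℝ, 0 < C ∧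
      ∀ (bc : BoundaryKind) (H κ v₀ : ℝ), 0 < H → 0 < κ → 0 < v₀ →
      ∀ u : ℝ × ℝ → ℝ × ℝ, IsFlow bc H u →
      ∀ (N : ℕ) (D : Fin N → Tube), (∀ j, (D j).IsPercolating bc H K u) → TubesDisjoint H D →
      ∀ T : ℝ → ℝ × ℝ → ℝ, IsSolution bc H κ v₀ f u T →
        InitialDecay bc H (T 0) → InitialMonotonicity bc H κ v₀ f u (T 0) →
      ∀ t : ℝ, 0 < t →
        IntegrableOn (fun p => deriv (fun s => T s p) t) (strip H) ∧
        ∀ ξ : Fin N → ℝ,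
          C * (v₀ + ∑ j, (1 + κ / v₀ / (D j).h)⁻¹ * ((D j).flux u (ξ j) / H))
            ≤ bulkBurningRate H T t := by
  obtain ⟨g, G, B, hg⟩ := hf.exists_isCutoff
  have hγ : 0 < G 1 - G 0 := sub_pos.2 hg.lt
  have hB := hg.one_le
  have hC : 0 < B + 18 * (B * (1 + 2 * K)) := by positivity
  -- The summand B comes from `speed_le`; the other is the factor 6B(1 + 2K) of `flux_le` times the
  -- bound 3 for the total energy.
  refine ⟨(G 1 - G 0) / (B + 18 * (B * (1 + 2 * K))), by positivity, ?_⟩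
  intro bc H κ v₀ hH hκ hv u hu N D hD hdisj T hT hdec hmono t ht
  have hr : 0 < v₀ ^ 2 / κ := by positivity
  have hθ := hT.isProfile hf hu hH hκ hdec hmono ht
  set τ : ℝ × ℝ → ℝ := fun p => deriv (fun s => T s p) t with hτ
  obtain ⟨hτi, hτeq⟩ := hθ.integral_time_deriv hf hu hH
  refine ⟨hτi, fun ξ => ?_⟩
  obtain ⟨hgi, hgle⟩ := hθ.integral_gradSq_le hf hu hH hκ hr.le
  have hfi := hθ.integrableOn_reaction hf
  have hspeed := hθ.speed_le hf hu hH hκ hr hg (v₀ := v₀) (by field_simp)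
  rw [← hτeq] at hspeed hgle
  -- This V is not divided by H.
  set V := ∫ p in strip H, τ p with hV
  have hWi : IntegrableOn (energyDensity (bc.yRange H) κ (v₀ ^ 2 / κ) f (T t) τ) (strip H) :=
    (hτi.add (hgi.const_mul κ)).add (hfi.const_mul (v₀ ^ 2 / κ))
  -- Burning and reaction contribute V each, the dissipation at most V.
  have hWle : ∫ p in strip H, energyDensity (bc.yRange H) κ (v₀ ^ 2 / κ) f (T t) τ p ≤ 3 * V := by
    have h1 : ∫ p in strip H, energyDensity (bc.yRange H) κ (v₀ ^ 2 / κ) f (T t) τ p =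
        V + κ * (∫ p in strip H, gradSq (bc.yRange H) (T t) p) +
          v₀ ^ 2 / κ * ∫ p in strip H, f (T t p) := by
      simp only [energyDensity]
      have i1 : IntegrableOn (fun p => τ p + κ * gradSq (bc.yRange H) (T t) p) (strip H) :=
        hτi.add (hgi.const_mul κ)
      rw [integral_add i1 (hfi.const_mul _), integral_add hτi (hgi.const_mul κ),
        integral_const_mul, integral_const_mul]
    rw [h1]
    linarith
  have hWc : ContinuousOn (energyDensity (bc.yRange H) κ (v₀ ^ 2 / κ) f (T t) τ) (bc.domain H) :=
    ((hθ.continuousOn_time_deriv hf hu hH).add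
      (continuousOn_const.mul (hθ.continuousOn_gradSq hH))).add
      (continuousOn_const.mul (hθ.continuousOn_reaction hf))
  have hW0 : ∀ p ∈ bc.domain H, 0 ≤ energyDensity (bc.yRange H) κ (v₀ ^ 2 / κ) f (T t) τ p :=
    fun p hp => by
      have := hf.nonneg_Icc (hθ.mem_Icc p hp)
      have : 0 ≤ τ p := hθ.nonneg p hp
      have := gradSq_nonneg (bc.yRange H) (T t) p
      unfold energyDensity
      positivity
  obtain ⟨hint, hsum⟩ := sum_integral_tubes_le hH hD hdisj hW0 hWc hWi (by
    rintro rfl x y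
    exact hT.energyDensity_periodic ht x y)
  have htube : ∀ j, (G 1 - G 0) * ((1 + κ / v₀ / (D j).h)⁻¹ * (D j).flux u (ξ j)) ≤
      6 * (B * (1 + 2 * K)) * ∫ q in (D j).coords,
        energyDensity (bc.yRange H) κ (v₀ ^ 2 / κ) f (T t) τ ((D j).map q) * |(D j).jacobian q| := by
    intro j
    have hh := (hD j).h_pos
    have hl : 0 < 1 + κ / v₀ / (D j).h := by positivity
    have := mul_le_mul_of_nonneg_left
      (hθ.flux_le hf hu hH hg hκ hv rfl hK (hD j) (hint j) (ξ j)) (inv_pos.2 hl).le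
    set I := ∫ q in (D j).coords,
        energyDensity (bc.yRange H) κ (v₀ ^ 2 / κ) f (T t) τ ((D j).map q) * |(D j).jacobian q|
    calc _ = (1 + κ / v₀ / (D j).h)⁻¹ * ((G 1 - G 0) * (D j).flux u (ξ j)) := by ring
      _ ≤ _ := this
      _ = 6 * (B * (1 + 2 * K)) * ((1 + κ / v₀ / (D j).h)⁻¹ * (1 + κ / v₀ / (D j).h)) * I := by ring
      _ = _ := by rw [inv_mul_cancel₀ hl.ne', mul_one]
  have hall := (Finset.sum_le_sum fun j (_ : j ∈ Finset.univ) => htube j)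
  rw [← Finset.mul_sum, ← Finset.mul_sum] at hall
  have hall2 := hall.trans (mul_le_mul_of_nonneg_left (hsum.trans hWle)
    (by positivity : 0 ≤ 6 * (B * (1 + 2 * K))))
  have hfac : ∑ j, (1 + κ / v₀ / (D j).h)⁻¹ * ((D j).flux u (ξ j) / H) =
      (∑ j, (1 + κ / v₀ / (D j).h)⁻¹ * (D j).flux u (ξ j)) / H := by
    rw [Finset.sum_div]
    exact Finset.sum_congr rfl fun j _ => (mul_div_assoc _ _ _).symm
  rw [hfac, bulkBurningRate, ← hV, le_div_iff₀ hH, div_mul_eq_mul_div, div_mul_eq_mul_div,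
    div_le_iff₀ hC]
  have : (G 1 - G 0) * (v₀ + (∑ j, (1 + κ / v₀ / (D j).h)⁻¹ * (D j).flux u (ξ j)) / H) * H =
      (G 1 - G 0) * (v₀ * H) +
        (G 1 - G 0) * ∑ j, (1 + κ / v₀ / (D j).h)⁻¹ * (D j).flux u (ξ j) := by
    field_simp
  rw [this]
  linarith
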